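/- Let $n\ge 2$ and $0\le\kappa\le n$ be integers, with $\kappa\ne 1$ when $n=2$. Equip $\mathbf R^{2n}$, with coordinates $(x_1,\dots,x_n,y_1,\dots,y_n)$, with the symplectic form $\omega=dx_1\wedge dy_1+\dots+dx_n\wedge dy_n$. Then there are complex numbers $\lambda_1,\dots,\lambda_n$ such that (a) $\lambda_j$ is purely imaginary precisely when $1\le j\le\kappa$, and the family $(\lambda_k)_{\kappa<k\le n}$ is closed under complex conjugation; (b) $\lambda_1,\dots,\lambda_n$ are non-resonant: $\lambda_1\alpha_1+\dots+\lambda_n\alpha_n\ne 0$ for all $\alpha\in\mathbf Z^n\setminus\{0\}$; and there is a real-valued real analytic function $h$, defined near $0\in\mathbf R^{2n}$, of the form $$h(x,y)=\frac12\sum_{1\le j\le\kappa} i\lambda_j(x_j^2+y_j^2)+\frac12\,\mathrm{Re}\sum_{\kappa<k,l\le n,\ \lambda_l=\overline{\lambda_k}}\lambda_k(x_k+ix_l)(y_k-iy_l)+O(3),$$ such that the Birkhoff normal form of $h$ is divergent. Here a Birkhoff normal form of $h$ is a real formal power series $\hat h$ with $\hat h=h\circ\varphi^{-1}$ for some formal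 symplectic transformation $\varphi$ of $\mathbf R^{2n}$ fixing $0$, such that $\hat h$ is a formal power series in the quantities $x_j^2+y_j^2$ $(1\le j\le\kappa)$ and $(x_k+ix_l)(y_k-iy_l)$ $(\kappa<k,l\le n,\ \lambda_l=\overline{\lambda_k})$. That the Birkhoff normal form of $h$ is divergent means that $h$ has a Birkhoff normal form and that none of its Birkhoff normal forms converges in a neighbourhood of $0$. -/

import Mathlib

open scoped Topology Matrix ComplexConjugate
open Asymptotics

namespace Birkhoff

/-- The coordinates `(x₁, …, xₙ, y₁, …, yₙ)` of `ℝ²ⁿ`: `Sum.inl j` stands for `x_j` and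
`Sum.inr j` for `y_j`. -/
abbrev Coord (n : ℕ) : Type := Fin n ⊕ Fin n

/-- The Hamiltonian eigenvalues: `λ_j` is purely imaginary exactly for the first `κ` indices, and the
non-real ones among the others come in complex conjugate pairs (the Hamiltonian is real). -/
def IsSpectrum {n : ℕ} (κ : ℕ) (lam : Fin n → ℂ) : Prop :=
  (∀ j : Fin n, (lam j).re = 0 ↔ (j : ℕ) < κ) ∧
    ∀ k : Fin n, κ ≤ (k : ℕ) → ∃ l : Fin n, κ ≤ (l : ℕ) ∧ lam l = conj (lam k)

/-- `λ·α ≠ 0` for every nonzero integer vector `α`. -/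
def NonResonant {n : ℕ} (lam : Fin n → ℂ) : Prop :=
  ∀ α : Fin n → ℤ, α ≠ 0 → ∑ j, lam j * (α j : ℂ) ≠ 0

/-- The ordered pairs `(k, l)` with `κ < k, l ≤ n` (counting from `1`) and `λ_l = conj λ_k`.
For real `λ_k` this includes `(k, k)`. -/
def IsConjPair {n : ℕ} (κ : ℕ) (lam : Fin n → ℂ) (p : Fin n × Fin n) : Prop :=
  κ ≤ (p.1 : ℕ) ∧ κ ≤ (p.2 : ℕ) ∧ lam p.2 = conj (lam p.1)

open Classical in
/-- The quadratic form
`½ ∑_{j ≤ κ} i λ_j (x_j² + y_j²) + ½ Re ∑_{κ < k, l ≤ n, λ_l = conj λ_k} λ_k (x_k + i x_l)(y_k - i y_l)`.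
The numbers `i λ_j` with `j ≤ κ` are real, so that taking the real part only changes the type. -/
noncomputable def quadraticPart {n : ℕ} (κ : ℕ) (lam : Fin n → ℂ) (z : Coord n → ℝ) : ℝ :=
  (1 / 2) * ∑ j ∈ Finset.univ.filter (fun j : Fin n => (j : ℕ) < κ),
      (Complex.I * lam j).re * (z (.inl j) ^ 2 + z (.inr j) ^ 2) +
    (1 / 2) * (∑ p ∈ Finset.univ.filter (fun p : Fin n × Fin n => IsConjPair κ lam p),
      lam p.1 * ((z (.inl p.1) : ℂ) + Complex.I * (z (.inl p.2) : ℂ)) *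
        ((z (.inr p.1) : ℂ) - Complex.I * (z (.inr p.2) : ℂ))).re

/-- The term of multidegree `m` of a power series, evaluated at the point `z`. -/
noncomputable def term {σ : Type*} (H : MvPowerSeries σ ℝ) (z : σ → ℝ) (m : σ →₀ ℕ) : ℝ :=
  MvPowerSeries.coeff m H * m.prod fun i k => z i ^ k

/-- `H` is the power series expansion of `h` at the origin. -/
def HasExpansion {σ : Type*} (h : (σ → ℝ) → ℝ) (H : MvPowerSeries σ ℝ) : Prop :=
  ∀ᶠ z in 𝓝 (0 : σ → ℝ), HasSum (term H z) (h z)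

/-- The formal power series converges in a neighbourhood of the origin. -/
def IsConvergent {σ : Type*} (H : MvPowerSeries σ ℝ) : Prop :=
  ∀ᶠ z in 𝓝 (0 : σ → ℝ), Summable (term H z)

/-- The Jacobian matrix of a formal map, rows indexed by components. -/
noncomputable def jacobian {n : ℕ} (φ : Coord n → MvPowerSeries (Coord n) ℝ) :
    Matrix (Coord n) (Coord n) (MvPowerSeries (Coord n) ℝ) :=
  Matrix.of fun i j => MvPowerSeries.pderiv ℝ j (φ i)

/-- A formal symplectic transformation of `(ℝ²ⁿ, 0)`: a formal map fixing the origin that preserves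
`ω = ∑ dx_j ∧ dy_j`. (Such a map is formally invertible, its linear part being a symplectic
matrix.) -/
def IsFormalSymplectic {n : ℕ} (φ : Coord n → MvPowerSeries (Coord n) ℝ) : Prop :=
  (∀ i, MvPowerSeries.constantCoeff (φ i) = 0) ∧
    (jacobian φ)ᵀ * Matrix.J (Fin n) (MvPowerSeries (Coord n) ℝ) * jacobian φ =
      Matrix.J (Fin n) (MvPowerSeries (Coord n) ℝ)

/-- The quadratic monomials of the normal form: `x_j² + y_j²` for `j ≤ κ` and
`(x_k + i x_l)(y_k - i y_l)` for `κ < k, l ≤ n` with `λ_l = conj λ_k`. -/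
noncomputable def invariants {n : ℕ} (κ : ℕ) (lam : Fin n → ℂ) :
    {j : Fin n // (j : ℕ) < κ} ⊕ {p : Fin n × Fin n // IsConjPair κ lam p} →
      MvPowerSeries (Coord n) ℂ
  | .inl j => MvPowerSeries.X (.inl j.1) ^ 2 + MvPowerSeries.X (.inr j.1) ^ 2
  | .inr p =>
      (MvPowerSeries.X (.inl p.1.1) + MvPowerSeries.C Complex.I * MvPowerSeries.X (.inl p.1.2)) *
        (MvPowerSeries.X (.inr p.1.1) - MvPowerSeries.C Complex.I * MvPowerSeries.X (.inr p.1.2))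

/-- The real formal power series `F` is a formal power series in the `invariants`. The coefficients
of the outer series `g` are complex because the invariants are; `F` itself is real. -/
def IsNormalForm {n : ℕ} (κ : ℕ) (lam : Fin n → ℂ) (F : MvPowerSeries (Coord n) ℝ) : Prop :=
  ∃ g : MvPowerSeries
      ({j : Fin n // (j : ℕ) < κ} ⊕ {p : Fin n × Fin n // IsConjPair κ lam p}) ℂ,
    MvPowerSeries.map Complex.ofRealHom F = MvPowerSeries.subst (invariants κ lam) g

/-- `F` is a Birkhoff normal form of `H`: `F` is in normal form and `F = H ∘ φ⁻¹`, that is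
`F ∘ φ = H`, for some formal symplectic transformation `φ`. -/
def IsBirkhoffNormalFormOf {n : ℕ} (κ : ℕ) (lam : Fin n → ℂ)
    (F H : MvPowerSeries (Coord n) ℝ) : Prop :=
  IsNormalForm κ lam F ∧
    ∃ φ : Coord n → MvPowerSeries (Coord n) ℝ,
      IsFormalSymplectic φ ∧ MvPowerSeries.subst φ F = H

end Birkhoff

/-!
The eigenvalues are `i t_j` for `j < κ` and `t_j` for the other indices, where `t_j = x ^ j` for a
transcendental number `x` that has extremely good rational approximations `p / q`. Two consecutive
eigenvalues of the same type then have extremely small divisors, of size at most `|q x - p|`, which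
are nonzero.

In coordinates diagonalizing the quadratic part, perturb it by a multiple `c` of
`ξ_s ^ p η_t ^ q + η_s ^ p ξ_t ^ q`. Removing this term by a canonical transformation leaves in the
normal form, in degree `2 (p + q) - 2`, a contribution quadratic in `c` with a coefficient of the
size of the inverse divisor. A quadratic polynomial with large leading coefficient is large for at
least one of three values of `c`, whatever the terms of lower degree contribute. Since the terms of
higher degree do not interfere, the multipliers `c` of a sparse sequence of such perturbations can
be chosen one after the other so that infinitely many coefficients of the normal form are too large
for convergence.

Over the complex numbers the normal form of a nonresonant Hamiltonian is unique up to a permutation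
of the planes and signs of the action variables, so every Birkhoff normal form diverges.
-/

namespace Birkhoff

open MvPowerSeries

section Order

variable {σ τ R S : Type*}

/-- The ideal of power series of order at least `N`. The filtration by these ideals replaces the
topology: a series lying in all of them vanishes, and all error terms below are measured by it. -/
def orderGE (σ R : Type*) [CommSemiring R] (N : ℕ) : Ideal (MvPowerSeries σ R) where
  carrier := {f | N ≤ f.order}
  add_mem' hf hg := (le_min hf hg).trans min_order_le_add
  zero_mem' := by simp
  smul_mem' _ _ hf := (le_add_of_le_right hf).trans le_order_mul

section CommSemiring

variable [CommSemiring R] [CommSemiring S] {M N a b : ℕ} {f g : MvPowerSeries σ R}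

theorem mem_orderGE : f ∈ orderGE σ R N ↔ (N : ℕ∞) ≤ f.order := Iff.rfl

theorem mem_orderGE_iff_coeff :
    f ∈ orderGE σ R N ↔ ∀ m : σ →₀ ℕ, m.degree < N → coeff m f = 0 :=
  ⟨fun hf _ hm => coeff_of_lt_order ((Nat.cast_lt.mpr hm).trans_le hf), nat_le_order⟩

theorem coeff_eq_zero_of_mem_orderGE (hf : f ∈ orderGE σ R N) {m : σ →₀ ℕ} (hm : m.degree < N) :
    coeff m f = 0 :=
  mem_orderGE_iff_coeff.mp hf m hm

theorem orderGE_anti (h : M ≤ N) (hf : f ∈ orderGE σ R N) : f ∈ orderGE σ R M :=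
  (Nat.cast_le.mpr h).trans (mem_orderGE.mp hf)

theorem mem_orderGE_zero (f : MvPowerSeries σ R) : f ∈ orderGE σ R 0 := by
  simp [mem_orderGE]

theorem mem_orderGE_one : f ∈ orderGE σ R 1 ↔ constantCoeff f = 0 := by
  rw [mem_orderGE, Nat.cast_one, one_le_order_iff_constCoeff_eq_zero]

theorem eq_zero_of_forall_mem_orderGE (h : ∀ N, f ∈ orderGE σ R N) : f = 0 := by
  ext m
  exact coeff_eq_zero_of_mem_orderGE (h (m.degree + 1)) (Nat.lt_succ_self _)

theorem mul_mem_orderGE (hf : f ∈ orderGE σ R a) (hg : g ∈ orderGE σ R b) :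
    f * g ∈ orderGE σ R (a + b) := by
  rw [mem_orderGE, Nat.cast_add]
  exact (add_le_add hf hg).trans le_order_mul

theorem pow_mem_orderGE (hf : f ∈ orderGE σ R a) (k : ℕ) : f ^ k ∈ orderGE σ R (k * a) := by
  rw [mem_orderGE, Nat.cast_mul, ← nsmul_eq_mul]
  exact (nsmul_le_nsmul_right hf k).trans (le_order_pow k)

theorem smul_mem_orderGE (hf : f ∈ orderGE σ R N) (c : R) : c • f ∈ orderGE σ R N :=
  hf.trans le_order_smul

theorem X_mem_orderGE (i : σ) : (X i : MvPowerSeries σ R) ∈ orderGE σ R 1 :=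
  mem_orderGE_one.mpr (constantCoeff_X i)

theorem map_mem_orderGE (φ : R →+* S) (hf : f ∈ orderGE σ R N) :
    MvPowerSeries.map φ f ∈ orderGE σ S N :=
  hf.trans (le_order_map φ)

theorem pderiv_mem_orderGE (hf : f ∈ orderGE σ R N) (i : σ) :
    pderiv R i f ∈ orderGE σ R (N - 1) := by
  rw [mem_orderGE_iff_coeff]
  intro m hm
  rw [coeff_pderiv, coeff_eq_zero_of_mem_orderGE hf, zero_mul]
  rw [map_add, Finsupp.degree_single]
  omega

theorem pderiv_comm (i j : σ) (f : MvPowerSeries σ R) :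
    pderiv R i (pderiv R j f) = pderiv R j (pderiv R i f) := by
  classical
  ext m
  simp only [coeff_pderiv, Finsupp.add_apply, Finsupp.single_apply]
  rw [add_right_comm]
  rcases eq_or_ne i j with rfl | h
  · rfl
  · simp only [if_neg h, if_neg h.symm, add_zero]
    ring

theorem map_pderiv (φ : R →+* S) (i : σ) (f : MvPowerSeries σ R) :
    MvPowerSeries.map φ (pderiv R i f) = pderiv S i (MvPowerSeries.map φ f) := by
  ext m
  simp [coeff_pderiv]

theorem coeff_X_mul_pderiv (i : σ) (f : MvPowerSeries σ R) (m : σ →₀ ℕ) :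
    coeff m (X i * pderiv R i f) = m i * coeff m f := by
  classical
  rw [X, coeff_monomial_mul, one_mul]
  split_ifs with h
  · rw [coeff_pderiv, tsub_add_cancel_of_le h, mul_comm]
    congr 1
    have hi : 1 ≤ m i := by simpa using h i
    rw [Finsupp.tsub_apply, Finsupp.single_eq_same]
    exact_mod_cast congrArg (Nat.cast (R := R)) (Nat.sub_add_cancel hi)
  · have hi : m i = 0 := by
      by_contra hi
      exact h (by simpa [Nat.one_le_iff_ne_zero] using hi)
    simp [hi]

end CommSemiring

section CommRing

variable [CommRing R] {a : σ → MvPowerSeries τ R}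

theorem exists_forall_sub_mem_orderGE {s : ℕ → MvPowerSeries σ R} {N : ℕ}
    (hs : ∀ k, s (k + 1) - s k ∈ orderGE σ R (N + k)) :
    ∃ f, ∀ k, f - s k ∈ orderGE σ R (N + k) := by
  have cauchy (k j : ℕ) : s (k + j) - s k ∈ orderGE σ R (N + k) := by
    induction j with
    | zero => simp
    | succ j ih =>
      rw [← add_assoc, ← sub_add_sub_cancel]
      exact Ideal.add_mem _ (orderGE_anti (by omega) (hs (k + j))) ih
  have coeff_eq (k j : ℕ) {m : σ →₀ ℕ} (hm : m.degree < N + k) :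
      coeff m (s (k + j)) = coeff m (s k) :=
    sub_eq_zero.mp (by rw [← map_sub]; exact coeff_eq_zero_of_mem_orderGE (cauchy k j) hm)
  let f : MvPowerSeries σ R := fun m => coeff m (s (m.degree + 1))
  have coeff_f (m) : coeff m f = coeff m (s (m.degree + 1)) := rfl
  refine ⟨f, fun k => mem_orderGE_iff_coeff.mpr fun m hm => ?_⟩
  rw [map_sub, sub_eq_zero, coeff_f]
  rcases le_total (m.degree + 1) k with hk | hk
  · obtain ⟨j, rfl⟩ := Nat.exists_eq_add_of_le hk
    exact (coeff_eq _ j (by omega)).symm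
  · obtain ⟨j, hj⟩ := Nat.exists_eq_add_of_le hk
    rw [hj, coeff_eq k j hm]

theorem sub_truncTotal_mem_orderGE [Finite σ] (N : ℕ) (f : MvPowerSeries σ R) :
    f - (truncTotal N f : MvPolynomial σ R) ∈ orderGE σ R N := by
  rw [mem_orderGE_iff_coeff]
  intro m hm
  rw [map_sub, MvPolynomial.coeff_coe, coeff_truncTotal _ hm, sub_self]

theorem subst_mem_orderGE [Finite σ] (ha : ∀ i, constantCoeff (a i) = 0) {N : ℕ}
    {f : MvPowerSeries σ R} (hf : f ∈ orderGE σ R N) : subst a f ∈ orderGE τ R N := by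
  refine le_trans ?_ (le_order_subst (hasSubst_of_constantCoeff_zero ha) f)
  have ha' : 1 ≤ ⨅ i, (a i).order :=
    le_iInf fun i => one_le_order_iff_constCoeff_eq_zero.mpr (ha i)
  exact (mem_orderGE.mp hf).trans (le_mul_of_one_le_left' ha')

theorem addMonoidHom_ext_of_polynomial [Finite σ] {L L' : MvPowerSeries σ R →+ MvPowerSeries τ R}
    (k : ℕ) (hL : ∀ N, ∀ f ∈ orderGE σ R N, L f ∈ orderGE τ R (N - k))
    (hL' : ∀ N, ∀ f ∈ orderGE σ R N, L' f ∈ orderGE τ R (N - k))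
    (h : ∀ p : MvPolynomial σ R, L p = L' p) : L = L' := by
  ext1 f
  rw [← sub_eq_zero]
  refine eq_zero_of_forall_mem_orderGE fun N => ?_
  have hf := sub_truncTotal_mem_orderGE (N + k) f
  have hsub := Ideal.sub_mem _ (hL _ _ hf) (hL' _ _ hf)
  simpa only [Nat.add_sub_cancel, map_sub, h, sub_sub_sub_cancel_right] using hsub

theorem pderiv_subst_coe [Fintype σ] (ha : HasSubst a) (i : τ) (p : MvPolynomial σ R) :
    pderiv R i (subst a (p : MvPowerSeries σ R)) =
      ∑ j, subst a (pderiv R j (p : MvPowerSeries σ R)) * pderiv R i (a j) := by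
  classical
  induction p using MvPolynomial.induction_on with
  | C r =>
    simp only [MvPolynomial.coe_C, pderiv_C, subst_C, ← coe_substAlgHom ha, map_zero, zero_mul,
      Finset.sum_const_zero]
  | add p q hp hq =>
    simp only [MvPolynomial.coe_add, map_add, subst_add ha, hp, hq, add_mul,
      Finset.sum_add_distrib]
  | mul_X p k hp =>
    simp only [MvPolynomial.coe_mul, MvPolynomial.coe_X, subst_mul ha, subst_X ha,
      Derivation.leibniz, smul_eq_mul, hp, subst_add ha, add_mul, Finset.sum_add_distrib]
    congr 1
    · rw [Finset.sum_eq_single k]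
      · rw [pderiv_X_self, ← coe_substAlgHom ha, map_one, mul_one]
      · intro j _ hj
        rw [pderiv_X_of_ne hj.symm, ← coe_substAlgHom ha, map_zero, mul_zero, zero_mul]
      · simp
    · rw [Finset.mul_sum]
      exact Finset.sum_congr rfl fun j _ => by ring

theorem pderiv_subst [Fintype σ] (ha : ∀ i, constantCoeff (a i) = 0) (i : τ)
    (f : MvPowerSeries σ R) :
    pderiv R i (subst a f) = ∑ j, subst a (pderiv R j f) * pderiv R i (a j) := by
  have hs := hasSubst_of_constantCoeff_zero ha
  let L : MvPowerSeries σ R →ₗ[R] MvPowerSeries τ R :=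
    (pderiv R i : MvPowerSeries τ R →ₗ[R] MvPowerSeries τ R) ∘ₗ (substAlgHom hs).toLinearMap
  let L' : MvPowerSeries σ R →ₗ[R] MvPowerSeries τ R :=
    ∑ j, LinearMap.mulRight R (pderiv R i (a j)) ∘ₗ (substAlgHom hs).toLinearMap ∘ₗ
      (pderiv R j : MvPowerSeries σ R →ₗ[R] MvPowerSeries σ R)
  have hL (f) : L.toAddMonoidHom f = pderiv R i (subst a f) := by simp [L]
  have hL' (f) : L'.toAddMonoidHom f = ∑ j, subst a (pderiv R j f) * pderiv R i (a j) := by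
    simp [L']
  rw [← hL, ← hL']
  refine DFunLike.congr_fun (addMonoidHom_ext_of_polynomial 1 ?_ ?_ fun p => ?_) f
  · intro N f hf
    rw [hL]
    exact pderiv_mem_orderGE (subst_mem_orderGE ha hf) i
  · intro N f hf
    rw [hL']
    exact Ideal.sum_mem _ fun j _ =>
      Ideal.mul_mem_right _ _ (subst_mem_orderGE ha (pderiv_mem_orderGE hf j))
  · rw [hL, hL']
    exact pderiv_subst_coe hs i p

theorem algHom_eq_subst [Finite σ] (e : MvPowerSeries σ R →ₐ[R] MvPowerSeries τ R)
    (he : ∀ N, ∀ f ∈ orderGE σ R N, e f ∈ orderGE τ R N) (f : MvPowerSeries σ R) :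
    e f = subst (fun i => e (X i)) f := by
  have ha (i) : constantCoeff (e (X i)) = 0 := mem_orderGE_one.mp (he 1 _ (X_mem_orderGE i))
  have hs := hasSubst_of_constantCoeff_zero ha
  rw [← substAlgHom_apply hs]
  refine DFunLike.congr_fun (addMonoidHom_ext_of_polynomial (L := e.toLinearMap.toAddMonoidHom)
    (L' := (substAlgHom (R := R) hs).toLinearMap.toAddMonoidHom) 0 he ?_ fun p => ?_) f
  · intro N f hf
    exact (substAlgHom_apply hs f).symm ▸ subst_mem_orderGE ha hf
  · have : e.comp (MvPolynomial.coeToMvPowerSeries.algHom (σ := σ) R)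
        = (substAlgHom hs).comp (MvPolynomial.coeToMvPowerSeries.algHom (σ := σ) R) := by
      ext i
      simp [subst_X hs]
    simpa using DFunLike.congr_fun this p

end CommRing

end Order

section Poisson

variable {n : ℕ} {R S : Type*} [CommRing R] [CommRing S]

/-- The Poisson bracket `{f, g} = ∑ j, (∂f/∂x_j ∂g/∂y_j - ∂f/∂y_j ∂g/∂x_j)`, as a bilinear map, so
that `poisson f` is the Hamiltonian derivation of `f`. -/
noncomputable def poisson :
    MvPowerSeries (Coord n) R →ₗ[R] MvPowerSeries (Coord n) R →ₗ[R] MvPowerSeries (Coord n) R :=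
  ∑ j, ((LinearMap.mul R _).compl₁₂ (pderiv R (.inl j)).toLinearMap (pderiv R (.inr j)).toLinearMap
    - (LinearMap.mul R _).compl₁₂ (pderiv R (.inr j)).toLinearMap (pderiv R (.inl j)).toLinearMap)

variable (f g h : MvPowerSeries (Coord n) R)

theorem poisson_apply :
    poisson f g = ∑ j, (pderiv R (.inl j) f * pderiv R (.inr j) g
      - pderiv R (.inr j) f * pderiv R (.inl j) g) := by
  simp [poisson]

theorem poisson_antisymm : poisson f g = -poisson g f := by
  rw [poisson_apply, poisson_apply, ← Finset.sum_neg_distrib]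
  exact Finset.sum_congr rfl fun j _ => by ring

theorem poisson_self : poisson f f = 0 := by
  rw [poisson_apply]
  exact Finset.sum_eq_zero fun j _ => by ring

theorem poisson_mul_right : poisson f (g * h) = g * poisson f h + h * poisson f g := by
  simp only [poisson_apply, Derivation.leibniz, smul_eq_mul, Finset.mul_sum,
    ← Finset.sum_add_distrib]
  exact Finset.sum_congr rfl fun j _ => by ring

theorem poisson_mul_left : poisson (f * g) h = f * poisson g h + g * poisson f h := by
  rw [poisson_antisymm, poisson_mul_right, poisson_antisymm h f, poisson_antisymm h g]
  ring

variable {f g} in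
theorem poisson_mem_orderGE {a b : ℕ} (hf : f ∈ orderGE _ R a) (hg : g ∈ orderGE _ R b) :
    poisson f g ∈ orderGE _ R (a + b - 2) := by
  rw [poisson_apply]
  refine Ideal.sum_mem _ fun j _ => Ideal.sub_mem _ ?_ ?_ <;>
  exact orderGE_anti (by omega)
    (mul_mem_orderGE (pderiv_mem_orderGE hf _) (pderiv_mem_orderGE hg _))

theorem map_poisson (φ : R →+* S) :
    MvPowerSeries.map φ (poisson f g)
      = poisson (MvPowerSeries.map φ f) (MvPowerSeries.map φ g) := by
  simp only [poisson_apply, map_sum, map_sub, map_mul, map_pderiv]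

theorem poisson_X_inl (j : Fin n) : poisson (X (.inl j)) g = pderiv R (.inr j) g := by
  rw [poisson_apply, Finset.sum_eq_single j]
  · rw [pderiv_X_self, pderiv_X_of_ne (by simp), one_mul, zero_mul, sub_zero]
  · intro i _ hi
    rw [pderiv_X_of_ne (by simpa using hi.symm), pderiv_X_of_ne (by simp), zero_mul, zero_mul,
      sub_zero]
  · simp

theorem poisson_X_inr (j : Fin n) : poisson (X (.inr j)) g = -pderiv R (.inl j) g := by
  rw [poisson_apply, Finset.sum_eq_single j]
  · rw [pderiv_X_self, pderiv_X_of_ne (by simp), one_mul, zero_mul, zero_sub]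
  · intro i _ hi
    rw [pderiv_X_of_ne (by simp), pderiv_X_of_ne (by simpa using hi.symm), zero_mul, zero_mul,
      sub_zero]
  · simp

theorem pderiv_poisson (i : Coord n) :
    pderiv R i (poisson f g) = poisson (pderiv R i f) g + poisson f (pderiv R i g) := by
  simp only [poisson_apply, map_sum, map_sub, Derivation.leibniz, smul_eq_mul,
    ← Finset.sum_add_distrib, pderiv_comm i]
  exact Finset.sum_congr rfl fun j _ => by ring

theorem sum_pderiv_mul_poisson_comm :
    ∑ j, (pderiv R (.inl j) g * poisson f (pderiv R (.inr j) h)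
        - pderiv R (.inr j) g * poisson f (pderiv R (.inl j) h))
      = ∑ j, (pderiv R (.inl j) f * poisson g (pderiv R (.inr j) h)
        - pderiv R (.inr j) f * poisson g (pderiv R (.inl j) h)) := by
  simp only [poisson_apply, Finset.mul_sum, ← Finset.sum_sub_distrib]
  rw [Finset.sum_comm]
  refine Finset.sum_congr rfl fun i _ => Finset.sum_congr rfl fun j _ => ?_
  rw [pderiv_comm (.inl i) (.inl j) h, pderiv_comm (.inr i) (.inr j) h,
    pderiv_comm (.inl i) (.inr j) h, pderiv_comm (.inr i) (.inl j) h]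
  ring

theorem poisson_jacobi :
    poisson f (poisson g h) = poisson (poisson f g) h + poisson g (poisson f h) := by
  have expand (f g : MvPowerSeries (Coord n) R) : poisson f (poisson g h)
      = ∑ j, (pderiv R (.inr j) h * poisson f (pderiv R (.inl j) g)
          - pderiv R (.inl j) h * poisson f (pderiv R (.inr j) g))
        + ∑ j, (pderiv R (.inl j) g * poisson f (pderiv R (.inr j) h)
          - pderiv R (.inr j) g * poisson f (pderiv R (.inl j) h)) := by
    rw [poisson_apply g h]
    simp only [map_sum, map_sub, poisson_mul_right, ← Finset.sum_add_distrib]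
    exact Finset.sum_congr rfl fun j _ => by ring
  have inner : poisson (poisson f g) h
      = ∑ j, (pderiv R (.inr j) h * poisson f (pderiv R (.inl j) g)
          - pderiv R (.inl j) h * poisson f (pderiv R (.inr j) g))
        - ∑ j, (pderiv R (.inr j) h * poisson g (pderiv R (.inl j) f)
          - pderiv R (.inl j) h * poisson g (pderiv R (.inr j) f)) := by
    simp only [poisson_apply (poisson f g), pderiv_poisson, poisson_antisymm (pderiv R _ f) g,
      ← Finset.sum_sub_distrib]
    exact Finset.sum_congr rfl fun j _ => by ring
  rw [expand f g, expand g f, inner, sum_pderiv_mul_poisson_comm f g h]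
  ring

end Poisson

section LieExp

open Finset.HasAntidiagonal (antidiagonal mem_antidiagonal)

variable {σ K : Type*} [Field K]

/-- The divided power `D ^ k / k!`. -/
noncomputable def divPow (D : Module.End K (MvPowerSeries σ K)) (k : ℕ) :
    Module.End K (MvPowerSeries σ K) :=
  (k.factorial : K)⁻¹ • D ^ k

/-- The endomorphism raises the order of every power series, so that its exponential makes sense
formally. -/
def RaisesOrder (D : Module.End K (MvPowerSeries σ K)) : Prop :=
  ∀ N, ∀ f ∈ orderGE σ K N, D f ∈ orderGE σ K (N + 1)

/-- The exponential `∑ k, D ^ k / k!` of an endomorphism that raises the order. For such `D` the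
terms with `k > |m|` do not contribute to the coefficient at `m`, which is why the sum is cut off
there; for other `D` the value is junk. -/
noncomputable def lieExp (D : Module.End K (MvPowerSeries σ K)) :
    Module.End K (MvPowerSeries σ K) where
  toFun f m := coeff m (∑ k ∈ Finset.range (m.degree + 1), divPow D k f)
  map_add' f g := by
    ext m
    simp only [map_add, Finset.sum_add_distrib]
    rfl
  map_smul' c f := by
    ext m
    simp only [map_smul, ← Finset.smul_sum]
    rfl

variable {D : Module.End K (MvPowerSeries σ K)}

theorem coeff_lieExp (f : MvPowerSeries σ K) (m : σ →₀ ℕ) :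
    coeff m (lieExp D f) = coeff m (∑ k ∈ Finset.range (m.degree + 1), divPow D k f) := rfl

theorem divPow_zero (f : MvPowerSeries σ K) : divPow D 0 f = f := by simp [divPow]

theorem divPow_one (f : MvPowerSeries σ K) : divPow D 1 f = D f := by simp [divPow]

theorem lieExp_eq_self {f : MvPowerSeries σ K} (h : D f = 0) : lieExp D f = f := by
  ext m
  rw [coeff_lieExp, Finset.sum_range_succ', divPow_zero, Finset.sum_eq_zero, zero_add]
  intro k _
  rw [divPow, LinearMap.smul_apply, pow_succ, Module.End.mul_apply, h, map_zero, smul_zero]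

theorem succ_smul_divPow_succ [CharZero K] (k : ℕ) (f : MvPowerSeries σ K) :
    ((k : K) + 1) • divPow D (k + 1) f = D (divPow D k f) := by
  have hk : (k : K) + 1 ≠ 0 := Nat.cast_add_one_ne_zero k
  simp only [divPow, LinearMap.smul_apply, map_smul, pow_succ', Module.End.mul_apply, smul_smul]
  rw [Nat.factorial_succ, Nat.cast_mul, Nat.cast_succ, mul_inv, mul_inv_cancel_left₀ hk]

theorem RaisesOrder.neg (hD : RaisesOrder D) : RaisesOrder (-D) := fun N f hf => by
  simpa using hD N f hf

theorem RaisesOrder.divPow_mem (hD : RaisesOrder D) (k : ℕ) {N : ℕ} {f : MvPowerSeries σ K}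
    (hf : f ∈ orderGE σ K N) : divPow D k f ∈ orderGE σ K (N + k) := by
  refine smul_mem_orderGE ?_ _
  induction k with
  | zero => simpa using hf
  | succ k ih =>
    rw [pow_succ', Module.End.mul_apply, ← add_assoc]
    exact hD _ _ ih

theorem RaisesOrder.lieExp_sub_sum_mem (hD : RaisesOrder D) (N : ℕ) (f : MvPowerSeries σ K) :
    lieExp D f - ∑ k ∈ Finset.range N, divPow D k f ∈ orderGE σ K N := by
  rw [mem_orderGE_iff_coeff]
  intro m hm
  rw [map_sub, sub_eq_zero, coeff_lieExp,
    ← Finset.sum_range_add_sum_Ico _ (Nat.succ_le_of_lt hm), map_add, left_eq_add]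
  refine coeff_eq_zero_of_mem_orderGE (Ideal.sum_mem _ fun k hk => ?_) (Nat.lt_succ_self _)
  have hmk : m.degree + 1 ≤ 0 + k := by simpa using (Finset.mem_Ico.mp hk).1
  exact orderGE_anti hmk (hD.divPow_mem k (mem_orderGE_zero f))

theorem RaisesOrder.lieExp_mem (hD : RaisesOrder D) {N : ℕ} {f : MvPowerSeries σ K}
    (hf : f ∈ orderGE σ K N) : lieExp D f ∈ orderGE σ K N := by
  have h := Ideal.add_mem _ (hD.lieExp_sub_sum_mem N f)
    (Ideal.sum_mem _ fun k (_ : k ∈ Finset.range N) =>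
      orderGE_anti (Nat.le_add_right N k) (hD.divPow_mem k hf))
  simpa using h

theorem sum_range_sum_range_sub_antidiagonal_mem {R : Type*} [CommRing R]
    {u : ℕ → ℕ → MvPowerSeries σ R} {s : ℕ} (hu : ∀ i j, u i j ∈ orderGE σ R (i + j - s)) (M : ℕ) :
    ∑ i ∈ Finset.range M, ∑ j ∈ Finset.range M, u i j
      - ∑ k ∈ Finset.range M, ∑ p ∈ antidiagonal k, u p.1 p.2 ∈ orderGE σ R (M - s) := by
  have triangle : ∑ k ∈ Finset.range M, ∑ p ∈ antidiagonal k, u p.1 p.2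
      = ∑ i ∈ Finset.range M, ∑ j ∈ Finset.range (M - i), u i j := by
    rw [← Finset.sum_range_diag_flip]
    exact Finset.sum_congr rfl fun k _ =>
      Finset.Nat.sum_antidiagonal_eq_sum_range_succ_mk _ _
  rw [triangle, ← Finset.sum_sub_distrib]
  refine Ideal.sum_mem _ fun i _ => ?_
  rw [← Finset.sum_range_add_sum_Ico _ (Nat.sub_le M i), add_sub_cancel_left]
  refine Ideal.sum_mem _ fun j hj => orderGE_anti ?_ (hu i j)
  have := (Finset.mem_Ico.mp hj).1
  omega

theorem bilin_sub_bilin_mem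
    {B : MvPowerSeries σ K →ₗ[K] MvPowerSeries σ K →ₗ[K] MvPowerSeries σ K} {s M : ℕ}
    (hs : ∀ a b, ∀ f ∈ orderGE σ K a, ∀ g ∈ orderGE σ K b, B f g ∈ orderGE σ K (a + b - s))
    {f f' g g' : MvPowerSeries σ K} (hf : f - f' ∈ orderGE σ K M) (hg : g - g' ∈ orderGE σ K M) :
    B f g - B f' g' ∈ orderGE σ K (M - s) := by
  have e : B f g - B f' g' = B (f - f') g + B f' (g - g') := by
    rw [map_sub, map_sub, LinearMap.sub_apply, sub_add_sub_cancel]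
  rw [e]
  exact Ideal.add_mem _ (hs M 0 _ hf _ (mem_orderGE_zero _))
    (orderGE_anti (by omega) (hs 0 M _ (mem_orderGE_zero _) _ hg))

section Bilinear

variable [CharZero K] {B : MvPowerSeries σ K →ₗ[K] MvPowerSeries σ K →ₗ[K] MvPowerSeries σ K}
  (hB : ∀ f g, D (B f g) = B (D f) g + B f (D g))
include hB

theorem divPow_bilin (k : ℕ) (f g : MvPowerSeries σ K) :
    divPow D k (B f g) = ∑ p ∈ antidiagonal k, B (divPow D p.1 f) (divPow D p.2 g) := by
  induction k with
  | zero => simp [divPow_zero]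
  | succ k ih =>
    apply smul_right_injective _ (Nat.cast_add_one_ne_zero (R := K) k)
    have split : ∀ p ∈ antidiagonal (k + 1),
        ((k : K) + 1) • B (divPow D p.1 f) (divPow D p.2 g)
          = (p.1 : K) • B (divPow D p.1 f) (divPow D p.2 g)
            + (p.2 : K) • B (divPow D p.1 f) (divPow D p.2 g) := by
      intro p hp
      rw [← add_smul]
      congr 1
      exact_mod_cast (mem_antidiagonal.mp hp).symm
    simp only [succ_smul_divPow_succ, ih, map_sum, hB, Finset.sum_add_distrib, Finset.smul_sum]
    rw [Finset.sum_congr rfl split, Finset.sum_add_distrib, Finset.Nat.sum_antidiagonal_succ,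
      Finset.Nat.sum_antidiagonal_succ']
    simp [← succ_smul_divPow_succ]

theorem RaisesOrder.lieExp_bilin (hD : RaisesOrder D) {s : ℕ}
    (hs : ∀ a b, ∀ f ∈ orderGE σ K a, ∀ g ∈ orderGE σ K b, B f g ∈ orderGE σ K (a + b - s))
    (f g : MvPowerSeries σ K) : lieExp D (B f g) = B (lieExp D f) (lieExp D g) := by
  rw [← sub_eq_zero]
  refine eq_zero_of_forall_mem_orderGE fun N => ?_
  let S (f : MvPowerSeries σ K) := ∑ k ∈ Finset.range (N + s), divPow D k f
  have hS (f) : lieExp D f - S f ∈ orderGE σ K (N + s) := hD.lieExp_sub_sum_mem (N + s) f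
  have hBS : B (S f) (S g) - S (B f g) ∈ orderGE σ K (N + s - s) := by
    have := sum_range_sum_range_sub_antidiagonal_mem
      (u := fun i j => B (divPow D i f) (divPow D j g)) (s := s)
      (fun i j => orderGE_anti (by omega) (hs _ _ _ (hD.divPow_mem i (mem_orderGE_zero f)) _
        (hD.divPow_mem j (mem_orderGE_zero g)))) (N + s)
    have expand : B (S f) (S g) = ∑ i ∈ Finset.range (N + s), ∑ j ∈ Finset.range (N + s),
        B (divPow D i f) (divPow D j g) := by
      rw [LinearMap.map_sum₂]
      exact Finset.sum_congr rfl fun i _ => map_sum _ _ _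
    rw [expand]
    simpa only [S, divPow_bilin hB] using this
  have hlie := bilin_sub_bilin_mem hs (hS f) (hS g)
  rw [Nat.add_sub_cancel] at hBS hlie
  have := Ideal.sub_mem _ (orderGE_anti (Nat.le_add_right N s) (hS (B f g)))
    (Ideal.add_mem _ hlie hBS)
  rwa [sub_add_sub_cancel, sub_sub_sub_cancel_right] at this

end Bilinear

theorem divPow_divPow_neg [CharZero K] (i j : ℕ) (f : MvPowerSeries σ K) :
    divPow D i (divPow (-D) j f) =
      (PowerSeries.coeff i (PowerSeries.exp K) *
        PowerSeries.coeff j (PowerSeries.evalNegHom (PowerSeries.exp K))) • (D ^ (i + j)) f := by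
  have hneg : (-D) ^ j = (-1 : K) ^ j • D ^ j := by rw [← smul_pow, neg_one_smul]
  simp only [divPow, LinearMap.smul_apply, map_smul, smul_smul, PowerSeries.coeff_exp,
    PowerSeries.evalNegHom, PowerSeries.coeff_rescale, hneg, pow_add, Module.End.mul_apply]
  congr 1
  simp only [one_div, map_inv₀, map_natCast]
  ring

theorem sum_antidiagonal_divPow_divPow_neg [CharZero K] (k : ℕ) (f : MvPowerSeries σ K) :
    ∑ p ∈ antidiagonal k, divPow D p.1 (divPow (-D) p.2 f) = if k = 0 then f else 0 := by
  have h := congrArg (PowerSeries.coeff k) (PowerSeries.exp_mul_exp_neg_eq_one (A := K))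
  rw [PowerSeries.coeff_mul, PowerSeries.coeff_one] at h
  have term (p) (hp : p ∈ antidiagonal k) := by
    simpa only [mem_antidiagonal.mp hp] using divPow_divPow_neg (D := D) p.1 p.2 f
  rw [Finset.sum_congr rfl term, ← Finset.sum_smul, h, ite_smul, one_smul, zero_smul]
  split_ifs with hk
  · rw [hk, pow_zero, Module.End.one_apply]
  · rfl

theorem RaisesOrder.lieExp_lieExp_neg [CharZero K] (hD : RaisesOrder D) (f : MvPowerSeries σ K) :
    lieExp D (lieExp (-D) f) = f := by
  rw [← sub_eq_zero]
  refine eq_zero_of_forall_mem_orderGE fun N => orderGE_anti (Nat.le_succ N) ?_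
  let f' := ∑ k ∈ Finset.range (N + 1), divPow (-D) k f
  have inner := hD.lieExp_mem (hD.neg.lieExp_sub_sum_mem (N + 1) f)
  rw [map_sub] at inner
  have outer := hD.lieExp_sub_sum_mem (N + 1) f'
  have product := sum_range_sum_range_sub_antidiagonal_mem
    (u := fun i j => divPow D i (divPow (-D) j f)) (s := 0)
    (fun i j => orderGE_anti (by omega)
      (hD.divPow_mem i (hD.neg.divPow_mem j (mem_orderGE_zero f)))) (N + 1)
  simp only [sum_antidiagonal_divPow_divPow_neg, Finset.sum_ite_eq', Finset.mem_range,
    Nat.succ_pos, if_true, ← map_sum, Nat.sub_zero] at product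
  have := Ideal.add_mem _ (Ideal.add_mem _ inner outer) product
  rwa [sub_add_sub_cancel, sub_add_sub_cancel] at this

end LieExp

section SymplecticAut

/-- A symplectic automorphism of the ring of formal power series: an algebra automorphism that
preserves the Poisson bracket and, in both directions, the order. It is composition with a formal
symplectic transformation. -/
structure IsSymplecticAut {n : ℕ} {R : Type*} [CommRing R]
    (e : MvPowerSeries (Coord n) R ≃ₐ[R] MvPowerSeries (Coord n) R) : Prop where
  map_poisson : ∀ f g, e (poisson f g) = poisson (e f) (e g)
  map_mem : ∀ N, ∀ f ∈ orderGE (Coord n) R N, e f ∈ orderGE (Coord n) R N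
  symm_mem : ∀ N, ∀ f ∈ orderGE (Coord n) R N, e.symm f ∈ orderGE (Coord n) R N

variable {n : ℕ} {R : Type*} [CommRing R]
  {e e' : MvPowerSeries (Coord n) R ≃ₐ[R] MvPowerSeries (Coord n) R}

theorem IsSymplecticAut.symm (h : IsSymplecticAut e) : IsSymplecticAut e.symm where
  map_poisson f g := e.injective (by simp [h.map_poisson])
  map_mem := h.symm_mem
  symm_mem := h.map_mem

theorem IsSymplecticAut.trans (h : IsSymplecticAut e) (h' : IsSymplecticAut e') :
    IsSymplecticAut (e.trans e') where
  map_poisson f g := by simp [h.map_poisson, h'.map_poisson]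
  map_mem N f hf := h'.map_mem N _ (h.map_mem N f hf)
  symm_mem N f hf := h.symm_mem N _ (h'.symm_mem N f hf)

end SymplecticAut

section Flow

variable {n : ℕ} {K : Type*} [Field K] {G g q H : MvPowerSeries (Coord n) K} {N : ℕ}

theorem raisesOrder_poisson (hG : G ∈ orderGE (Coord n) K 3) : RaisesOrder (poisson G) :=
  fun _ _ hf => orderGE_anti (by omega) (poisson_mem_orderGE hG hf)

theorem poisson_quadratic_mem (hq : q ∈ orderGE (Coord n) K 2) {f : MvPowerSeries (Coord n) K}
    (hf : f ∈ orderGE (Coord n) K N) : poisson q f ∈ orderGE (Coord n) K N :=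
  orderGE_anti (by omega) (poisson_mem_orderGE hq hf)

theorem lieExp_poisson_one (G : MvPowerSeries (Coord n) K) : lieExp (poisson G) 1 = 1 :=
  lieExp_eq_self (by simp [poisson_apply])

theorem lieExp_poisson_mul [CharZero K] (hG : G ∈ orderGE (Coord n) K 3)
    (f g : MvPowerSeries (Coord n) K) :
    lieExp (poisson G) (f * g) = lieExp (poisson G) f * lieExp (poisson G) g :=
  (raisesOrder_poisson hG).lieExp_bilin (B := LinearMap.mul K _) (s := 0)
    (fun f g => by
      simp only [LinearMap.mul_apply']
      rw [poisson_mul_right]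
      ring)
    (fun _ _ _ hf _ hg => mul_mem_orderGE hf hg) f g

theorem lieExp_poisson_poisson [CharZero K] (hG : G ∈ orderGE (Coord n) K 3)
    (f g : MvPowerSeries (Coord n) K) :
    lieExp (poisson G) (poisson f g) = poisson (lieExp (poisson G) f) (lieExp (poisson G) g) :=
  (raisesOrder_poisson hG).lieExp_bilin (poisson_jacobi G)
    (fun _ _ _ hf _ hg => poisson_mem_orderGE hf hg) f g

/-- The time one map `exp {G, ·}` of the Hamiltonian flow of a series `G` of order at least three,
acting on functions. -/
noncomputable def flow [CharZero K] (hG : G ∈ orderGE (Coord n) K 3) :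
    MvPowerSeries (Coord n) K ≃ₐ[K] MvPowerSeries (Coord n) K :=
  AlgEquiv.ofLinearEquiv
    (LinearEquiv.ofLinearMap (lieExp (poisson G)) (lieExp (poisson (-G)))
      (LinearMap.ext fun f => by
        rw [map_neg]
        exact (raisesOrder_poisson hG).lieExp_lieExp_neg f)
      (LinearMap.ext fun f => by
        have := (raisesOrder_poisson (Submodule.neg_mem _ hG)).lieExp_lieExp_neg f
        rwa [map_neg, neg_neg, ← map_neg] at this))
    (lieExp_poisson_one G) (lieExp_poisson_mul hG)

theorem flow_apply [CharZero K] (hG : G ∈ orderGE (Coord n) K 3) (f : MvPowerSeries (Coord n) K) :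
    flow hG f = lieExp (poisson G) f := rfl

theorem isSymplecticAut_flow [CharZero K] (hG : G ∈ orderGE (Coord n) K 3) :
    IsSymplecticAut (flow hG) where
  map_poisson := lieExp_poisson_poisson hG
  map_mem _ _ hf := (raisesOrder_poisson hG).lieExp_mem hf
  symm_mem _ _ hf := (raisesOrder_poisson (Submodule.neg_mem _ hG)).lieExp_mem hf

theorem poisson_pow_mem {d k : ℕ} {f : MvPowerSeries (Coord n) K}
    (hG : G ∈ orderGE (Coord n) K (d + 2)) (hf : f ∈ orderGE (Coord n) K k) (i : ℕ) :
    (poisson G ^ i) f ∈ orderGE (Coord n) K (i * d + k) := by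
  induction i with
  | zero => simpa using hf
  | succ i ih =>
    rw [pow_succ', Module.End.mul_apply, add_mul]
    exact orderGE_anti (by omega) (poisson_mem_orderGE hG ih)

theorem lieExp_poisson_sub_sum_mem {d k : ℕ} {f : MvPowerSeries (Coord n) K}
    (hG3 : G ∈ orderGE (Coord n) K 3) (hG : G ∈ orderGE (Coord n) K (d + 2))
    (hf : f ∈ orderGE (Coord n) K k) (M : ℕ) :
    lieExp (poisson G) f - ∑ i ∈ Finset.range M, divPow (poisson G) i f
      ∈ orderGE (Coord n) K (M * d + k) := by
  have h := (raisesOrder_poisson hG3).lieExp_sub_sum_mem (M + (M * d + k)) f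
  rw [← Finset.sum_range_add_sum_Ico _ (Nat.le_add_right M (M * d + k)), ← sub_sub] at h
  have tail : ∑ i ∈ Finset.Ico M (M + (M * d + k)), divPow (poisson G) i f
      ∈ orderGE (Coord n) K (M * d + k) := by
    refine Ideal.sum_mem _ fun i hi =>
      smul_mem_orderGE (orderGE_anti ?_ (poisson_pow_mem hG hf i)) _
    exact Nat.add_le_add_right (Nat.mul_le_mul_right d (Finset.mem_Ico.mp hi).1) k
  simpa using Ideal.add_mem _ (orderGE_anti (Nat.le_add_left _ M) h) tail

theorem poisson_add_pow_sub_pow_mem (hG : G ∈ orderGE (Coord n) K 3) (hN : 3 ≤ N)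
    (hg : g ∈ orderGE (Coord n) K N) (hH : H ∈ orderGE (Coord n) K 2) (k : ℕ) :
    (poisson (G + g) ^ (k + 1)) H - (poisson G ^ (k + 1)) H ∈ orderGE (Coord n) K (N + k) := by
  have hGg : G + g ∈ orderGE (Coord n) K 3 := Ideal.add_mem _ hG (orderGE_anti hN hg)
  induction k with
  | zero =>
    simp only [zero_add, pow_one, map_add, LinearMap.add_apply, add_sub_cancel_left]
    exact orderGE_anti (by omega) (poisson_mem_orderGE hg hH)
  | succ k ih =>
    have telescope : (poisson (G + g) ^ (k + 1 + 1)) H - (poisson G ^ (k + 1 + 1)) H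
        = poisson (G + g) ((poisson (G + g) ^ (k + 1)) H - (poisson G ^ (k + 1)) H)
          + poisson g ((poisson G ^ (k + 1)) H) := by
      rw [pow_succ', pow_succ' (poisson G), Module.End.mul_apply, Module.End.mul_apply, map_sub,
        map_add poisson, LinearMap.add_apply, LinearMap.add_apply]
      ring
    rw [telescope, ← add_assoc]
    exact Ideal.add_mem _ (raisesOrder_poisson hGg _ _ ih)
      (orderGE_anti (by omega)
        (poisson_mem_orderGE hg (poisson_pow_mem (d := 1) hG hH (k + 1))))

theorem lieExp_poisson_add_sub_mem (hG : G ∈ orderGE (Coord n) K 3) (hN : 3 ≤ N)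
    (hg : g ∈ orderGE (Coord n) K N) (hH : H ∈ orderGE (Coord n) K 2) :
    lieExp (poisson (G + g)) H - lieExp (poisson G) H - poisson g H
      ∈ orderGE (Coord n) K (N + 1) := by
  have hGg : G + g ∈ orderGE (Coord n) K 3 := Ideal.add_mem _ hG (orderGE_anti hN hg)
  have exp_Gg := (raisesOrder_poisson hGg).lieExp_sub_sum_mem (N + 1) H
  have exp_G := (raisesOrder_poisson hG).lieExp_sub_sum_mem (N + 1) H
  obtain ⟨M, rfl⟩ : ∃ M, N = M + 1 := ⟨N - 1, by omega⟩
  have tail : ∑ k ∈ Finset.range M, (divPow (poisson (G + g)) (k + 1 + 1) H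
      - divPow (poisson G) (k + 1 + 1) H) ∈ orderGE (Coord n) K (M + 1 + 1) := by
    refine Ideal.sum_mem _ fun k _ => ?_
    rw [divPow, divPow, LinearMap.smul_apply, LinearMap.smul_apply, ← smul_sub]
    exact smul_mem_orderGE
      (orderGE_anti (by omega) (poisson_add_pow_sub_pow_mem hG hN hg hH (k + 1))) _
  rw [Finset.sum_sub_distrib] at tail
  simp only [Finset.sum_range_succ' _ (M + 1), Finset.sum_range_succ' _ M, divPow_zero,
    zero_add, divPow_one] at exp_Gg exp_G
  convert Ideal.add_mem _ (Ideal.sub_mem _ exp_Gg exp_G) tail using 1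
  rw [map_add poisson, LinearMap.add_apply]
  ring

/-- Every `R` is, modulo the image of `{q, ·}`, in its kernel, and the correction can be chosen of
order at least that of `{q, R}`. This says that `{q, ·}` is semisimple in every degree. -/
def IsSemisimple (q : MvPowerSeries (Coord n) K) : Prop :=
  ∀ N R, poisson q R ∈ orderGE (Coord n) K N →
    ∃ w ∈ orderGE (Coord n) K N, poisson q (R - poisson q w) = 0

theorem exists_normalization_step (hq : q ∈ orderGE (Coord n) K 2) (hs : IsSemisimple q)
    (hH : H - q ∈ orderGE (Coord n) K 3) (hG : G ∈ orderGE (Coord n) K 3) (hN : 3 ≤ N)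
    (h : poisson q (lieExp (poisson G) H) ∈ orderGE (Coord n) K N) :
    ∃ g ∈ orderGE (Coord n) K N,
      poisson q (lieExp (poisson (G + g)) H) ∈ orderGE (Coord n) K (N + 1) := by
  obtain ⟨w, hw, hw0⟩ := hs N _ h
  refine ⟨w, hw, ?_⟩
  have hH2 : H ∈ orderGE (Coord n) K 2 := by
    simpa using Ideal.add_mem _ (orderGE_anti (by norm_num) hH) hq
  have first_order := lieExp_poisson_add_sub_mem hG hN hw hH2
  have cubic : poisson w (H - q) ∈ orderGE (Coord n) K (N + 1) :=
    orderGE_anti (by omega) (poisson_mem_orderGE hw hH)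
  have e : lieExp (poisson (G + w)) H = (lieExp (poisson (G + w)) H - lieExp (poisson G) H
      - poisson w H + poisson w (H - q)) + (lieExp (poisson G) H - poisson q w) := by
    rw [map_sub, poisson_antisymm w q]
    ring
  rw [e, map_add, hw0, add_zero]
  exact poisson_quadratic_mem hq (Ideal.add_mem _ first_order cubic)

theorem exists_flow_normalizing [CharZero K] (hq : q ∈ orderGE (Coord n) K 2) (hs : IsSemisimple q)
    (hH : H - q ∈ orderGE (Coord n) K 3) (hN : 3 ≤ N)
    (h : poisson q H ∈ orderGE (Coord n) K N) :
    ∃ G, ∃ hG : G ∈ orderGE (Coord n) K 3,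
      G ∈ orderGE (Coord n) K N ∧ poisson q (flow hG H) = 0 := by
  have hH2 : H ∈ orderGE (Coord n) K 2 := by
    simpa using Ideal.add_mem _ (orderGE_anti (by norm_num) hH) hq
  let S (k : ℕ) := {G : MvPowerSeries (Coord n) K // G ∈ orderGE (Coord n) K N ∧
    poisson q (lieExp (poisson G) H) ∈ orderGE (Coord n) K (N + k)}
  have step (k : ℕ) (G : S k) : ∃ G' : S (k + 1), G'.1 - G.1 ∈ orderGE (Coord n) K (N + k) := by
    obtain ⟨g, hg, hg'⟩ := exists_normalization_step hq hs hH (orderGE_anti hN G.2.1)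
      (hN.trans (Nat.le_add_right N k)) G.2.2
    exact ⟨⟨G.1 + g, Ideal.add_mem _ G.2.1 (orderGE_anti (Nat.le_add_right N k) hg), hg'⟩,
      by simpa using hg⟩
  choose next hnext using step
  let s (k : ℕ) : S k := Nat.rec
    ⟨0, Submodule.zero_mem _, by rwa [lieExp_eq_self (by rw [map_zero, LinearMap.zero_apply])]⟩
    next k
  obtain ⟨G, hGs⟩ := exists_forall_sub_mem_orderGE (s := fun k => (s k).1) fun k => hnext k (s k)
  have hGN : G ∈ orderGE (Coord n) K N := by simpa using Ideal.add_mem _ (hGs 0) (s 0).2.1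
  refine ⟨G, orderGE_anti hN hGN, hGN, ?_⟩
  rw [flow_apply]
  refine eq_zero_of_forall_mem_orderGE fun k => orderGE_anti (Nat.le_add_left k N) ?_
  have first_order := lieExp_poisson_add_sub_mem (orderGE_anti hN (s k).2.1)
    (hN.trans (Nat.le_add_right N k)) (hGs k) hH2
  rw [add_sub_cancel] at first_order
  have correction : poisson (G - (s k).1) H ∈ orderGE (Coord n) K (N + k) :=
    orderGE_anti (by omega) (poisson_mem_orderGE (hGs k) hH2)
  have := poisson_quadratic_mem hq
    (Ideal.add_mem _ (orderGE_anti (Nat.le_succ _) first_order) correction)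
  rw [sub_add_cancel, map_sub] at this
  simpa using Ideal.add_mem _ this (s k).2.2

end Flow

section NormalForms

variable {n : ℕ} {K : Type*} [Field K] {q H P G G₀ : MvPowerSeries (Coord n) K} {d : ℕ}

theorem exists_homological_solution (hq : q ∈ orderGE (Coord n) K 2) (hs : IsSemisimple q)
    (hH : H - q ∈ orderGE (Coord n) K 3)
    (h : P + poisson G₀ H ∈ orderGE (Coord n) K (d + 1)) (k : ℕ) :
    ∃ G, G - G₀ ∈ orderGE (Coord n) K (d + 1) ∧
      poisson q (P + poisson G H) ∈ orderGE (Coord n) K (d + 1 + k) := by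
  induction k with
  | zero => exact ⟨G₀, by simp, poisson_quadratic_mem hq h⟩
  | succ k ih =>
    obtain ⟨G, hG, hG'⟩ := ih
    obtain ⟨w, hw, hw0⟩ := hs _ _ hG'
    refine ⟨G + w, ?_, ?_⟩
    · rw [add_sub_right_comm]
      exact Ideal.add_mem _ hG (orderGE_anti (Nat.le_add_right _ k) hw)
    · have e : P + poisson (G + w) H
          = (P + poisson G H - poisson q w) + poisson w (H - q) := by
        rw [map_add, LinearMap.add_apply, map_sub, poisson_antisymm w q]
        ring
      rw [e, map_add, hw0, zero_add]
      exact poisson_quadratic_mem hq (orderGE_anti (by omega) (poisson_mem_orderGE hw hH))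

theorem exists_generator_of_perturbation (hq : q ∈ orderGE (Coord n) K 2) (hs : IsSemisimple q)
    (hH : H - q ∈ orderGE (Coord n) K 3) (hG₀ : G₀ ∈ orderGE (Coord n) K (d + 2))
    (hP : P - poisson q G₀ ∈ orderGE (Coord n) K (d + 3)) :
    ∃ G ∈ orderGE (Coord n) K (d + 2), P + poisson G H ∈ orderGE (Coord n) K (d + 3) ∧
      poisson q (P + poisson G H) ∈ orderGE (Coord n) K (2 * d + 3) ∧
      poisson G P - poisson G₀ (poisson q G₀) ∈ orderGE (Coord n) K (2 * d + 3) := by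
  have hH2 : H ∈ orderGE (Coord n) K 2 := by
    simpa using Ideal.add_mem _ (orderGE_anti (by norm_num) hH) hq
  have hPd : P ∈ orderGE (Coord n) K (d + 2) := by
    simpa using Ideal.add_mem _ (orderGE_anti (Nat.le_succ _) hP) (poisson_quadratic_mem hq hG₀)
  have start : P + poisson G₀ H ∈ orderGE (Coord n) K (d + 2 + 1) := by
    convert Ideal.add_mem _ hP
      (orderGE_anti (show d + 3 ≤ _ by omega) (poisson_mem_orderGE hG₀ hH)) using 1
    rw [map_sub, poisson_antisymm G₀ q]
    ring
  obtain ⟨G, hGG₀, hG⟩ := exists_homological_solution hq hs hH start d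
  refine ⟨G, ?_, ?_, orderGE_anti (by omega) hG, ?_⟩
  · simpa using Ideal.add_mem _ (orderGE_anti (Nat.le_succ _) hGG₀) hG₀
  · have := Ideal.add_mem _ start
      (orderGE_anti (show d + 3 ≤ _ by omega) (poisson_mem_orderGE hGG₀ hH2))
    rwa [map_sub, LinearMap.sub_apply, add_add_sub_cancel] at this
  · have := Ideal.add_mem _
      (orderGE_anti (show 2 * d + 3 ≤ _ by omega) (poisson_mem_orderGE hGG₀ hPd))
      (orderGE_anti (show 2 * d + 3 ≤ _ by omega) (poisson_mem_orderGE hG₀ hP))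
    rwa [map_sub, LinearMap.sub_apply, map_sub, sub_add_sub_cancel] at this

variable [CharZero K]

theorem exists_isSymplecticAut_normalizing (hq : q ∈ orderGE (Coord n) K 2) (hs : IsSemisimple q)
    (hH : H - q ∈ orderGE (Coord n) K 3) (hd : 1 ≤ d)
    (h : poisson q H ∈ orderGE (Coord n) K (d + 2)) :
    ∃ e : MvPowerSeries (Coord n) K ≃ₐ[K] MvPowerSeries (Coord n) K, IsSymplecticAut e ∧
      (∀ k, ∀ f ∈ orderGE (Coord n) K k, e f - f ∈ orderGE (Coord n) K (d + k)) ∧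
      poisson q (e H) = 0 := by
  obtain ⟨G, hG, hGd, hGH⟩ := exists_flow_normalizing hq hs hH (by omega) h
  refine ⟨flow hG, isSymplecticAut_flow hG, fun k f hf => ?_, hGH⟩
  simpa [flow_apply, divPow_zero] using lieExp_poisson_sub_sum_mem hG hGd hf 1

theorem flow_smul_sub_mem {F : MvPowerSeries (Coord n) K} {c : K}
    (hcG : c • G ∈ orderGE (Coord n) K 3) (hG : G ∈ orderGE (Coord n) K (d + 2)) {k : ℕ}
    (hF : F ∈ orderGE (Coord n) K k) :
    flow hcG F - (F + c • poisson G F + (c ^ 2 / 2) • poisson G (poisson G F))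
      ∈ orderGE (Coord n) K (3 * d + k) := by
  have quadratic : divPow (poisson (c • G)) 2 F
      = (c ^ 2 / 2) • poisson G (poisson G F) := by
    simp only [divPow, LinearMap.smul_apply, pow_two, Module.End.mul_apply, map_smul, smul_smul,
      Nat.factorial]
    congr 1
    push_cast
    ring
  have h := lieExp_poisson_sub_sum_mem hcG (smul_mem_orderGE hG c) hF 3
  rwa [Finset.sum_range_succ, Finset.sum_range_succ, Finset.sum_range_one, divPow_zero, divPow_one,
    quadratic, ← flow_apply hcG, map_smul, LinearMap.smul_apply] at h

-- If `{G, F}` almost cancels the perturbation `P`, the flow of `c • G` leaves only half of the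
-- quadratic term `c ^ 2 {G, P}`.
theorem flow_smul_perturbation_sub_mem {F R : MvPowerSeries (Coord n) K} {c : K}
    (hcG : c • G ∈ orderGE (Coord n) K 3) (hd : 1 ≤ d) (hF : F ∈ orderGE (Coord n) K 2)
    (hP : P ∈ orderGE (Coord n) K (d + 2)) (hG : G ∈ orderGE (Coord n) K (d + 2))
    (hGF : P + poisson G F ∈ orderGE (Coord n) K (d + 3))
    (hR : R ∈ orderGE (Coord n) K (2 * d + 3)) :
    flow hcG (F + c • P + R) - (F + c • (P + poisson G F) + (c ^ 2 / 2) • poisson G P)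
      ∈ orderGE (Coord n) K (2 * d + 3) := by
  have flow_R := (isSymplecticAut_flow hcG).map_mem _ _ hR
  have flow_F := orderGE_anti (show 2 * d + 3 ≤ _ by omega) (flow_smul_sub_mem hcG hG hF)
  have flow_P := smul_mem_orderGE
    (orderGE_anti (show 2 * d + 3 ≤ _ by omega) (flow_smul_sub_mem hcG hG hP)) c
  have cubic : poisson G (poisson G P) ∈ orderGE (Coord n) K (2 * d + 3) :=
    orderGE_anti (by omega) (poisson_mem_orderGE hG (poisson_mem_orderGE hG hP))
  have remainder : poisson G (P + poisson G F) ∈ orderGE (Coord n) K (2 * d + 3) :=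
    orderGE_anti (by omega) (poisson_mem_orderGE hG hGF)
  convert Ideal.add_mem _ (Ideal.add_mem _ flow_R flow_F) (Ideal.add_mem _ flow_P (Ideal.add_mem _
    (smul_mem_orderGE cubic (c * (c ^ 2 / 2))) (smul_mem_orderGE remainder (c ^ 2 / 2)))) using 1
  have half : (C (c ^ 2 / 2) : MvPowerSeries (Coord n) K) * 2 = C c * C c := by
    rw [← map_ofNat (C (σ := Coord n) (R := K)) 2, ← map_mul, ← map_mul]
    congr 1
    field_simp
  simp only [map_add, map_smul]
  simp only [smul_eq_C_mul, map_mul]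
  linear_combination (-poisson G P) * half

theorem exists_isSymplecticAut_of_approx {T : MvPowerSeries (Coord n) K}
    (hq : q ∈ orderGE (Coord n) K 2) (hs : IsSemisimple q) (hd : 1 ≤ d)
    (hT : T - q ∈ orderGE (Coord n) K 3) (hqT : poisson q T ∈ orderGE (Coord n) K (d + 2))
    (hHT : H - T ∈ orderGE (Coord n) K (d + 2)) :
    ∃ e : MvPowerSeries (Coord n) K ≃ₐ[K] MvPowerSeries (Coord n) K, IsSymplecticAut e ∧
      poisson q (e H) = 0 ∧ e H - q ∈ orderGE (Coord n) K 3 ∧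
      e H - T ∈ orderGE (Coord n) K (d + 2) := by
  have hH : H - q ∈ orderGE (Coord n) K 3 := by
    simpa using Ideal.add_mem _ (orderGE_anti (by omega) hHT) hT
  have hqH : poisson q H ∈ orderGE (Coord n) K (d + 2) := by
    simpa using Ideal.add_mem _ (poisson_quadratic_mem hq hHT) hqT
  obtain ⟨e, he, he_sub, heH⟩ := exists_isSymplecticAut_normalizing hq hs hH hd hqH
  have heHH := he_sub 2 H (by simpa using Ideal.add_mem _ (orderGE_anti (by norm_num) hH) hq)
  exact ⟨e, he, heH, by simpa using Ideal.add_mem _ (orderGE_anti (by omega) heHH) hH,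
    by simpa using Ideal.add_mem _ heHH hHT⟩

theorem exists_normalForms_of_perturbation (hq : q ∈ orderGE (Coord n) K 2) (hs : IsSemisimple q)
    (hH : H - q ∈ orderGE (Coord n) K 3) (hd : 1 ≤ d) (hG₀ : G₀ ∈ orderGE (Coord n) K (d + 2))
    (hn : poisson q (poisson G₀ (poisson q G₀)) = 0) :
    ∃ A B : MvPowerSeries (Coord n) K, ∀ c : K, ∀ R ∈ orderGE (Coord n) K (2 * d + 3),
      ∃ e : MvPowerSeries (Coord n) K ≃ₐ[K] MvPowerSeries (Coord n) K, IsSymplecticAut e ∧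
        poisson q (e (H + c • poisson q G₀ + R)) = 0 ∧
        e (H + c • poisson q G₀ + R) - q ∈ orderGE (Coord n) K 3 ∧
        e (H + c • poisson q G₀ + R) - (A + c • B + (c ^ 2 / 2) • poisson G₀ (poisson q G₀))
          ∈ orderGE (Coord n) K (2 * d + 3) := by
  have hqH : poisson q H ∈ orderGE (Coord n) K 3 := by
    simpa [poisson_self] using poisson_quadratic_mem hq hH
  obtain ⟨e₀, he₀, he₀_sub, hF⟩ := exists_isSymplecticAut_normalizing hq hs hH le_rfl hqH
  set P := poisson q G₀
  have hP : P ∈ orderGE (Coord n) K (d + 2) := poisson_quadratic_mem hq hG₀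
  have hPP : e₀ P - P ∈ orderGE (Coord n) K (d + 3) :=
    orderGE_anti (by omega) (he₀_sub _ _ hP)
  have hH2 : H ∈ orderGE (Coord n) K 2 := by
    simpa using Ideal.add_mem _ (orderGE_anti (by norm_num) hH) hq
  have hFq : e₀ H - q ∈ orderGE (Coord n) K 3 := by
    simpa using Ideal.add_mem _ (he₀_sub _ _ hH2) hH
  obtain ⟨G, hG, hB, hqB, hGP⟩ := exists_generator_of_perturbation hq hs hFq hG₀ hPP
  set B := e₀ P + poisson G (e₀ H)
  refine ⟨e₀ H, B, fun c R hR => ?_⟩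
  have hcG : c • G ∈ orderGE (Coord n) K 3 := orderGE_anti (by omega) (smul_mem_orderGE hG c)
  have approx : flow hcG (e₀ (H + c • P + R))
      - (e₀ H + c • B + (c ^ 2 / 2) • poisson G₀ P) ∈ orderGE (Coord n) K (2 * d + 3) := by
    convert Ideal.add_mem _ (flow_smul_perturbation_sub_mem hcG hd (he₀.map_mem _ _ hH2)
      (he₀.map_mem _ _ hP) hG hB (he₀.map_mem _ _ hR)) (smul_mem_orderGE hGP (c ^ 2 / 2)) using 1
    rw [map_add e₀, map_add e₀, map_smul e₀, smul_sub]
    abel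
  have quadratic : e₀ H + c • B + (c ^ 2 / 2) • poisson G₀ P - q ∈ orderGE (Coord n) K 3 := by
    have := Ideal.add_mem _ hFq (Ideal.add_mem _
      (smul_mem_orderGE (orderGE_anti (show 3 ≤ d + 3 by omega) hB) c)
      (smul_mem_orderGE (orderGE_anti (show 3 ≤ _ by omega) (poisson_mem_orderGE hG₀ hP))
        (c ^ 2 / 2)))
    rwa [sub_add_eq_add_sub, ← add_assoc] at this
  have normalized : poisson q (e₀ H + c • B + (c ^ 2 / 2) • poisson G₀ P)
      ∈ orderGE (Coord n) K (2 * d + 3) := by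
    rw [map_add, map_add, map_smul, map_smul, hF, hn, smul_zero, zero_add, add_zero]
    exact smul_mem_orderGE hqB c
  obtain ⟨e, he, hqe, he_quad, he_approx⟩ :=
    exists_isSymplecticAut_of_approx (d := 2 * d + 1) hq hs (by omega) quadratic normalized approx
  exact ⟨(e₀.trans (flow hcG)).trans e, (he₀.trans (isSymplecticAut_flow hcG)).trans he, hqe,
    he_quad, he_approx⟩

end NormalForms

section Actions

variable {n : ℕ} {R : Type*} [CommRing R]

/-- The action variable `x_j y_j`. -/
noncomputable def act (R : Type*) [CommRing R] (j : Fin n) : MvPowerSeries (Coord n) R :=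
  X (.inl j) * X (.inr j)

/-- The quadratic form `∑ μ_j x_j y_j`, to which the quadratic part of the Hamiltonian is brought by
a complex linear symplectic change of coordinates. -/
noncomputable def diagQuad (μ : Fin n → R) : MvPowerSeries (Coord n) R := ∑ j, μ j • act R j

/-- A series is balanced if the exponents of `x_j` and `y_j` agree in each of its terms, that is, if
it is a series in the action variables. -/
def Balanced (f : MvPowerSeries (Coord n) R) : Prop :=
  ∀ m : Coord n →₀ ℕ, coeff m f ≠ 0 → ∀ j, m (.inl j) = m (.inr j)

variable {f g u v : MvPowerSeries (Coord n) R} {μ : Fin n → R}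

theorem poisson_act (j : Fin n) (f : MvPowerSeries (Coord n) R) :
    poisson (act R j) f = X (.inr j) * pderiv R (.inr j) f - X (.inl j) * pderiv R (.inl j) f := by
  rw [act, poisson_mul_left, poisson_X_inl, poisson_X_inr]
  ring

theorem coeff_poisson_act (j : Fin n) (f : MvPowerSeries (Coord n) R) (m : Coord n →₀ ℕ) :
    coeff m (poisson (act R j) f) = ((m (.inr j) : R) - m (.inl j)) * coeff m f := by
  rw [poisson_act, map_sub, coeff_X_mul_pderiv, coeff_X_mul_pderiv]
  ring

theorem coeff_poisson_diagQuad (μ : Fin n → R) (f : MvPowerSeries (Coord n) R)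
    (m : Coord n →₀ ℕ) :
    coeff m (poisson (diagQuad μ) f)
      = (∑ j, μ j * ((m (.inr j) : R) - m (.inl j))) * coeff m f := by
  simp only [diagQuad, map_sum, LinearMap.sum_apply, map_smul, LinearMap.smul_apply, smul_eq_mul,
    coeff_poisson_act, Finset.sum_mul, mul_assoc]

theorem poisson_act_X_inl (i j : Fin n) :
    poisson (act R i) (X (.inl j)) = (if i = j then (-1 : R) else 0) • X (.inl j) := by
  rw [poisson_act, pderiv_X_of_ne (by simp)]
  split_ifs with h
  · subst h
    simp
  · simp [pderiv_X_of_ne, Ne.symm h]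

theorem act_mem_orderGE (j : Fin n) : act R j ∈ orderGE (Coord n) R 2 :=
  mul_mem_orderGE (X_mem_orderGE _) (X_mem_orderGE _)

theorem diagQuad_mem_orderGE (μ : Fin n → R) : diagQuad μ ∈ orderGE (Coord n) R 2 :=
  Ideal.sum_mem _ fun j _ => smul_mem_orderGE (act_mem_orderGE j) _

theorem Balanced.sub (hf : Balanced f) (hg : Balanced g) : Balanced (f - g) := by
  intro m hm j
  by_cases h0 : coeff m f = 0
  · exact hg m (fun h => hm (by rw [map_sub, h0, h, sub_zero])) j
  · exact hf m h0 j

theorem Balanced.smul (hf : Balanced f) (c : R) : Balanced (c • f) := fun m hm j =>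
  hf m (right_ne_zero_of_mul (by rwa [coeff_smul] at hm)) j

theorem Balanced.poisson_act (hf : Balanced f) (j : Fin n) : poisson (act R j) f = 0 := by
  ext m
  rw [coeff_poisson_act, map_zero]
  by_cases h0 : coeff m f = 0
  · rw [h0, mul_zero]
  · rw [hf m h0 j, sub_self, zero_mul]

theorem balanced_of_poisson_act [NoZeroDivisors R] [CharZero R]
    (hf : ∀ j, poisson (act R j) f = 0) : Balanced f := by
  intro m hm j
  have h := congrArg (coeff m) (hf j)
  rw [coeff_poisson_act, map_zero, mul_eq_zero, or_iff_left hm, sub_eq_zero] at h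
  exact_mod_cast h.symm

theorem balanced_of_poisson_diagQuad [NoZeroDivisors R] (hμ : LinearIndependent ℤ μ)
    (hf : poisson (diagQuad μ) f = 0) : Balanced f := by
  intro m hm j
  have h := congrArg (coeff m) hf
  rw [coeff_poisson_diagQuad, map_zero, mul_eq_zero, or_iff_left hm] at h
  have h0 := Fintype.linearIndependent_iff.mp hμ (fun j => (m (.inr j) : ℤ) - m (.inl j))
    (by simpa [mul_comm] using h) j
  omega

theorem isSemisimple_diagQuad {K : Type*} [Field K] (μ : Fin n → K) :
    IsSemisimple (diagQuad μ) := by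
  intro N F hF
  let ω : (Coord n →₀ ℕ) → K := fun m => ∑ j, μ j * ((m (.inr j) : K) - m (.inl j))
  let w : MvPowerSeries (Coord n) K := fun m => if m.degree < N then 0 else coeff m F / ω m
  have hw : ∀ m, coeff m w = if m.degree < N then 0 else coeff m F / ω m := fun _ => rfl
  refine ⟨w, mem_orderGE_iff_coeff.mpr fun m hm => by rw [hw, if_pos hm], ?_⟩
  ext m
  rw [coeff_poisson_diagQuad, map_sub, coeff_poisson_diagQuad, map_zero, hw]
  change ω m * (coeff m F - ω m * _) = 0
  split_ifs with h
  · rw [mul_zero, sub_zero, ← coeff_poisson_diagQuad, coeff_eq_zero_of_mem_orderGE hF h]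
  · by_cases h0 : ω m = 0
    · rw [h0, zero_mul]
    · rw [mul_div_cancel₀ _ h0, sub_self, mul_zero]

theorem Balanced.X_mul_pderiv (hf : Balanced f) (j : Fin n) :
    X (.inr j) * pderiv R (.inr j) f = X (.inl j) * pderiv R (.inl j) f := by
  rw [← sub_eq_zero, ← Birkhoff.poisson_act]
  exact hf.poisson_act j

/-- The derivative of a balanced series with respect to the action variable `x_j y_j`, obtained from
`∂f/∂x_j` by division by `y_j`. -/
noncomputable def actDeriv (j : Fin n) :
    MvPowerSeries (Coord n) R →ₗ[R] MvPowerSeries (Coord n) R where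
  toFun f := fun m => coeff (m + Finsupp.single (.inr j) 1) (pderiv R (.inl j) f)
  map_add' f g := by
    rw [map_add]
    rfl
  map_smul' c f := by
    rw [Derivation.map_smul]
    rfl

theorem coeff_actDeriv (j : Fin n) (f : MvPowerSeries (Coord n) R) (m : Coord n →₀ ℕ) :
    coeff m (actDeriv j f) = coeff (m + Finsupp.single (.inr j) 1) (pderiv R (.inl j) f) := rfl

theorem Balanced.pderiv_inl (hf : Balanced f) (j : Fin n) :
    pderiv R (.inl j) f = X (.inr j) * actDeriv j f := by
  classical
  ext m
  rw [X, coeff_monomial_mul]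
  split_ifs with hm
  · rw [coeff_actDeriv, tsub_add_cancel_of_le hm, one_mul]
  · have h1 : m (.inr j) = 0 := by
      by_contra h0
      exact hm (Finsupp.single_le_iff.mpr (Nat.one_le_iff_ne_zero.mpr h0))
    rw [coeff_pderiv]
    by_contra h2
    have h3 := hf _ (left_ne_zero_of_mul h2) j
    simp [h1] at h3

theorem Balanced.actDeriv (hf : Balanced f) (j : Fin n) : Balanced (actDeriv j f) := by
  classical
  intro m hm i
  rw [coeff_actDeriv, coeff_pderiv] at hm
  have h := hf _ (left_ne_zero_of_mul hm) i
  by_cases hij : j = i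
  · subst hij
    simpa using h
  · simpa [hij] using h

open Classical in
/-- The part of a series of weight `α`: the sum of its terms in which, for all `j`, the exponent of
`y_j` exceeds that of `x_j` by `α j`. It is the projection onto a joint eigenspace of the operators
`{x_j y_j, ·}`. -/
noncomputable def weightPart (α : Fin n → ℤ) :
    MvPowerSeries (Coord n) R →ₗ[R] MvPowerSeries (Coord n) R where
  toFun u := fun m => if ∀ j, (m (.inr j) : ℤ) - m (.inl j) = α j then coeff m u else 0
  map_add' _ _ := funext fun _ => ite_add_zero
  map_smul' _ _ := funext fun _ => (mul_ite_zero ..).symm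

open Classical in
theorem coeff_weightPart (α : Fin n → ℤ) (u : MvPowerSeries (Coord n) R) (m : Coord n →₀ ℕ) :
    coeff m (weightPart α u) =
      if ∀ j, (m (.inr j) : ℤ) - m (.inl j) = α j then coeff m u else 0 := rfl

theorem weightPart_poisson_act (α : Fin n → ℤ) (k : Fin n) (u : MvPowerSeries (Coord n) R) :
    weightPart α (poisson (act R k) u) = (α k : R) • weightPart α u := by
  ext m
  rw [coeff_smul, coeff_weightPart, coeff_weightPart]
  split_ifs with h
  · rw [coeff_poisson_act, ← h k]
    push_cast
    rfl
  · rw [mul_zero]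

theorem Balanced.weightPart_mul (hg : Balanced g) (α : Fin n → ℤ)
    (u : MvPowerSeries (Coord n) R) : weightPart α (g * u) = g * weightPart α u := by
  classical
  ext m
  have weight_eq : ∀ p ∈ Finset.HasAntidiagonal.antidiagonal m, coeff p.1 g ≠ 0 → ∀ j,
      (p.2 (.inr j) : ℤ) - p.2 (.inl j) = (m (.inr j) : ℤ) - m (.inl j) := by
    intro p hp h0 j
    have hb := hg _ h0 j
    rw [← Finset.HasAntidiagonal.mem_antidiagonal.mp hp]
    simp only [Finsupp.add_apply]
    omega
  rw [coeff_weightPart, coeff_mul, coeff_mul, ← Finset.sum_const_zero, ← Finset.sum_ite_irrel]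
  refine Finset.sum_congr rfl fun p hp => ?_
  by_cases h0 : coeff p.1 g = 0
  · simp [h0]
  · simp only [coeff_weightPart, weight_eq p hp h0, mul_ite, mul_zero]

theorem exists_weightPart_single_ne_zero {i : Coord n} (hu : coeff (Finsupp.single i 1) u ≠ 0) :
    ∃ (k : Fin n) (s : ℤˣ), weightPart (Pi.single k (s : ℤ)) u ≠ 0 := by
  rcases i with k | k
  · refine ⟨k, -1, fun h => hu ?_⟩
    rw [← map_zero (coeff (Finsupp.single (Sum.inl k) 1)), ← h, coeff_weightPart, if_pos]
    intro l
    by_cases hl : l = k <;> simp [hl]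
  · refine ⟨k, 1, fun h => hu ?_⟩
    rw [← map_zero (coeff (Finsupp.single (Sum.inr k) 1)), ← h, coeff_weightPart, if_pos]
    intro l
    by_cases hl : l = k <;> simp [hl]

theorem exists_coeff_single_ne_zero [Nontrivial R] (hu : u ∈ orderGE (Coord n) R 1)
    (hv : v ∈ orderGE (Coord n) R 1) (huv : poisson u v = 1) :
    ∃ i, coeff (Finsupp.single i 1) u ≠ 0 := by
  by_contra! hcon
  have hu2 : u ∈ orderGE (Coord n) R 2 := by
    refine mem_orderGE_iff_coeff.mpr fun m hm => ?_
    rcases Nat.lt_or_ge m.degree 1 with h | h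
    · exact coeff_eq_zero_of_mem_orderGE hu h
    · have : m ∈ Set.range fun i : Coord n => Finsupp.single i 1 := by
        rw [Finsupp.range_single_one]
        exact le_antisymm (by omega) h
      obtain ⟨i, rfl⟩ := this
      exact hcon i
  have h := poisson_mem_orderGE hu2 hv
  rw [huv] at h
  simpa using mem_orderGE_one.mp h

theorem X_ne_zero {σ : Type*} [Nontrivial R] (i : σ) : (X i : MvPowerSeries σ R) ≠ 0 := by
  intro h
  simpa using congrArg (coeff (Finsupp.single i 1)) h

section IsDomain

variable [IsDomain R]

theorem Balanced.pderiv_inr (hf : Balanced f) (j : Fin n) :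
    pderiv R (.inr j) f = X (.inl j) * Birkhoff.actDeriv j f := by
  apply mul_left_cancel₀ (X_ne_zero (R := R) (Sum.inr j))
  rw [hf.X_mul_pderiv, hf.pderiv_inl]
  ring

theorem Balanced.poisson_eq_sum (hf : Balanced f) (u : MvPowerSeries (Coord n) R) :
    poisson f u = ∑ k, Birkhoff.actDeriv k f * poisson (act R k) u := by
  rw [poisson_apply]
  refine Finset.sum_congr rfl fun k _ => ?_
  rw [hf.pderiv_inl, hf.pderiv_inr, Birkhoff.poisson_act]
  ring

theorem Balanced.poisson_eq_zero (hf : Balanced f) (hg : Balanced g) : poisson f g = 0 := by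
  rw [hf.poisson_eq_sum]
  exact Finset.sum_eq_zero fun j _ => by rw [hg.poisson_act, mul_zero]

theorem Balanced.smul_actDeriv_of_weightPart_ne_zero (hf : Balanced f) {c : R}
    (hu : poisson f u = c • u) {k : Fin n} {s : ℤ} (hs : weightPart (Pi.single k s) u ≠ 0) :
    (s : R) • Birkhoff.actDeriv k f = C c := by
  have h := congrArg (weightPart (Pi.single k s)) hu
  rw [hf.poisson_eq_sum, map_sum, map_smul] at h
  simp only [(hf.actDeriv _).weightPart_mul, weightPart_poisson_act] at h
  rw [Finset.sum_eq_single_of_mem k (Finset.mem_univ k)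
    fun b _ hb => by rw [Pi.single_eq_of_ne hb, Int.cast_zero, zero_smul, mul_zero],
    Pi.single_eq_same, mul_smul_comm, ← smul_mul_assoc, smul_eq_C_mul (a := c)] at h
  exact mul_right_cancel₀ hs h

variable [CharZero R]

theorem balanced_act (k : Fin n) : Balanced (act R k) := by
  refine balanced_of_poisson_act fun j => ?_
  rw [poisson_act, act]
  by_cases hjk : j = k
  · subst hjk
    simp only [Derivation.leibniz, pderiv_X_self, pderiv_X_of_ne, smul_eq_mul, ne_eq, reduceCtorEq,
      not_false_eq_true]
    ring
  · simp [Derivation.leibniz, pderiv_X_of_ne, Ne.symm hjk]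

theorem actDeriv_act (j k : Fin n) :
    actDeriv j (act R k) = C (if k = j then (1 : R) else 0) := by
  apply mul_left_cancel₀ (X_ne_zero (R := R) (Sum.inr j))
  rw [← (balanced_act k).pderiv_inl, act, Derivation.leibniz, pderiv_X_of_ne (by simp)]
  split_ifs with h
  · subst h
    simp
  · simp [pderiv_X_of_ne, h]

theorem Balanced.ext_actDeriv (hf : Balanced f) (hg : Balanced g)
    (h0 : constantCoeff f = constantCoeff g)
    (h : ∀ k, Birkhoff.actDeriv k f = Birkhoff.actDeriv k g) : f = g := by
  have hfg := hf.sub hg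
  have hd : ∀ k, pderiv R (.inl k) (f - g) = 0 := fun k => by
    rw [hfg.pderiv_inl, map_sub, h, sub_self, mul_zero]
  rw [← sub_eq_zero]
  ext m
  rw [map_zero]
  by_contra hm
  by_cases hx : ∃ k, m (.inl k) ≠ 0
  · obtain ⟨k, hk⟩ := hx
    have h1 := congrArg (coeff (m - Finsupp.single (.inl k) 1)) (hd k)
    rw [coeff_pderiv, tsub_add_cancel_of_le
      (Finsupp.single_le_iff.mpr (Nat.one_le_iff_ne_zero.mpr hk)), map_zero, mul_eq_zero,
      or_iff_right hm] at h1
    exact Nat.cast_add_one_ne_zero _ h1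
  · push Not at hx
    obtain rfl : m = 0 := by
      ext i
      rcases i with k | k
      · exact hx k
      · exact (hfg m hm k).symm.trans (hx k)
    exact hm (by rw [coeff_zero_eq_constantCoeff_apply, map_sub, h0, sub_self])

variable {Ψ : MvPowerSeries (Coord n) R →ₐ[R] MvPowerSeries (Coord n) R}

theorem exists_actDeriv_eq (hΨ : ∀ f g, Ψ (poisson f g) = poisson (Ψ f) (Ψ g))
    (hord : ∀ N, ∀ f ∈ orderGE (Coord n) R N, Ψ f ∈ orderGE (Coord n) R N)
    (hbal : ∀ i, Balanced (Ψ (act R i))) (j : Fin n) :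
    ∃ (k : Fin n) (s : ℤˣ), ∀ i,
      actDeriv k (Ψ (act R i)) = C (if i = j then ((s : ℤ) : R) else 0) := by
  have hX : ∀ i, Ψ (X i) ∈ orderGE (Coord n) R 1 := fun i => hord 1 _ (X_mem_orderGE i)
  have hone : poisson (Ψ (X (.inl j))) (Ψ (X (.inr j))) = 1 := by
    rw [← hΨ, poisson_X_inl, pderiv_X_self, map_one]
  obtain ⟨i, hi⟩ := exists_coeff_single_ne_zero (hX _) (hX _) hone
  obtain ⟨k, s, hs⟩ := exists_weightPart_single_ne_zero hi
  refine ⟨k, -s, fun i => ?_⟩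
  have heigen : poisson (Ψ (act R i)) (Ψ (X (.inl j)))
      = (if i = j then (-1 : R) else 0) • Ψ (X (.inl j)) := by
    rw [← hΨ, poisson_act_X_inl, map_smul]
  have h := (hbal i).smul_actDeriv_of_weightPart_ne_zero heigen hs
  have hss : ((s : ℤ) : R) * (s : ℤ) = 1 := by
    rw [← Int.cast_mul, Int.units_coe_mul_self, Int.cast_one]
  rw [← one_smul R (actDeriv k _), ← hss, mul_smul, h, smul_eq_C_mul, ← map_mul]
  congr 1
  split_ifs <;> simp

theorem exists_perm_of_balanced (hΨ : ∀ f g, Ψ (poisson f g) = poisson (Ψ f) (Ψ g))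
    (hord : ∀ N, ∀ f ∈ orderGE (Coord n) R N, Ψ f ∈ orderGE (Coord n) R N)
    (hbal : ∀ i, Balanced (Ψ (act R i))) :
    ∃ (π : Equiv.Perm (Fin n)) (s : Fin n → ℤˣ),
      ∀ i, Ψ (act R i) = ((s i : ℤ) : R) • act R (π i) := by
  choose π s hπ using exists_actDeriv_eq hΨ hord hbal
  have hinj : Function.Injective π := by
    intro j j' hjj
    by_contra hne
    have h := (hπ j j).symm.trans (hjj ▸ hπ j' j)
    rw [if_pos rfl, if_neg hne] at h
    exact (s j).ne_zero (by simpa using congrArg constantCoeff h)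
  have hbij := Finite.injective_iff_bijective.mp hinj
  refine ⟨Equiv.ofBijective π hbij, s, fun i => ?_⟩
  have hcc : ∀ f ∈ orderGE (Coord n) R 2, constantCoeff f = 0 := fun f hf =>
    mem_orderGE_one.mp (orderGE_anti one_le_two hf)
  refine (hbal i).ext_actDeriv ((balanced_act _).smul _) ?_ fun k => ?_
  · rw [hcc _ (hord 2 _ (act_mem_orderGE i)), hcc _ (smul_mem_orderGE (act_mem_orderGE _) _)]
  · obtain ⟨j, rfl⟩ := hbij.2 k
    rw [hπ, map_smul, Equiv.ofBijective_apply, actDeriv_act, smul_eq_C_mul, ← map_mul]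
    simp only [hinj.eq_iff, mul_ite, mul_one, mul_zero]
    split_ifs with hij <;> simp [hij]

end IsDomain

end Actions

section NormalFormUniqueness

variable {n : ℕ} {R : Type*} [CommRing R] {τ : Type*}

/-- The exponent of `∏ (x_j y_j) ^ k_j`. -/
noncomputable def actExp : (Fin n →₀ ℕ) →+ (Coord n →₀ ℕ) where
  toFun k := Finsupp.sumElim k k
  map_zero' := by
    ext (j | j) <;> rfl
  map_add' k l := by
    ext (j | j) <;> rfl

@[simp]
theorem actExp_inl (k : Fin n →₀ ℕ) (j : Fin n) : actExp k (.inl j) = k j := rfl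

@[simp]
theorem actExp_inr (k : Fin n →₀ ℕ) (j : Fin n) : actExp k (.inr j) = k j := rfl

theorem actExp_injective : Function.Injective (actExp (n := n)) := fun k l h => by
  ext j
  exact DFunLike.congr_fun h (Sum.inl j)

theorem exists_eq_actExp {m : Coord n →₀ ℕ} (h : ∀ j, m (.inl j) = m (.inr j)) :
    ∃ k, m = actExp k := by
  refine ⟨Finsupp.equivFunOnFinite.symm fun j => m (.inl j), ?_⟩
  ext (j | j) <;> simp [h j]

theorem act_eq_monomial (j : Fin n) : act R j = monomial (actExp (Finsupp.single j 1)) 1 := by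
  classical
  rw [act, X, X, monomial_mul_monomial, one_mul]
  congr 2
  ext (l | l) <;> simp [Finsupp.single_apply]

theorem prod_smul_act_pow (π : τ → Fin n) (c : τ → R) (d : τ →₀ ℕ) :
    (d.prod fun i e => (c i • act R (π i)) ^ e)
      = monomial (actExp (d.mapDomain π)) (d.prod fun i e => c i ^ e) := by
  have hmap : actExp (d.mapDomain π) = ∑ i ∈ d.support, d i • actExp (Finsupp.single (π i) 1) := by
    simp only [Finsupp.mapDomain, Finsupp.sum, map_sum, ← map_nsmul, Finsupp.smul_single_one]
  rw [hmap, Finsupp.prod, Finsupp.prod, ← prod_monomial]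
  refine Finset.prod_congr rfl fun i _ => ?_
  rw [act_eq_monomial, ← map_smul, smul_eq_mul, mul_one, monomial_pow]

theorem hasSubst_smul_act [Finite τ] (π : τ → Fin n) (c : τ → R) :
    HasSubst fun i => c i • act R (π i) :=
  hasSubst_of_constantCoeff_zero fun i => by simp [act, smul_eq_C_mul]

theorem coeff_subst_act [Finite τ] (π : τ ≃ Fin n) (c : τ → R) (g : MvPowerSeries τ R)
    (k : τ →₀ ℕ) : coeff (actExp (k.mapDomain π)) (subst (fun i => c i • act R (π i)) g)
      = (k.prod fun i e => c i ^ e) * coeff k g := by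
  classical
  rw [coeff_subst (hasSubst_smul_act π c), finsum_eq_single _ k]
  · rw [prod_smul_act_pow, coeff_monomial_same, smul_eq_mul, mul_comm]
  · intro d hd
    rw [prod_smul_act_pow, coeff_monomial_ne, smul_zero]
    exact fun h => hd (Finsupp.mapDomain_injective π.injective (actExp_injective h)).symm

theorem balanced_subst_act [Finite τ] (π : τ → Fin n) (c : τ → R) (g : MvPowerSeries τ R) :
    Balanced (subst (fun i => c i • act R (π i)) g) := by
  classical
  intro m hm j
  by_contra hj
  refine hm ?_
  rw [coeff_subst (hasSubst_smul_act π c)]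
  refine finsum_eq_zero_of_forall_eq_zero fun d => ?_
  rw [prod_smul_act_pow, coeff_monomial_ne, smul_zero]
  rintro rfl
  exact hj rfl

variable {K : Type*} [Field K] {F F₁ : MvPowerSeries (Coord n) K} {μ : Fin n → K}

theorem Balanced.exists_eq_subst [Finite τ] (hF : Balanced F) (π : τ ≃ Fin n) {c : τ → K}
    (hc : ∀ i, c i ≠ 0) : ∃ g : MvPowerSeries τ K, F = subst (fun i => c i • act K (π i)) g := by
  let g : MvPowerSeries τ K :=
    fun k => (k.prod fun i e => c i ^ e)⁻¹ * coeff (actExp (k.mapDomain π)) F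
  have hg : ∀ k, coeff k g = (k.prod fun i e => c i ^ e)⁻¹ * coeff (actExp (k.mapDomain π)) F :=
    fun k => rfl
  refine ⟨g, ?_⟩
  ext m
  by_cases hb : ∀ j, m (.inl j) = m (.inr j)
  · obtain ⟨k, rfl⟩ := exists_eq_actExp hb
    obtain ⟨k, rfl⟩ := (Finsupp.domCongr π : (τ →₀ ℕ) ≃+ (Fin n →₀ ℕ)).surjective k
    rw [Finsupp.domCongr_apply, Finsupp.equivMapDomain_eq_mapDomain, coeff_subst_act, hg,
      mul_inv_cancel_left₀]
    exact Finset.prod_ne_zero_iff.mpr fun i _ => pow_ne_zero _ (hc i)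
  · rw [not_imp_comm.mp (hF m) hb, not_imp_comm.mp (balanced_subst_act π c g m) hb]

theorem balanced_of_poisson_eq_zero (hμ : LinearIndependent ℤ μ) (hF : Balanced F)
    (hFq : F - diagQuad μ ∈ orderGE (Coord n) K 3) (h : poisson F F₁ = 0) : Balanced F₁ := by
  apply balanced_of_poisson_diagQuad hμ
  refine eq_zero_of_forall_mem_orderGE fun N => ?_
  induction N with
  | zero => exact mem_orderGE_zero _
  | succ N ih =>
    obtain ⟨w, hw, hw0⟩ := isSemisimple_diagQuad μ N F₁ ih
    set q := diagQuad μ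
    have hFw : poisson F (poisson q w) = 0 := by
      have := hF.poisson_eq_zero (balanced_of_poisson_diagQuad hμ hw0)
      rwa [map_sub, h, zero_sub, neg_eq_zero] at this
    have hqw : poisson (F - q) (poisson q w) ∈ orderGE (Coord n) K (N + 1) :=
      orderGE_anti (by omega)
        (poisson_mem_orderGE hFq (poisson_quadratic_mem (diagQuad_mem_orderGE μ) hw))
    rw [map_sub, LinearMap.sub_apply, hFw, zero_sub, Submodule.neg_mem_iff] at hqw
    rwa [sub_eq_zero.mp ((map_sub (poisson q) _ _).symm.trans hw0)]

variable [CharZero K]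

theorem exists_perm_coeff_eq {Ψ : MvPowerSeries (Coord n) K →ₐ[K] MvPowerSeries (Coord n) K}
    (hΨ : ∀ f g, Ψ (poisson f g) = poisson (Ψ f) (Ψ g))
    (hord : ∀ N, ∀ f ∈ orderGE (Coord n) K N, Ψ f ∈ orderGE (Coord n) K N)
    (hμ : LinearIndependent ℤ μ) (hF : Balanced F) (hΨF : Balanced (Ψ F))
    (hq : Ψ F - diagQuad μ ∈ orderGE (Coord n) K 3) :
    ∃ π : Equiv.Perm (Fin n), ∀ k : Fin n →₀ ℕ, ∃ s : ℤˣ,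
      coeff (actExp (k.mapDomain π)) (Ψ F) = ((s : ℤ) : K) * coeff (actExp k) F := by
  obtain ⟨π, s, hπ⟩ := exists_perm_of_balanced hΨ hord fun i => by
    refine balanced_of_poisson_eq_zero hμ hΨF hq ?_
    rw [← hΨ, poisson_antisymm, hF.poisson_act, neg_zero, map_zero]
  obtain ⟨g, hg⟩ := hF.exists_eq_subst (Equiv.refl (Fin n)) (c := 1) (by simp)
  have hX : ∀ i, constantCoeff (Ψ (X i)) = 0 := fun i =>
    mem_orderGE_one.mp (hord 1 _ (X_mem_orderGE i))
  have hΨF : Ψ F = subst (fun i => ((s i : ℤ) : K) • act K (π i)) g := by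
    rw [algHom_eq_subst Ψ hord, hg,
      subst_comp_subst_apply (hasSubst_smul_act _ _) (hasSubst_of_constantCoeff_zero hX)]
    congr 1
    funext i
    rw [← algHom_eq_subst Ψ hord, Pi.one_apply, one_smul, Equiv.refl_apply, hπ]
  refine ⟨π, fun k => ⟨k.prod fun i e => s i ^ e, ?_⟩⟩
  have hFk := coeff_subst_act (Equiv.refl (Fin n)) (1 : Fin n → K) g k
  rw [← hg] at hFk
  simp only [Equiv.coe_refl, Finsupp.mapDomain_id, Pi.one_apply, one_pow, Finsupp.prod,
    Finset.prod_const_one, one_mul] at hFk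
  rw [hΨF, coeff_subst_act, hFk]
  simp [Finsupp.prod]

end NormalFormUniqueness

section Perturbation

variable {n : ℕ} {R : Type*} [CommRing R]

theorem poisson_diagQuad_monomial (μ : Fin n → R) (m : Coord n →₀ ℕ) (c : R) :
    poisson (diagQuad μ) (monomial m c)
      = (∑ j, μ j * ((m (.inr j) : R) - m (.inl j))) • monomial m c := by
  classical
  ext k
  rw [coeff_poisson_diagQuad, coeff_smul, coeff_monomial]
  split_ifs with h
  · rw [h]
  · rw [mul_zero, mul_zero]

/-- The monomial `x_s ^ p * y_t ^ q`, an eigenvector of every diagonal quadratic Hamiltonian with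
eigenvalue `μ_t q - μ_s p`, which is the small divisor of the argument. -/
noncomputable def crossMonomial (R : Type*) [CommRing R] (s t : Fin n) (p q : ℕ) :
    MvPowerSeries (Coord n) R := X (.inl s) ^ p * X (.inr t) ^ q

theorem crossMonomial_eq_monomial (s t : Fin n) (p q : ℕ) : crossMonomial R s t p q
    = monomial (Finsupp.single (.inl s) p + Finsupp.single (.inr t) q) 1 := by
  rw [crossMonomial, X_pow_eq, X_pow_eq, monomial_mul_monomial, one_mul]

theorem crossMonomial_mem_orderGE (s t : Fin n) (p q : ℕ) :
    crossMonomial R s t p q ∈ orderGE (Coord n) R (p + q) := by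
  have hs := pow_mem_orderGE (X_mem_orderGE (R := R) (Sum.inl s : Coord n)) p
  have ht := pow_mem_orderGE (X_mem_orderGE (R := R) (Sum.inr t : Coord n)) q
  rw [mul_one] at hs ht
  exact mul_mem_orderGE hs ht

theorem poisson_diagQuad_crossMonomial (μ : Fin n → R) (s t : Fin n) (p q : ℕ) :
    poisson (diagQuad μ) (crossMonomial R s t p q)
      = (μ t * q - μ s * p) • crossMonomial R s t p q := by
  classical
  rw [crossMonomial_eq_monomial, poisson_diagQuad_monomial]
  congr 1
  simp only [Finsupp.add_apply, Finsupp.single_apply, Sum.inr.injEq, Sum.inl.injEq, reduceCtorEq,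
    if_false, zero_add, add_zero, mul_sub, Finset.sum_sub_distrib, Nat.cast_ite, Nat.cast_zero,
    mul_ite, mul_zero, Finset.sum_ite_eq, Finset.mem_univ, if_true]

theorem pderiv_inl_crossMonomial (s t : Fin n) (p q : ℕ) (j : Fin n) :
    pderiv R (.inl j) (crossMonomial R s t p q)
      = if s = j then (p : R) • crossMonomial R s t (p - 1) q else 0 := by
  simp only [crossMonomial, Derivation.leibniz, Derivation.leibniz_pow]
  rw [pderiv_X_of_ne (show (Sum.inr t : Coord n) ≠ .inl j by simp)]
  split_ifs with h
  · subst h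
    rw [pderiv_X_self, Nat.cast_smul_eq_nsmul]
    simp only [smul_eq_mul, nsmul_eq_mul]
    ring
  · rw [pderiv_X_of_ne (show (Sum.inl s : Coord n) ≠ .inl j by simpa using h)]
    simp only [smul_zero, add_zero]

theorem pderiv_inr_crossMonomial (s t : Fin n) (p q : ℕ) (j : Fin n) :
    pderiv R (.inr j) (crossMonomial R s t p q)
      = if t = j then (q : R) • crossMonomial R s t p (q - 1) else 0 := by
  simp only [crossMonomial, Derivation.leibniz, Derivation.leibniz_pow]
  rw [pderiv_X_of_ne (show (Sum.inl s : Coord n) ≠ .inr j by simp)]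
  split_ifs with h
  · subst h
    rw [pderiv_X_self, Nat.cast_smul_eq_nsmul]
    simp only [smul_eq_mul, nsmul_eq_mul]
    ring
  · rw [pderiv_X_of_ne (show (Sum.inr t : Coord n) ≠ .inr j by simpa using h)]
    simp only [smul_zero, add_zero]

theorem poisson_crossMonomial (s t : Fin n) (p q : ℕ) :
    poisson (crossMonomial R s t p q) (crossMonomial R t s q p)
      = ((p : R) ^ 2) • (act R s ^ (p - 1) * act R t ^ q)
        - ((q : R) ^ 2) • (act R s ^ p * act R t ^ (q - 1)) := by
  simp only [poisson_apply, pderiv_inl_crossMonomial, pderiv_inr_crossMonomial, ite_mul, mul_ite,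
    zero_mul, mul_zero, Finset.sum_sub_distrib, Finset.sum_ite_eq, Finset.mem_univ, if_true]
  simp only [crossMonomial, act, smul_eq_C_mul, map_pow]
  ring

theorem coeff_act_pow_mul_act_pow (s t : Fin n) (a b : ℕ) (k : Fin n →₀ ℕ) [Decidable
    (k = Finsupp.single s a + Finsupp.single t b)] :
    coeff (actExp k) (act R s ^ a * act R t ^ b)
      = if k = Finsupp.single s a + Finsupp.single t b then 1 else 0 := by
  classical
  have hact : act R s ^ a * act R t ^ b
      = monomial (actExp (Finsupp.single s a + Finsupp.single t b)) 1 := by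
    simp only [act_eq_monomial, monomial_pow, monomial_mul_monomial, one_pow, mul_one, map_add,
      ← map_nsmul, Finsupp.smul_single, smul_eq_mul]
  simp only [hact, coeff_monomial, actExp_injective.eq_iff]

theorem degree_actExp (k : Fin n →₀ ℕ) : (actExp k).degree = 2 * k.degree := by
  rw [Finsupp.degree_eq_sum, Finsupp.degree_eq_sum, Fintype.sum_sum_type, two_mul]
  simp only [actExp_inl, actExp_inr]

theorem coeff_poisson_crossMonomial {s t : Fin n} (hst : s ≠ t) {p : ℕ} (hp : 1 ≤ p) (q : ℕ) :
    coeff (actExp (Finsupp.single s (p - 1) + Finsupp.single t q))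
      (poisson (crossMonomial R s t p q) (crossMonomial R t s q p)) = (p : R) ^ 2 := by
  classical
  have hne : Finsupp.single s (p - 1) + Finsupp.single t q
      ≠ Finsupp.single s p + Finsupp.single t (q - 1) := fun h => by
    have hs := DFunLike.congr_fun h s
    simp only [Finsupp.add_apply, Finsupp.single_eq_same, Finsupp.single_eq_of_ne hst] at hs
    omega
  rw [poisson_crossMonomial, map_sub, coeff_smul, coeff_smul, coeff_act_pow_mul_act_pow,
    coeff_act_pow_mul_act_pow, if_pos rfl, if_neg hne, mul_zero, sub_zero, mul_one]

theorem exists_le_norm_add_smul_add_smul {E : Type*} [NormedAddCommGroup E] [NormedSpace ℂ E]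
    (u v w : E) :
    ∃ c : ℝ, |c| ≤ 1 ∧ ‖w‖ / 4 ≤ ‖u + (c : ℂ) • v + ((c : ℂ) ^ 2 / 2) • w‖ := by
  let f : ℝ → E := fun c => u + (c : ℂ) • v + ((c : ℂ) ^ 2 / 2) • w
  by_contra! hsmall
  have hw : w = f 1 + f (-1) - (f 0 + f 0) := by
    simp only [f]
    push_cast
    module
  have hnorm : ‖w‖ ≤ ‖f 1‖ + ‖f (-1)‖ + (‖f 0‖ + ‖f 0‖) := by
    calc ‖w‖ = ‖f 1 + f (-1) - (f 0 + f 0)‖ := by rw [← hw]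
      _ ≤ ‖f 1 + f (-1)‖ + ‖f 0 + f 0‖ := norm_sub_le _ _
      _ ≤ _ := add_le_add (norm_add_le _ _) (norm_add_le _ _)
  linarith [hsmall 1 (by simp), hsmall (-1) (by simp), hsmall 0 (by simp)]

section Generator

variable {K : Type*} [Field K] {q A B : MvPowerSeries (Coord n) K} {δ : K}

theorem poisson_generator (hδ : δ ≠ 0) (hA : poisson q A = δ • A) (hB : poisson q B = -δ • B)
    (a b : K) : poisson q (δ⁻¹ • (a • A - b • B)) = a • A + b • B := by
  rw [map_smul, map_sub, map_smul, map_smul, hA, hB, smul_comm a δ, smul_comm b (-δ), neg_smul,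
    sub_neg_eq_add, ← smul_add, smul_smul, inv_mul_cancel₀ hδ, one_smul]

theorem generator_poisson (A B : MvPowerSeries (Coord n) K) (δ a b : K) :
    poisson (δ⁻¹ • (a • A - b • B)) (a • A + b • B) = (2 * a * b * δ⁻¹) • poisson A B := by
  simp only [map_smul, map_sub, map_add, LinearMap.smul_apply, LinearMap.sub_apply, poisson_self,
    poisson_antisymm B A]
  module

theorem poisson_poisson_eq_zero (hA : poisson q A = δ • A) (hB : poisson q B = -δ • B) :
    poisson q (poisson A B) = 0 := by
  rw [poisson_jacobi, hA, hB, map_smul, map_smul, LinearMap.smul_apply, neg_smul,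
    add_neg_cancel]

end Generator

/-- `F` is a normal form of `H` with respect to the diagonal quadratic part `∑ μ_j x_j y_j`: it
commutes with the quadratic part and arises from `H` by a symplectic automorphism. This is the
notion of normal form in the complex coordinates that diagonalize the quadratic part. -/
def IsDiagNormalFormOf (μ : Fin n → R) (F H : MvPowerSeries (Coord n) R) : Prop :=
  poisson (diagQuad μ) F = 0 ∧ F - diagQuad μ ∈ orderGE (Coord n) R 3 ∧
    ∃ e : MvPowerSeries (Coord n) R ≃ₐ[R] MvPowerSeries (Coord n) R, IsSymplecticAut e ∧ e H = F

theorem le_norm_coeff_poisson_generator {s t : Fin n} (hst : s ≠ t) {p : ℕ} (hp : 1 ≤ p) (q : ℕ)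
    (a b δ : ℂ) :
    ‖a * b‖ / (2 * ‖δ‖) ≤ ‖coeff (actExp (Finsupp.single s (p - 1) + Finsupp.single t q))
      ((2 * a * b * δ⁻¹) • poisson (crossMonomial ℂ s t p q) (crossMonomial ℂ t s q p))‖ / 4 := by
  have hp2 : (1 : ℝ) ≤ (p : ℝ) ^ 2 := one_le_pow₀ (by exact_mod_cast hp)
  rw [coeff_smul, coeff_poisson_crossMonomial hst hp]
  simp only [norm_mul, norm_inv, norm_pow, Complex.norm_natCast, Complex.norm_ofNat]
  calc ‖a‖ * ‖b‖ / (2 * ‖δ‖) = ‖a‖ * ‖b‖ / ‖δ‖ / 2 * 1 := by rw [mul_one, div_div, mul_comm 2]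
    _ ≤ ‖a‖ * ‖b‖ / ‖δ‖ / 2 * (p : ℝ) ^ 2 := by gcongr
    _ = 2 * ‖a‖ * ‖b‖ * ‖δ‖⁻¹ * (p : ℝ) ^ 2 / 4 := by ring

-- The coefficient in question is a quadratic polynomial in the multiplier `c`, with leading
-- coefficient of the size of the inverse of the divisor, so it is large for one of three values.
theorem exists_isDiagNormalFormOf_coeff_ge {μ : Fin n → ℂ} {H : MvPowerSeries (Coord n) ℂ}
    (hH : H - diagQuad μ ∈ orderGE (Coord n) ℂ 3) {s t : Fin n} (hst : s ≠ t) {p q : ℕ}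
    (hp : 1 ≤ p) (hpq : 3 ≤ p + q) (a b : ℂ) (hδ : μ t * q - μ s * p ≠ 0) :
    ∃ c : ℝ, |c| ≤ 1 ∧ ∀ R ∈ orderGE (Coord n) ℂ (2 * (p + q) - 1), ∃ F,
      IsDiagNormalFormOf μ F
        (H + (c : ℂ) • (a • crossMonomial ℂ s t p q + b • crossMonomial ℂ t s q p) + R) ∧
      ‖a * b‖ / (2 * ‖μ t * q - μ s * p‖)
        ≤ ‖coeff (actExp (Finsupp.single s (p - 1) + Finsupp.single t q)) F‖ := by
  set δ := μ t * q - μ s * p with hδdef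
  set A := crossMonomial ℂ s t p q
  set B := crossMonomial ℂ t s q p with hB
  set k := Finsupp.single s (p - 1) + Finsupp.single t q with hk
  have hqA : poisson (diagQuad μ) A = δ • A := poisson_diagQuad_crossMonomial μ s t p q
  have hqB : poisson (diagQuad μ) B = -δ • B := by
    rw [hB, poisson_diagQuad_crossMonomial, hδdef, neg_sub]
  have hBm : B ∈ orderGE (Coord n) ℂ (p + q) := add_comm q p ▸ crossMonomial_mem_orderGE t s q p
  have hGm : δ⁻¹ • (a • A - b • B) ∈ orderGE (Coord n) ℂ (p + q) := smul_mem_orderGE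
    (Ideal.sub_mem _ (smul_mem_orderGE (crossMonomial_mem_orderGE s t p q) a)
      (smul_mem_orderGE hBm b)) _
  have hGP := poisson_generator hδ hqA hqB a b
  obtain ⟨S₀, S₁, hS⟩ := exists_normalForms_of_perturbation (diagQuad_mem_orderGE μ)
    (isSemisimple_diagQuad μ) hH (d := p + q - 2) (by omega)
    (by rwa [Nat.sub_add_cancel (by omega)])
    (by rw [hGP, generator_poisson, map_smul, poisson_poisson_eq_zero hqA hqB, smul_zero])
  rw [hGP, generator_poisson, show 2 * (p + q - 2) + 3 = 2 * (p + q) - 1 by omega] at hS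
  obtain ⟨c, hc, hlarge⟩ := exists_le_norm_add_smul_add_smul (coeff (actExp k) S₀)
    (coeff (actExp k) S₁) (coeff (actExp k) ((2 * a * b * δ⁻¹) • poisson A B))
  refine ⟨c, hc, fun R hR => ?_⟩
  obtain ⟨e, he, hcomm, hquad, hcoeff⟩ := hS c R hR
  refine ⟨_, ⟨hcomm, hquad, e, he, rfl⟩,
    (le_norm_coeff_poisson_generator hst hp q a b δ).trans (hlarge.trans_eq ?_)⟩
  have hdeg : (actExp k).degree < 2 * (p + q) - 1 := by
    rw [degree_actExp, hk, map_add, Finsupp.degree_single, Finsupp.degree_single]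
    omega
  rw [sub_eq_zero.mp ((map_sub _ _ _).symm.trans (coeff_eq_zero_of_mem_orderGE hcoeff hdeg))]
  simp only [(coeff _).map_add, (coeff _).map_smul]

end Perturbation

section Canonical

variable {n : ℕ} {R : Type*} [CommRing R] {ψ : Coord n → MvPowerSeries (Coord n) R}

theorem poisson_X_X (a b : Coord n) :
    poisson (X a) (X b) = -C (Matrix.J (Fin n) R a b) := by
  rcases a with i | i <;> rcases b with j | j <;>
    simp [poisson_X_inl, poisson_X_inr, pderiv_X, Matrix.J, Matrix.one_apply, Pi.single_apply,
      eq_comm, apply_ite C]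

theorem poisson_subst_left (hψ : ∀ i, constantCoeff (ψ i) = 0)
    (f g : MvPowerSeries (Coord n) R) :
    poisson (subst ψ f) g = ∑ a, subst ψ (pderiv R a f) * poisson (ψ a) g := by
  simp only [poisson_apply, pderiv_subst hψ, Finset.sum_mul, Finset.mul_sum,
    ← Finset.sum_sub_distrib]
  rw [Finset.sum_comm]
  exact Finset.sum_congr rfl fun a _ => Finset.sum_congr rfl fun j _ => by ring

theorem poisson_subst_subst (hψ : ∀ i, constantCoeff (ψ i) = 0)
    (f g : MvPowerSeries (Coord n) R) : poisson (subst ψ f) (subst ψ g)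
      = ∑ a, ∑ b, subst ψ (pderiv R a f) * subst ψ (pderiv R b g) * poisson (ψ a) (ψ b) := by
  rw [poisson_subst_left hψ]
  refine Finset.sum_congr rfl fun a _ => ?_
  rw [poisson_antisymm, poisson_subst_left hψ, ← Finset.sum_neg_distrib, Finset.mul_sum]
  refine Finset.sum_congr rfl fun b _ => ?_
  rw [poisson_antisymm (ψ b)]
  ring

/-- The components of a formal map without constant terms satisfy the canonical commutation
relations. Over `ℝ` this is the condition `IsFormalSymplectic`, expressed by Poisson brackets. -/
def IsCanonical (ψ : Coord n → MvPowerSeries (Coord n) R) : Prop :=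
  (∀ i, constantCoeff (ψ i) = 0) ∧ ∀ a b, poisson (ψ a) (ψ b) = poisson (X a) (X b)

theorem IsCanonical.hasSubst (h : IsCanonical ψ) : HasSubst ψ :=
  hasSubst_of_constantCoeff_zero h.1

theorem IsCanonical.subst_poisson (h : IsCanonical ψ) (f g : MvPowerSeries (Coord n) R) :
    subst ψ (poisson f g) = poisson (subst ψ f) (subst ψ g) := by
  have hfg := poisson_subst_subst (R := R) (ψ := X) constantCoeff_X f g
  simp only [subst_self, id_eq, poisson_X_X] at hfg
  rw [poisson_subst_subst h.1, hfg, ← coe_substAlgHom (R := R) h.hasSubst]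
  simp only [map_sum, map_mul, map_neg, h.2, poisson_X_X]
  simp only [coe_substAlgHom, subst_C]

theorem IsSymplecticAut.isCanonical
    {e : MvPowerSeries (Coord n) R ≃ₐ[R] MvPowerSeries (Coord n) R} (h : IsSymplecticAut e) :
    IsCanonical fun i => e (X i) := by
  refine ⟨fun i => mem_orderGE_one.mp (h.map_mem 1 _ (X_mem_orderGE i)), fun a b => ?_⟩
  rw [← h.map_poisson, poisson_X_X, map_neg]
  exact congrArg Neg.neg (e.commutes _)

theorem IsCanonical.map {S : Type*} [CommRing S] (h : IsCanonical ψ) (φ : R →+* S) :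
    IsCanonical fun i => MvPowerSeries.map φ (ψ i) := by
  refine ⟨fun i => ?_, fun a b => ?_⟩
  · rw [constantCoeff_map, h.1, map_zero]
  · rw [← map_poisson, h.2, map_poisson, map_X, map_X]

theorem jacobian_mul_J_mul_transpose_apply (φ : Coord n → MvPowerSeries (Coord n) ℝ)
    (a b : Coord n) :
    (jacobian φ * Matrix.J (Fin n) (MvPowerSeries (Coord n) ℝ) * (jacobian φ)ᵀ) a b
      = -poisson (φ a) (φ b) := by
  rw [poisson_apply, Matrix.mul_apply, Fintype.sum_sum_type, ← Finset.sum_neg_distrib,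
    ← Finset.sum_add_distrib]
  refine Finset.sum_congr rfl fun j _ => ?_
  rw [Matrix.mul_apply, Matrix.mul_apply, Fintype.sum_sum_type, Fintype.sum_sum_type]
  simp [Matrix.J, jacobian, Matrix.one_apply]
  ring

theorem isFormalSymplectic_iff {φ : Coord n → MvPowerSeries (Coord n) ℝ} :
    IsFormalSymplectic φ ↔ IsCanonical φ := by
  have hJ (a b : Coord n) : Matrix.J (Fin n) (MvPowerSeries (Coord n) ℝ) a b
      = -poisson (X a) (X b) := by
    rw [poisson_X_X, neg_neg]
    rcases a with i | i <;> rcases b with j | j <;>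
      simp [Matrix.J, Matrix.one_apply, apply_ite C]
  rw [IsFormalSymplectic, IsCanonical, ← SymplecticGroup.mem_iff', SymplecticGroup.mem_iff,
    ← Matrix.ext_iff]
  simp only [jacobian_mul_J_mul_transpose_apply, hJ, neg_inj]

end Canonical

section LinearMaps

variable {n : ℕ} {R : Type*} [CommRing R] {α β γ δ : Fin n → R}

/-- The linear map acting on the plane of `x_j, y_j` by the matrix `!![α j, β j; γ j, δ j]`. -/
noncomputable def planeMap (α β γ δ : Fin n → R) : Coord n → MvPowerSeries (Coord n) R
  | .inl j => α j • X (.inl j) + β j • X (.inr j)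
  | .inr j => γ j • X (.inl j) + δ j • X (.inr j)

theorem constantCoeff_planeMap (i : Coord n) : constantCoeff (planeMap α β γ δ i) = 0 := by
  rcases i with j | j <;> simp [planeMap, smul_eq_C_mul]

theorem hasSubst_planeMap : HasSubst (planeMap α β γ δ) :=
  hasSubst_of_constantCoeff_zero constantCoeff_planeMap

theorem isCanonical_planeMap (h : ∀ j, α j * δ j - β j * γ j = 1) :
    IsCanonical (planeMap α β γ δ) := by
  refine ⟨constantCoeff_planeMap, fun a b => ?_⟩
  rcases a with i | i <;> rcases b with j | j <;>
    simp only [planeMap, map_add, map_smul, LinearMap.add_apply, LinearMap.smul_apply, poisson_X_X,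
      Matrix.J, Matrix.fromBlocks_apply₁₁, Matrix.fromBlocks_apply₁₂, Matrix.fromBlocks_apply₂₁,
      Matrix.fromBlocks_apply₂₂, Matrix.zero_apply, Matrix.neg_apply, map_zero, neg_zero,
      smul_zero, add_zero, zero_add, map_neg, neg_neg, smul_neg, Matrix.one_apply] <;>
    split_ifs with hij <;>
    simp only [map_zero, map_one, smul_zero, neg_zero, add_zero]
  all_goals
    subst hij
    have hC : (C (α i) : MvPowerSeries (Coord n) R) * C (δ i) - C (β i) * C (γ i) = 1 := by
      rw [← map_mul, ← map_mul, ← map_sub, h, map_one]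
    simp only [smul_eq_C_mul]
  · ring
  · linear_combination hC
  · linear_combination -hC
  · ring

theorem subst_planeMap_planeMap (h : ∀ j, α j * δ j - β j * γ j = 1) (i : Coord n) :
    subst (planeMap α β γ δ) (planeMap δ (-β) (-γ) α i) = X i := by
  have hs := hasSubst_planeMap (α := α) (β := β) (γ := γ) (δ := δ)
  have hC (j) : (C (α j) : MvPowerSeries (Coord n) R) * C (δ j) - C (β j) * C (γ j) = 1 := by
    rw [← map_mul, ← map_mul, ← map_sub, h, map_one]
  rcases i with j | j
  all_goals
    simp only [planeMap, subst_add hs, subst_smul hs, subst_X hs]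
    simp only [smul_eq_C_mul, Pi.neg_apply, map_neg]
  · linear_combination (X (.inl j)) * hC j
  · linear_combination (X (.inr j)) * hC j

theorem substAlgHom_planeMap_comp (h : ∀ j, α j * δ j - β j * γ j = 1) :
    (substAlgHom (hasSubst_planeMap (α := α) (β := β) (γ := γ) (δ := δ))).comp
      (substAlgHom (hasSubst_planeMap (α := δ) (β := -β) (γ := -γ) (δ := α)))
      = AlgHom.id R (MvPowerSeries (Coord n) R) := by
  ext1 f
  simp only [AlgHom.comp_apply, substAlgHom_apply, AlgHom.id_apply]
  rw [subst_comp_subst_apply hasSubst_planeMap hasSubst_planeMap]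
  simp only [subst_planeMap_planeMap h, subst_self, id]

/-- The linear symplectic change of coordinates given by `planeMap`. -/
noncomputable def planeEquiv (h : ∀ j, α j * δ j - β j * γ j = 1) :
    MvPowerSeries (Coord n) R ≃ₐ[R] MvPowerSeries (Coord n) R :=
  AlgEquiv.ofAlgHom (substAlgHom (hasSubst_planeMap (α := α) (β := β) (γ := γ) (δ := δ)))
    (substAlgHom (hasSubst_planeMap (α := δ) (β := -β) (γ := -γ) (δ := α)))
    (substAlgHom_planeMap_comp h)
    (by
      have hinv := substAlgHom_planeMap_comp (α := δ) (β := -β) (γ := -γ) (δ := α) fun j => by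
        rw [Pi.neg_apply, Pi.neg_apply, neg_mul_neg, mul_comm, h]
      simpa only [neg_neg] using hinv)

theorem planeEquiv_apply (h : ∀ j, α j * δ j - β j * γ j = 1) (f : MvPowerSeries (Coord n) R) :
    planeEquiv h f = subst (planeMap α β γ δ) f := substAlgHom_apply hasSubst_planeMap f

theorem planeEquiv_X (h : ∀ j, α j * δ j - β j * γ j = 1) (i : Coord n) :
    planeEquiv h (X i) = planeMap α β γ δ i := by
  rw [planeEquiv_apply, subst_X hasSubst_planeMap]

theorem planeEquiv_symm_apply (h : ∀ j, α j * δ j - β j * γ j = 1)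
    (f : MvPowerSeries (Coord n) R) :
    (planeEquiv h).symm f = subst (planeMap δ (-β) (-γ) α) f :=
  substAlgHom_apply hasSubst_planeMap f

theorem isSymplecticAut_planeEquiv (h : ∀ j, α j * δ j - β j * γ j = 1) :
    IsSymplecticAut (planeEquiv h) where
  map_poisson f g := by
    simp only [planeEquiv_apply]
    exact (isCanonical_planeMap h).subst_poisson f g
  map_mem N f hf := by
    rw [planeEquiv_apply]
    exact subst_mem_orderGE constantCoeff_planeMap hf
  symm_mem N f hf := by
    rw [planeEquiv_symm_apply]
    exact subst_mem_orderGE constantCoeff_planeMap hf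

end LinearMaps

section Complexification

variable {σ : Type*}

/-- The complexification of a real power series. -/
noncomputable abbrev complexify (f : MvPowerSeries σ ℝ) : MvPowerSeries σ ℂ :=
  MvPowerSeries.map Complex.ofRealHom f

theorem complexify_smul (c : ℝ) (f : MvPowerSeries σ ℝ) :
    complexify (c • f) = (c : ℂ) • complexify f := by
  ext m
  simp [coeff_map]

theorem exists_eq_complexify_add (f : MvPowerSeries σ ℂ) :
    ∃ u v : MvPowerSeries σ ℝ, f = complexify u + Complex.I • complexify v ∧
      ∀ N, f ∈ orderGE σ ℂ N → u ∈ orderGE σ ℝ N := by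
  let u : MvPowerSeries σ ℝ := fun m => (coeff m f).re
  let v : MvPowerSeries σ ℝ := fun m => (coeff m f).im
  have hu : ∀ m, coeff m u = (coeff m f).re := fun _ => rfl
  have hv : ∀ m, coeff m v = (coeff m f).im := fun _ => rfl
  refine ⟨u, v, ?_, fun N hf => mem_orderGE_iff_coeff.mpr fun m hm => ?_⟩
  · ext m
    rw [map_add, coeff_smul, coeff_map, coeff_map, hu, hv, mul_comm]
    exact (Complex.re_add_im _).symm
  · rw [hu, coeff_eq_zero_of_mem_orderGE hf hm, Complex.zero_re]

theorem eq_zero_of_complexify_add {u v : MvPowerSeries σ ℝ}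
    (h : complexify u + Complex.I • complexify v = 0) : u = 0 := by
  ext m
  simpa [coeff_map] using congrArg (fun f => (coeff m f).re) h

theorem isSemisimple_of_complexify {n : ℕ} {q : MvPowerSeries (Coord n) ℝ} {μ : Fin n → ℂ}
    {T : MvPowerSeries (Coord n) ℂ ≃ₐ[ℂ] MvPowerSeries (Coord n) ℂ} (hT : IsSymplecticAut T)
    (hq : T (complexify q) = diagQuad μ) : IsSemisimple q := by
  intro N R hR
  have hTR := hT.map_mem N _ (map_mem_orderGE Complex.ofRealHom hR)
  rw [map_poisson, hT.map_poisson, hq] at hTR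
  obtain ⟨w, hw, hw0⟩ := isSemisimple_diagQuad μ N _ hTR
  obtain ⟨u, v, huv, hu⟩ := exists_eq_complexify_add (T.symm w)
  refine ⟨u, hu N (hT.symm_mem N w hw), ?_⟩
  have hw' : poisson (complexify q) (complexify R - poisson (complexify q) (T.symm w)) = 0 := by
    apply T.injective
    rw [hT.map_poisson, map_sub, hT.map_poisson, AlgEquiv.apply_symm_apply, hq, hw0, map_zero]
  apply eq_zero_of_complexify_add (v := -poisson q (poisson q v))
  rw [← hw', huv]
  simp only [complexify, map_neg, map_sub, map_poisson, map_add, map_smul]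
  rw [smul_neg]
  ring

end Complexification

section Diagonalization

variable {n : ℕ} (κ : ℕ)

/-- The linear form that the diagonalizing coordinates turn into a multiple of the `j`-th position
variable. -/
noncomputable def posForm (j : Fin n) : MvPowerSeries (Coord n) ℂ :=
  if (j : ℕ) < κ then X (.inl j) - C Complex.I * X (.inr j) else X (.inl j)

/-- The linear form that the diagonalizing coordinates turn into a multiple of the `j`-th momentum
variable. -/
noncomputable def momForm (j : Fin n) : MvPowerSeries (Coord n) ℂ :=
  if (j : ℕ) < κ then X (.inl j) + C Complex.I * X (.inr j) else X (.inr j)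

/-- The multiple of the position variable that `posForm` becomes in the diagonalizing
coordinates. -/
def posFactor (j : Fin n) : ℂ := if (j : ℕ) < κ then 2 else 1

/-- The multiple of the momentum variable that `momForm` becomes in the diagonalizing
coordinates. -/
noncomputable def momFactor (j : Fin n) : ℂ := if (j : ℕ) < κ then Complex.I else 1

/-- The generator of the invariants in the `j`-th plane: `x_j² + y_j²` for an elliptic plane
(`j < κ`) and `x_j y_j` for a hyperbolic one. -/
noncomputable def planeInvariant (R : Type*) [CommRing R] (j : Fin n) :
    MvPowerSeries (Coord n) R :=
  if (j : ℕ) < κ then X (.inl j) ^ 2 + X (.inr j) ^ 2 else act R j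

theorem C_I_mul_C_I {σ : Type*} : (C Complex.I : MvPowerSeries σ ℂ) * C Complex.I = -1 := by
  rw [← map_mul, Complex.I_mul_I, map_neg, map_one]

theorem posForm_mul_momForm (j : Fin n) : posForm κ j * momForm κ j = planeInvariant κ ℂ j := by
  rw [posForm, momForm, planeInvariant]
  split_ifs
  · linear_combination (-X (.inr j) ^ 2) * C_I_mul_C_I
  · rfl

theorem map_planeInvariant {R S : Type*} [CommRing R] [CommRing S] (φ : R →+* S) (j : Fin n) :
    MvPowerSeries.map φ (planeInvariant κ R j) = planeInvariant κ S j := by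
  rw [planeInvariant, planeInvariant]
  split_ifs <;> simp [act]

theorem planeInvariant_mem_orderGE {R : Type*} [CommRing R] (j : Fin n) :
    planeInvariant κ R j ∈ orderGE (Coord n) R 2 := by
  rw [planeInvariant]
  split_ifs
  · exact Ideal.add_mem _ (pow_mem_orderGE (X_mem_orderGE _) 2)
      (pow_mem_orderGE (X_mem_orderGE _) 2)
  · exact act_mem_orderGE j

/-- The complex symplectic linear change of coordinates that diagonalizes the quadratic part: on an
elliptic plane it sends `x_j` to `x_j + (i/2) y_j` and `y_j` to `i x_j + (1/2) y_j`. -/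
noncomputable def diagonalize (n κ : ℕ) :
    MvPowerSeries (Coord n) ℂ ≃ₐ[ℂ] MvPowerSeries (Coord n) ℂ :=
  planeEquiv (α := fun _ => 1) (β := fun j : Fin n => if (j : ℕ) < κ then Complex.I / 2 else 0)
    (γ := fun j => if (j : ℕ) < κ then Complex.I else 0)
    (δ := fun j => if (j : ℕ) < κ then 1 / 2 else 1) fun j => by
      split_ifs
      · linear_combination (-1 / 2 : ℂ) * Complex.I_mul_I
      · ring

theorem isSymplecticAut_diagonalize : IsSymplecticAut (diagonalize n κ) :=
  isSymplecticAut_planeEquiv _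

theorem diagonalize_subst {τ : Type*} {a : τ → MvPowerSeries (Coord n) ℂ} (ha : HasSubst a)
    (g : MvPowerSeries τ ℂ) :
    diagonalize n κ (subst a g) = subst (fun i => diagonalize n κ (a i)) g := by
  simp only [diagonalize, planeEquiv_apply]
  exact subst_comp_subst_apply ha hasSubst_planeMap g

theorem diagonalize_C (c : ℂ) : diagonalize n κ (C c) = C c := (diagonalize n κ).commutes c

theorem diagonalize_posForm (j : Fin n) :
    diagonalize n κ (posForm κ j) = posFactor κ j • X (.inl j) := by
  rw [posForm, posFactor]
  split_ifs with h
  · rw [map_sub, map_mul, diagonalize_C, diagonalize, planeEquiv_X, planeEquiv_X]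
    simp only [planeMap, if_pos h, smul_eq_C_mul, map_one, div_eq_mul_inv, map_mul, one_mul]
    rw [map_ofNat C 2]
    linear_combination (-X (.inl j)) * C_I_mul_C_I
  · rw [diagonalize, planeEquiv_X]
    simp [planeMap, h]

theorem diagonalize_momForm (j : Fin n) :
    diagonalize n κ (momForm κ j) = momFactor κ j • X (.inr j) := by
  rw [momForm, momFactor]
  split_ifs with h
  · rw [map_add, map_mul, diagonalize_C, diagonalize, planeEquiv_X, planeEquiv_X]
    simp only [planeMap, if_pos h, smul_eq_C_mul, map_one, div_eq_mul_inv, map_mul, one_mul]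
    have hC2 : (C (2 : ℂ)⁻¹ : MvPowerSeries (Coord n) ℂ) * 2 = 1 := by
      rw [← map_ofNat C 2, ← map_mul, inv_mul_cancel₀ two_ne_zero, map_one]
    linear_combination (X (.inl j)) * C_I_mul_C_I + (C Complex.I * X (.inr j)) * hC2
  · rw [diagonalize, planeEquiv_X]
    simp [planeMap, h]

theorem diagonalize_planeInvariant (j : Fin n) :
    diagonalize n κ (planeInvariant κ ℂ j) = (posFactor κ j * momFactor κ j) • act ℂ j := by
  rw [← posForm_mul_momForm, map_mul, diagonalize_posForm, diagonalize_momForm, smul_mul_smul_comm,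
    act]

theorem norm_posFactor (j : Fin n) : ‖posFactor κ j‖ = if (j : ℕ) < κ then 2 else 1 := by
  rw [posFactor]
  split_ifs <;> simp

theorem norm_momFactor (j : Fin n) : ‖momFactor κ j‖ = 1 := by
  rw [momFactor]
  split_ifs <;> simp

theorem posFactor_mul_momFactor_ne_zero (j : Fin n) : posFactor κ j * momFactor κ j ≠ 0 := by
  rw [← norm_ne_zero_iff, norm_mul, norm_posFactor, norm_momFactor]
  split_ifs <;> simp

end Diagonalization

section Spectrum

variable {n κ : ℕ} {t : Fin n → ℝ}

/-- The eigenvalues `i t_j` for `j < κ` and `t_j` for the other indices. -/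
noncomputable def spectrumOf (κ : ℕ) (t : Fin n → ℝ) (j : Fin n) : ℂ :=
  if (j : ℕ) < κ then Complex.I * t j else t j

/-- The eigenvalues in the diagonalizing coordinates. -/
noncomputable def diagSpectrum (κ : ℕ) (t : Fin n → ℝ) (j : Fin n) : ℂ :=
  if (j : ℕ) < κ then -(Complex.I * t j) else t j

/-- The coefficient of the generator of the invariants of the `j`-th plane in the quadratic part of
a Hamiltonian with eigenvalues `spectrumOf κ t`. -/
noncomputable def quadCoeff (κ : ℕ) (t : Fin n → ℝ) (j : Fin n) : ℝ :=
  if (j : ℕ) < κ then -t j / 2 else t j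

/-- The quadratic part of a Hamiltonian with eigenvalues `spectrumOf κ t`. -/
noncomputable def quadSeries (κ : ℕ) (t : Fin n → ℝ) : MvPowerSeries (Coord n) ℝ :=
  ∑ j, quadCoeff κ t j • planeInvariant κ ℝ j

theorem quadSeries_mem_orderGE (κ : ℕ) (t : Fin n → ℝ) :
    quadSeries κ t ∈ orderGE (Coord n) ℝ 2 :=
  Ideal.sum_mem _ fun j _ => smul_mem_orderGE (planeInvariant_mem_orderGE κ j) _

theorem quadCoeff_mul_factors (κ : ℕ) (t : Fin n → ℝ) (j : Fin n) :
    (quadCoeff κ t j : ℂ) * (posFactor κ j * momFactor κ j) = diagSpectrum κ t j := by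
  rw [quadCoeff, posFactor, momFactor, diagSpectrum]
  split_ifs <;> push_cast <;> ring

theorem diagonalize_quadSeries (κ : ℕ) (t : Fin n → ℝ) :
    diagonalize n κ (complexify (quadSeries κ t)) = diagQuad (diagSpectrum κ t) := by
  rw [quadSeries, complexify, map_sum, map_sum, diagQuad]
  refine Finset.sum_congr rfl fun j _ => ?_
  rw [← complexify, complexify_smul, map_smul, complexify, map_planeInvariant,
    diagonalize_planeInvariant, smul_smul, quadCoeff_mul_factors]

theorem isConjPair_spectrumOf (ht : Function.Injective t) {p : Fin n × Fin n} :
    IsConjPair κ (spectrumOf κ t) p ↔ κ ≤ (p.1 : ℕ) ∧ p.1 = p.2 := by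
  rw [IsConjPair]
  constructor
  · rintro ⟨h1, h2, h⟩
    rw [spectrumOf, spectrumOf, if_neg (not_lt.mpr h1), if_neg (not_lt.mpr h2),
      Complex.conj_ofReal] at h
    exact ⟨h1, (ht (by exact_mod_cast h)).symm⟩
  · rintro ⟨h1, h⟩
    refine ⟨h1, h ▸ h1, ?_⟩
    rw [← h, spectrumOf, if_neg (not_lt.mpr h1), Complex.conj_ofReal]

end Spectrum

section BirkhoffNormalForms

variable {n κ : ℕ} {t : Fin n → ℝ}

theorem exists_invariants_eq (ht : Function.Injective t) :
    ∃ (π : {j : Fin n // (j : ℕ) < κ} ⊕ {p : Fin n × Fin n // IsConjPair κ (spectrumOf κ t) p} ≃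
        Fin n) (c : _ → ℂ), (∀ i, c i ≠ 0) ∧
      ∀ i, invariants κ (spectrumOf κ t) i = c i • planeInvariant κ ℂ (π i) := by
  let π : {j : Fin n // (j : ℕ) < κ} ⊕ {p : Fin n × Fin n // IsConjPair κ (spectrumOf κ t) p} →
    Fin n := Sum.elim Subtype.val fun p => p.1.1
  have hπ : Function.Bijective π := by
    refine ⟨Function.Injective.sumElim Subtype.val_injective ?_ fun j p h => ?_, fun j => ?_⟩
    · rintro ⟨⟨k, l⟩, hp⟩ ⟨⟨k', l'⟩, hp'⟩ (rfl : k = k')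
      obtain rfl : k = l := ((isConjPair_spectrumOf ht).mp hp).2
      obtain rfl : k = l' := ((isConjPair_spectrumOf ht).mp hp').2
      rfl
    · exact absurd (h ▸ j.2) (not_lt.mpr p.2.1)
    · by_cases hj : (j : ℕ) < κ
      · exact ⟨.inl ⟨j, hj⟩, rfl⟩
      · exact ⟨.inr ⟨(j, j), (isConjPair_spectrumOf ht).mpr ⟨not_lt.mp hj, rfl⟩⟩, rfl⟩
  refine ⟨Equiv.ofBijective π hπ, Sum.elim (fun _ => 1) fun _ => 2, ?_, ?_⟩
  · rintro (_ | _) <;> simp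
  · rintro (j | p)
    · simp [invariants, planeInvariant, π, j.2]
    · have hp := ((isConjPair_spectrumOf ht).mp p.2).2
      simp only [invariants, Sum.elim_inr, Equiv.ofBijective_apply, planeInvariant, π, ← hp, act,
        if_neg (not_lt.mpr p.2.1), smul_eq_C_mul, map_ofNat]
      linear_combination (-X (.inl p.1.1) * X (.inr p.1.1)) * C_I_mul_C_I

theorem isNormalForm_iff (ht : Function.Injective t) {F : MvPowerSeries (Coord n) ℝ} :
    IsNormalForm κ (spectrumOf κ t) F ↔ Balanced (diagonalize n κ (complexify F)) := by
  obtain ⟨π, c, hc, hinv⟩ := exists_invariants_eq (κ := κ) ht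
  set c' := fun i => c i * (posFactor κ (π i) * momFactor κ (π i)) with hc'
  have hsubst : HasSubst (invariants κ (spectrumOf κ t)) :=
    hasSubst_of_constantCoeff_zero fun i => mem_orderGE_one.mp (by
      rw [hinv]
      exact smul_mem_orderGE (orderGE_anti one_le_two (planeInvariant_mem_orderGE κ _)) _)
  have hdiag (g : MvPowerSeries _ ℂ) : diagonalize n κ (subst (invariants κ (spectrumOf κ t)) g)
      = subst (fun i => c' i • act ℂ (π i)) g := by
    simp only [diagonalize_subst κ hsubst, hinv, map_smul, diagonalize_planeInvariant, smul_smul,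
      hc']
  constructor
  · rintro ⟨g, hg⟩
    rw [complexify, hg, hdiag]
    exact balanced_subst_act _ _ g
  · intro h
    obtain ⟨g, hg⟩ := h.exists_eq_subst π (c := c') fun i =>
      mul_ne_zero (hc i) (posFactor_mul_momFactor_ne_zero κ _)
    exact ⟨g, (diagonalize n κ).injective (by rw [hdiag, ← hg])⟩

theorem exists_isBirkhoffNormalFormOf (ht : Function.Injective t)
    (hμ : LinearIndependent ℤ (diagSpectrum κ t)) {H : MvPowerSeries (Coord n) ℝ}
    (hH : H - quadSeries κ t ∈ orderGE (Coord n) ℝ 3) :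
    ∃ F, IsBirkhoffNormalFormOf κ (spectrumOf κ t) F H := by
  have hT := isSymplecticAut_diagonalize (n := n) κ
  have hs : IsSemisimple (quadSeries κ t) :=
    isSemisimple_of_complexify hT (diagonalize_quadSeries κ t)
  have hq := quadSeries_mem_orderGE κ t
  have hqH : poisson (quadSeries κ t) H ∈ orderGE (Coord n) ℝ 3 := by
    simpa [poisson_self] using poisson_quadratic_mem hq hH
  obtain ⟨e, he, -, hF⟩ := exists_isSymplecticAut_normalizing hq hs hH le_rfl hqH
  refine ⟨e H, (isNormalForm_iff ht).mpr (balanced_of_poisson_diagQuad hμ ?_),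
    fun i => e.symm (X i), isFormalSymplectic_iff.mpr he.symm.isCanonical, ?_⟩
  · rw [← diagonalize_quadSeries, ← hT.map_poisson, ← map_poisson, hF, map_zero, map_zero]
  · simpa using (algHom_eq_subst e.symm.toAlgHom he.symm_mem (e H)).symm

end BirkhoffNormalForms

section CoefficientComparison

variable {n : ℕ} (κ : ℕ)

theorem coeff_eq_zero_of_mem_span_X {σ R : Type*} [CommRing R] {S : Set σ}
    {f : MvPowerSeries σ R} (hf : f ∈ Ideal.span (X '' S)) {m : σ →₀ ℕ} (hm : ∀ i ∈ S, m i = 0) :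
    coeff m f = 0 := by
  classical
  induction hf using Submodule.span_induction generalizing m with
  | mem f hf =>
    obtain ⟨i, hi, rfl⟩ := hf
    rw [coeff_X, if_neg]
    rintro rfl
    simpa using hm i hi
  | zero => rw [map_zero]
  | add f g _ _ ihf ihg => rw [map_add, ihf hm, ihg hm, add_zero]
  | smul a f _ ih =>
    rw [smul_eq_mul, coeff_mul]
    refine Finset.sum_eq_zero fun p hp => ?_
    have hpm := Finset.HasAntidiagonal.mem_antidiagonal.mp hp
    refine mul_eq_zero_of_right _ (ih fun i hi => ?_)
    have hi0 : p.1 i + p.2 i = 0 := (DFunLike.congr_fun hpm i).trans (hm i hi)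
    omega

/-- The exponent of the monomial of `planeInvariant` free of the variables `y_j` with `j < κ`. -/
noncomputable def leadExp (j : Fin n) : Coord n →₀ ℕ :=
  if (j : ℕ) < κ then Finsupp.single (.inl j) 2 else actExp (Finsupp.single j 1)

theorem linearCombination_leadExp_inl (k : Fin n →₀ ℕ) (j : Fin n) :
    Finsupp.linearCombination ℕ (leadExp κ) k (.inl j) = k j * if (j : ℕ) < κ then 2 else 1 := by
  classical
  rw [Finsupp.linearCombination_apply, Finsupp.sum_fintype _ _ (by simp), Finsupp.finsetSum_apply,
    Finset.sum_eq_single j (fun i _ hi => ?_) (by simp)]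
  · rw [leadExp]
    split_ifs <;> simp
  · rw [leadExp]
    split_ifs <;> simp [hi]

theorem linearIndependent_leadExp : LinearIndependent ℕ (leadExp (n := n) κ) := by
  intro k l h
  ext j
  have hj := DFunLike.congr_fun h (.inl j)
  rw [linearCombination_leadExp_inl, linearCombination_leadExp_inl] at hj
  exact Nat.eq_of_mul_eq_mul_right (by split_ifs <;> simp) hj

theorem linearCombination_leadExp_inr (k : Fin n →₀ ℕ) {j : Fin n} (hj : (j : ℕ) < κ) :
    Finsupp.linearCombination ℕ (leadExp κ) k (.inr j) = 0 := by
  classical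
  rw [Finsupp.linearCombination_apply, Finsupp.sum_apply]
  refine Finset.sum_eq_zero fun i _ => ?_
  simp only [leadExp]
  split_ifs with hi
  · simp
  · have hij : i ≠ j := by
      rintro rfl
      exact hi hj
    simp [hij]

theorem degree_linearCombination_leadExp (k : Fin n →₀ ℕ) :
    (Finsupp.linearCombination ℕ (leadExp κ) k).degree = 2 * k.degree := by
  rw [Finsupp.linearCombination_apply, Finsupp.sum, map_sum, Finsupp.degree_apply, Finset.mul_sum]
  refine Finset.sum_congr rfl fun i _ => ?_
  rw [map_nsmul, smul_eq_mul, mul_comm, leadExp]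
  congr 1
  split_ifs <;> simp [degree_actExp]

theorem coeff_prod_planeInvariant_pow {R : Type*} [CommRing R] (k l : Fin n →₀ ℕ) :
    coeff (Finsupp.linearCombination ℕ (leadExp κ) k) (l.prod fun j e => planeInvariant κ R j ^ e)
      = if l = k then 1 else 0 := by
  classical
  -- Modulo the variables `y_j` with `j < κ`, every `planeInvariant` is a monomial.
  set J : Ideal (MvPowerSeries (Coord n) R) :=
    Ideal.span (X '' (Sum.inr '' {j : Fin n | (j : ℕ) < κ}))
  have hJ (j : Fin n) : Ideal.Quotient.mk J (planeInvariant κ R j)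
      = Ideal.Quotient.mk J (monomial (leadExp κ j) 1) := by
    rw [Ideal.Quotient.eq, planeInvariant, leadExp]
    split_ifs with hj
    · rw [← X_pow_eq, add_sub_cancel_left]
      have hX : X (.inr j) ∈ J := Ideal.subset_span ⟨.inr j, ⟨j, hj, rfl⟩, rfl⟩
      exact Ideal.pow_mem_of_mem _ hX 2 two_pos
    · rw [act_eq_monomial, sub_self]
      exact J.zero_mem
  have hprod : (l.prod fun j e => planeInvariant κ R j ^ e)
      - monomial (Finsupp.linearCombination ℕ (leadExp κ) l) 1 ∈ J := by
    rw [← Ideal.Quotient.eq, Finsupp.prod, map_prod, Finsupp.linearCombination_apply, Finsupp.sum,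
      ← Finset.prod_const_one, ← prod_monomial, map_prod]
    refine Finset.prod_congr rfl fun j _ => ?_
    rw [map_pow, hJ, ← map_pow, monomial_pow, one_pow]
  have hcoeff := coeff_eq_zero_of_mem_span_X hprod
    (m := Finsupp.linearCombination ℕ (leadExp κ) k) (by
      rintro _ ⟨j, hj, rfl⟩
      exact linearCombination_leadExp_inr κ k hj)
  rw [map_sub, sub_eq_zero] at hcoeff
  rw [hcoeff, coeff_monomial]
  exact if_congr ((linearIndependent_leadExp κ).eq_iff.trans eq_comm) rfl rfl

theorem hasSubst_planeInvariant {R : Type*} [CommRing R] :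
    HasSubst (planeInvariant (n := n) κ R) :=
  hasSubst_of_constantCoeff_zero fun j =>
    mem_orderGE_one.mp (orderGE_anti one_le_two (planeInvariant_mem_orderGE κ j))

theorem coeff_subst_planeInvariant {R : Type*} [CommRing R] (g : MvPowerSeries (Fin n) R)
    (k : Fin n →₀ ℕ) :
    coeff (Finsupp.linearCombination ℕ (leadExp κ) k) (subst (planeInvariant κ R) g)
      = coeff k g := by
  rw [coeff_subst (hasSubst_planeInvariant κ), finsum_eq_single _ k fun l hl => ?_]
  · rw [coeff_prod_planeInvariant_pow, if_pos rfl, smul_eq_mul, mul_one]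
  · rw [coeff_prod_planeInvariant_pow, if_neg hl, smul_zero]

theorem norm_coeff_diagonalize_le {f : MvPowerSeries (Coord n) ℂ}
    (hf : Balanced (diagonalize n κ f)) (k : Fin n →₀ ℕ) :
    ‖coeff (actExp k) (diagonalize n κ f)‖
      ≤ 2 ^ k.degree * ‖coeff (Finsupp.linearCombination ℕ (leadExp κ) k) f‖ := by
  obtain ⟨g, hg⟩ := hf.exists_eq_subst (Equiv.refl (Fin n)) (posFactor_mul_momFactor_ne_zero κ)
  have hfg : f = subst (planeInvariant κ ℂ) g := (diagonalize n κ).injective (by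
    simp only [hg, diagonalize_subst κ (hasSubst_planeInvariant κ), diagonalize_planeInvariant,
      Equiv.refl_apply])
  have hk := coeff_subst_act (Equiv.refl (Fin n)) (fun j => posFactor κ j * momFactor κ j) g k
  rw [Equiv.coe_refl, Finsupp.mapDomain_id] at hk
  rw [hg, hfg, coeff_subst_planeInvariant]
  refine (congrArg norm hk).trans_le ?_
  rw [norm_mul, Finsupp.prod, norm_prod, Finsupp.degree_apply, ← Finset.prod_pow_eq_pow_sum]
  refine mul_le_mul_of_nonneg_right (Finset.prod_le_prod (fun j _ => norm_nonneg _) fun j _ => ?_)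
    (norm_nonneg _)
  rw [norm_pow, norm_mul, norm_posFactor, norm_momFactor, mul_one]
  exact pow_le_pow_left₀ (by split_ifs <;> norm_num) (by split_ifs <;> norm_num) _

theorem exists_algHom_of_normalForms {lam : Fin n → ℂ}
    {F H : MvPowerSeries (Coord n) ℝ} {F₁ : MvPowerSeries (Coord n) ℂ} {μ : Fin n → ℂ}
    (hF : IsBirkhoffNormalFormOf κ lam F H)
    (hF₁ : IsDiagNormalFormOf μ F₁ (diagonalize n κ (complexify H))) :
    ∃ Ψ : MvPowerSeries (Coord n) ℂ →ₐ[ℂ] MvPowerSeries (Coord n) ℂ,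
      (∀ f g, Ψ (poisson f g) = poisson (Ψ f) (Ψ g)) ∧
      (∀ N, ∀ f ∈ orderGE (Coord n) ℂ N, Ψ f ∈ orderGE (Coord n) ℂ N) ∧
      Ψ (diagonalize n κ (complexify F)) = F₁ := by
  obtain ⟨-, φ, hφ, hsub⟩ := hF
  obtain ⟨-, -, e, he, heF⟩ := hF₁
  have hcan := isFormalSymplectic_iff.mp hφ
  have hcanC := hcan.map Complex.ofRealHom
  have hT := isSymplecticAut_diagonalize (n := n) κ
  refine ⟨(e.toAlgHom.comp (diagonalize n κ).toAlgHom).comp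
    ((substAlgHom hcanC.hasSubst).comp (diagonalize n κ).symm.toAlgHom), fun f g => ?_,
    fun N f hf => ?_, ?_⟩
  · simp [hT.symm.map_poisson, hcanC.subst_poisson, hT.map_poisson, he.map_poisson]
  · simpa using he.map_mem _ _ (hT.map_mem _ _ (subst_mem_orderGE hcanC.1 (hT.symm_mem _ _ hf)))
  · simp [complexify, ← map_subst hcan.hasSubst, hsub, heF]

-- Normal forms are unique up to a permutation of the planes and signs of the action variables, so
-- one normal form with a large coefficient forces the same on every other.
theorem exists_coeff_ge {t : Fin n → ℝ} (ht : Function.Injective t)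
    (hμ : LinearIndependent ℤ (diagSpectrum κ t)) {F H : MvPowerSeries (Coord n) ℝ}
    (hF : IsBirkhoffNormalFormOf κ (spectrumOf κ t) F H) {F₁ : MvPowerSeries (Coord n) ℂ}
    (hF₁ : IsDiagNormalFormOf (diagSpectrum κ t) F₁ (diagonalize n κ (complexify H)))
    (k : Fin n →₀ ℕ) :
    ∃ m : Coord n →₀ ℕ, m.degree = 2 * k.degree ∧
      ‖coeff (actExp k) F₁‖ ≤ 2 ^ k.degree * |coeff m F| := by
  obtain ⟨Ψ, hΨ, hord, rfl⟩ := exists_algHom_of_normalForms κ hF hF₁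
  have hFb := (isNormalForm_iff ht).mp hF.1
  obtain ⟨π, hπ⟩ := exists_perm_coeff_eq hΨ hord hμ hFb
    (balanced_of_poisson_diagQuad hμ hF₁.1) hF₁.2.1
  obtain ⟨l, rfl⟩ := (Finsupp.domCongr π : (Fin n →₀ ℕ) ≃+ (Fin n →₀ ℕ)).surjective k
  rw [Finsupp.domCongr_apply, Finsupp.equivMapDomain_eq_mapDomain, Finsupp.degree_mapDomain]
  obtain ⟨s, hs⟩ := hπ l
  refine ⟨_, degree_linearCombination_leadExp κ l, ?_⟩
  have hs1 : ‖((s : ℤ) : ℂ)‖ = 1 := by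
    rcases Int.units_eq_one_or s with rfl | rfl <;> simp
  rw [hs, norm_mul, hs1, one_mul]
  simpa [complexify, coeff_map] using norm_coeff_diagonalize_le κ hFb l

end CoefficientComparison

section SpectrumChoice

theorem setOf_exists_approx_mem_residual (N : ℕ) :
    Set.Iio 0 ∪ {x : ℝ | ∃ p q : ℕ, N ≤ p ∧ 1 ≤ q ∧
      |(q : ℝ) * x - p| < 1 / ((p + q : ℕ) : ℝ) ^ (p + q)} ∈ residual ℝ := by
  refine residual_of_dense_open (isOpen_Iio.union ?_) (dense_of_exists_between fun a b hab => ?_)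
  · simp only [Set.ofPred_exists, Set.ofPred_and]
    exact isOpen_iUnion fun p => isOpen_iUnion fun q => isOpen_const.inter
      (isOpen_const.inter (isOpen_lt (by fun_prop) continuous_const))
  · rcases le_or_gt b 0 with hb | hb
    · obtain ⟨c, hac, hcb⟩ := exists_between hab
      exact ⟨c, Or.inl (hcb.trans_le hb), hac, hcb⟩
    · obtain ⟨r, hr, hrb⟩ := exists_rat_btwn (max_lt hab hb)
      have hr0 : 0 < r := by exact_mod_cast (le_max_right a 0).trans_lt hr
      refine ⟨r, Or.inr ?_, (le_max_left a 0).trans_lt hr, hrb⟩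
      obtain ⟨p, hp⟩ := Int.eq_ofNat_of_zero_le (Rat.num_pos.mpr hr0).le
      have hp0 : 0 < p := by
        have := Rat.num_pos.mpr hr0
        omega
      have hrp : (r.den : ℝ) * r = p := by
        have := Rat.den_mul_eq_num r
        rw [hp] at this
        exact_mod_cast this
      refine ⟨p * (N + 1), r.den * (N + 1), by nlinarith, Nat.mul_pos r.den_pos N.succ_pos, ?_⟩
      have hzero : ((r.den * (N + 1) : ℕ) : ℝ) * r - (p * (N + 1) : ℕ) = 0 := by
        push_cast
        rw [← hrp]
        ring
      rw [hzero, abs_zero]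
      positivity

theorem exists_transcendental_approximable :
    ∃ x : ℝ, 0 < x ∧ x < 1 ∧ Transcendental ℤ x ∧ ∀ N : ℕ, ∃ p q : ℕ, N ≤ p ∧ 1 ≤ q ∧
      |(q : ℝ) * x - p| < 1 / ((p + q : ℕ) : ℝ) ^ (p + q) := by
  have hres := Filter.inter_mem eventually_residual_liouville
    (countable_iInter_mem.mpr setOf_exists_approx_mem_residual)
  obtain ⟨x, ⟨hx0, hx1⟩, hxL, hxA⟩ := (dense_of_mem_residual hres).inter_open_nonempty
    (Set.Ioo (0 : ℝ) 1) isOpen_Ioo (Set.nonempty_Ioo.mpr one_pos)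
  exact ⟨x, hx0, hx1, Liouville.transcendental hxL, fun N =>
    (Set.mem_iInter.mp hxA N).resolve_left (not_lt.mpr hx0.le)⟩

theorem exists_sparse_exponents {x : ℝ} (hx : ∀ N : ℕ, ∃ p q : ℕ, N ≤ p ∧ 1 ≤ q ∧
      |(q : ℝ) * x - p| < 1 / ((p + q : ℕ) : ℝ) ^ (p + q)) :
    ∃ p q : ℕ → ℕ, (∀ k, 3 ≤ p k) ∧ (∀ k, 1 ≤ q k) ∧
      (∀ k, |(q k : ℝ) * x - p k| < 1 / ((p k + q k : ℕ) : ℝ) ^ (p k + q k)) ∧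
      ∀ k, 2 * (p k + q k) ≤ p (k + 1) + q (k + 1) := by
  choose P Q hP hQ hPQ using hx
  let N : ℕ → ℕ := fun k => Nat.rec 3 (fun _ N => 2 * (P N + Q N)) k
  have hN (k : ℕ) : N (k + 1) = 2 * (P (N k) + Q (N k)) := rfl
  have h3 (k : ℕ) : 3 ≤ N k := by
    induction k with
    | zero => exact le_rfl
    | succ k ih => linarith [hP (N k), hN k]
  refine ⟨fun k => P (N k), fun k => Q (N k), fun k => (h3 k).trans (hP _), fun k => hQ _,
    fun k => hPQ _, fun k => ?_⟩
  exact (hN k).ge.trans ((hP _).trans (Nat.le_add_right _ _))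

theorem linearIndependent_pow_of_transcendental {R A : Type*} [CommRing R] [CommRing A]
    [Algebra R A] {x : A} (hx : Transcendental R x) :
    LinearIndependent R fun k : ℕ => x ^ k := by
  have h := (Polynomial.basisMonomials R).linearIndependent.map'
    (Polynomial.aeval x).toLinearMap
    (LinearMap.ker_eq_bot.mpr (transcendental_iff_injective.mp hx))
  simpa [Function.comp_def, Polynomial.aeval_monomial] using h

theorem linearIndependent_ite_mul {ι : Type*} [Finite ι] (P : ι → Prop) [DecidablePred P]
    {t : ι → ℝ} (ht : LinearIndependent ℤ t) {c : ℂ} (hc : c.im ≠ 0) :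
    LinearIndependent ℤ fun j => if P j then c * t j else (t j : ℂ) := by
  have := Fintype.ofFinite ι
  rw [Fintype.linearIndependent_iff] at ht ⊢
  intro α hα
  have him : ∑ j, (if P j then α j else 0) • t j = 0 := by
    refine (mul_eq_zero.mp (?_ : c.im * _ = 0)).resolve_left hc
    rw [← Complex.zero_im, ← hα, Complex.im_sum, Finset.mul_sum]
    refine Finset.sum_congr rfl fun j _ => ?_
    split_ifs <;> simp [mul_left_comm]
  have hre : ∑ j, (if P j then 0 else α j) • t j = 0 := by
    have hsplit := congrArg Complex.re hα
    rw [Complex.re_sum, Complex.zero_re] at hsplit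
    rw [← hsplit, ← add_zero (∑ j, _), ← mul_zero c.re, ← him, Finset.mul_sum,
      ← Finset.sum_add_distrib]
    refine Finset.sum_congr rfl fun j _ => ?_
    split_ifs <;> simp [mul_left_comm]
  intro j
  have hj := ht _ him j
  have hj' := ht _ hre j
  by_cases h : P j
  · rwa [if_pos h] at hj
  · rwa [if_neg h] at hj'

variable {n : ℕ} (κ : ℕ) {t : Fin n → ℝ}

theorem nonResonant_iff_linearIndependent {lam : Fin n → ℂ} :
    NonResonant lam ↔ LinearIndependent ℤ lam := by
  rw [NonResonant, Fintype.linearIndependent_iff]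
  refine forall_congr' fun α => ?_
  simp only [zsmul_eq_mul, mul_comm (lam _), ne_eq, funext_iff (f := α)]
  exact not_imp_not

theorem nonResonant_spectrumOf (ht : LinearIndependent ℤ t) : NonResonant (spectrumOf κ t) :=
  nonResonant_iff_linearIndependent.mpr
    (linearIndependent_ite_mul _ ht (by simp : Complex.I.im ≠ 0))

theorem linearIndependent_diagSpectrum (ht : LinearIndependent ℤ t) :
    LinearIndependent ℤ (diagSpectrum κ t) := by
  convert linearIndependent_ite_mul (fun j : Fin n => (j : ℕ) < κ) ht
    (by simp : (-Complex.I).im ≠ 0) using 2 with j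
  rw [diagSpectrum, neg_mul]

theorem isSpectrum_spectrumOf (ht : ∀ j, t j ≠ 0) : IsSpectrum κ (spectrumOf κ t) := by
  refine ⟨fun j => ?_, fun k hk => ⟨k, hk, ?_⟩⟩
  · rw [spectrumOf]
    split_ifs with h
    · simp [h]
    · simp [h, ht j]
  · rw [spectrumOf, if_neg (not_lt.mpr hk), Complex.conj_ofReal]

theorem mul_natCast_sub_ne_zero_of_linearIndependent {ι K : Type*} [Ring K] {μ : ι → K}
    (hμ : LinearIndependent ℤ μ) {i j : ι} (hij : i ≠ j) (p : ℕ) {q : ℕ} (hq : q ≠ 0) :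
    μ j * q - μ i * p ≠ 0 := by
  intro h
  classical
  have hzero := linearIndependent_iff.mp hμ
    (Finsupp.single j (q : ℤ) - Finsupp.single i (p : ℤ))
    (by simpa [mul_comm, ← Nat.cast_comm] using h)
  have hj := DFunLike.congr_fun hzero j
  simp [hij, hq] at hj

theorem norm_diagSpectrum_sub_le {x : ℝ} {i j : Fin n} (hij : (j : ℕ) = i + 1)
    (hκ : (i : ℕ) < κ ↔ (j : ℕ) < κ) (hx : |x| ≤ 1) (p q : ℕ) :
    ‖diagSpectrum κ (fun l : Fin n => x ^ (l : ℕ)) j * q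
      - diagSpectrum κ (fun l : Fin n => x ^ (l : ℕ)) i * p‖ ≤ |(q : ℝ) * x - p| := by
  have hnorm (u : ℂ) (hu : ‖u‖ = 1) : ‖u * ((x ^ (i : ℕ) * ((q : ℝ) * x - p) : ℝ) : ℂ)‖
      ≤ |(q : ℝ) * x - p| := by
    rw [norm_mul, hu, one_mul, Complex.norm_real, Real.norm_eq_abs, abs_mul, abs_pow]
    exact mul_le_of_le_one_left (abs_nonneg _) (pow_le_one₀ (abs_nonneg x) hx)
  rw [diagSpectrum, diagSpectrum, ← if_congr hκ rfl rfl, hij]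
  split_ifs
  · refine le_of_eq_of_le (congrArg norm ?_) (hnorm (-Complex.I) (by simp))
    push_cast
    ring
  · refine le_of_eq_of_le (congrArg norm ?_) (hnorm 1 (by simp))
    push_cast
    ring

end SpectrumChoice

section Convergence

variable {σ : Type*}

theorem summable_pow_degree [Finite σ] {ρ : ℝ} (h0 : 0 ≤ ρ) (h1 : ρ < 1) :
    Summable fun m : σ →₀ ℕ => ρ ^ m.degree := by
  classical
  have := Fintype.ofFinite σ
  refine summable_of_sum_le (c := ∏ _i : σ, (1 - ρ)⁻¹) (fun m => by positivity) fun u => ?_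
  obtain ⟨N, hN⟩ : ∃ N, ∀ m ∈ u, m.degree < N := ⟨u.sup Finsupp.degree + 1, fun m hm =>
    Nat.lt_succ_of_le (Finset.le_sup (f := Finsupp.degree) hm)⟩
  calc ∑ m ∈ u, ρ ^ m.degree
      = ∑ x ∈ u.map ⟨fun m : σ →₀ ℕ => (m : σ → ℕ), DFunLike.coe_injective⟩, ∏ i, ρ ^ x i := by
        rw [Finset.sum_map]
        refine Finset.sum_congr rfl fun m _ => ?_
        rw [Finset.prod_pow_eq_pow_sum, Finsupp.degree_eq_sum]
        rfl
    _ ≤ ∑ x ∈ Fintype.piFinset fun _ : σ => Finset.range N, ∏ i, ρ ^ x i := by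
        refine Finset.sum_le_sum_of_subset_of_nonneg (fun x hx => ?_)
          fun x _ _ => Finset.prod_nonneg fun i _ => by positivity
        obtain ⟨m, hm, rfl⟩ := Finset.mem_map.mp hx
        exact Fintype.mem_piFinset.mpr fun i =>
          Finset.mem_range.mpr ((Finsupp.le_degree i m).trans_lt (hN m hm))
    _ = ∏ _i : σ, ∑ k ∈ Finset.range N, ρ ^ k := by
        rw [Finset.prod_univ_sum]
    _ ≤ _ := by
        refine Finset.prod_le_prod (fun _ _ => Finset.sum_nonneg fun _ _ => by positivity)
          fun _ _ => ?_
        rw [← tsum_geometric_of_lt_one h0 h1]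
        exact (summable_geometric_of_lt_one h0 h1).sum_le_tsum _ fun _ _ => by positivity

theorem summable_abs_coeff_mul_pow [Finite σ] {H : MvPowerSeries σ ℝ} {C M r : ℝ}
    (hH : ∀ m, |coeff m H| ≤ C * M ^ m.degree) (hr : 0 ≤ r) (hM : 0 ≤ M) (hMr : M * r < 1) :
    Summable fun m => |coeff m H| * r ^ m.degree := by
  refine .of_nonneg_of_le (fun m => by positivity) (fun m => ?_)
    ((summable_pow_degree (mul_nonneg hM hr) hMr).mul_left C)
  rw [mul_pow, ← mul_assoc]
  exact mul_le_mul_of_nonneg_right (hH m) (by positivity)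

theorem abs_monomial_le [Fintype σ] {r : ℝ} {z : σ → ℝ} (hz : ‖z‖ ≤ r) (m : σ →₀ ℕ) :
    |m.prod fun i k => z i ^ k| ≤ r ^ m.degree := by
  rw [Finsupp.prod, Finset.abs_prod, Finsupp.degree_apply, ← Finset.prod_pow_eq_pow_sum]
  refine Finset.prod_le_prod (fun _ _ => abs_nonneg _) fun i _ => ?_
  rw [abs_pow]
  exact pow_le_pow_left₀ (abs_nonneg _) ((norm_le_pi_norm z i).trans hz) _

theorem summable_term [Fintype σ] {H : MvPowerSeries σ ℝ} {r : ℝ}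
    (hH : Summable fun m => |coeff m H| * r ^ m.degree) {z : σ → ℝ} (hz : ‖z‖ ≤ r) :
    Summable (term H z) := by
  refine Summable.of_norm_bounded hH fun m => ?_
  rw [term, norm_mul, Real.norm_eq_abs, Real.norm_eq_abs]
  exact mul_le_mul_of_nonneg_left (abs_monomial_le hz m) (abs_nonneg _)

/-- The multidegrees of total degree `d` in finitely many variables, over which the homogeneous
part of degree `d` of a power series is a sum. -/
noncomputable def multidegrees (σ : Type*) [Finite σ] (d : ℕ) : Finset (σ →₀ ℕ) :=
  (Finsupp.finite_of_degree_eq d).toFinset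

theorem mem_multidegrees [Finite σ] {d : ℕ} {m : σ →₀ ℕ} :
    m ∈ multidegrees σ d ↔ m.degree = d := by
  simp [multidegrees]

theorem hasSum_sum_multidegrees [Finite σ] {f : (σ →₀ ℕ) → ℝ} (hf : Summable f) :
    HasSum (fun d => ∑ m ∈ multidegrees σ d, f m) (∑' m, f m) := by
  refine ((Equiv.sigmaFiberEquiv Finsupp.degree).hasSum_iff.mpr hf.hasSum).sigma fun d => ?_
  rw [← Finset.sum_subtype_of_mem (p := fun m : σ →₀ ℕ => m.degree = d) f
    fun m hm => mem_multidegrees.mp hm]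
  exact hasSum_sum_of_ne_finset_zero fun m hm =>
    absurd (Finset.mem_subtype.mpr (mem_multidegrees.mpr m.2)) hm

theorem exists_multilinear_monomial [Fintype σ] (m : σ →₀ ℕ) :
    ∃ M : ContinuousMultilinearMap ℝ (fun _ : Fin m.degree => σ → ℝ) ℝ, ‖M‖ ≤ 1 ∧
      ∀ z : σ → ℝ, M (fun _ => z) = m.prod fun i k => z i ^ k := by
  obtain ⟨l, hl⟩ : ∃ l : List σ, (l : Multiset σ) = Finsupp.toMultiset m :=
    ⟨_, Multiset.coe_toList _⟩
  have hlen : l.length = m.degree := by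
    rw [← Multiset.coe_card, hl, Finsupp.card_toMultiset, Finsupp.degree_apply, Finsupp.sum]
    rfl
  rw [← hlen]
  refine ⟨(ContinuousMultilinearMap.mkPiAlgebraFin ℝ l.length ℝ).compContinuousLinearMap
    fun i => ContinuousLinearMap.proj (l.get i), ?_, fun z => ?_⟩
  · refine (ContinuousMultilinearMap.norm_compContinuousLinearMap_le _ _).trans ?_
    rw [ContinuousMultilinearMap.norm_mkPiAlgebraFin, one_mul]
    refine Finset.prod_le_one (fun _ _ => norm_nonneg _) fun i _ => ?_
    refine ContinuousLinearMap.opNorm_le_bound _ zero_le_one fun z => ?_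
    rw [one_mul]
    exact norm_le_pi_norm z _
  · calc _ = (List.ofFn fun i => z (l.get i)).prod := by
          rw [ContinuousMultilinearMap.compContinuousLinearMap_apply,
            ContinuousMultilinearMap.mkPiAlgebraFin_apply]
          rfl
      _ = ((Finsupp.toMultiset m).map z).prod := by
          rw [← hl, Multiset.map_coe, Multiset.prod_coe, ← Function.comp_def, ← List.map_ofFn,
            List.ofFn_get]
      _ = _ := by
          rw [Finsupp.toMultiset_map, Finsupp.prod_toMultiset,
            Finsupp.prod_mapDomain_index (fun _ => pow_zero _) fun _ _ _ => pow_add _ _ _]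

theorem exists_formalMultilinearSeries [Fintype σ] (H : MvPowerSeries σ ℝ) :
    ∃ p : FormalMultilinearSeries ℝ (σ → ℝ) ℝ, ∀ d,
      ‖p d‖ ≤ ∑ m ∈ multidegrees σ d, |coeff m H| ∧
        ∀ z, p d (fun _ => z) = ∑ m ∈ multidegrees σ d, term H z m := by
  suffices h : ∀ d, ∃ P : ContinuousMultilinearMap ℝ (fun _ : Fin d => σ → ℝ) ℝ,
      ‖P‖ ≤ ∑ m ∈ multidegrees σ d, |coeff m H| ∧
        ∀ z, P (fun _ => z) = ∑ m ∈ multidegrees σ d, term H z m by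
    choose p hp using h
    exact ⟨p, hp⟩
  intro d
  have hmonomial (m : multidegrees σ d) :
      ∃ M : ContinuousMultilinearMap ℝ (fun _ : Fin d => σ → ℝ) ℝ, ‖M‖ ≤ 1 ∧
        ∀ z : σ → ℝ, M (fun _ => z) = m.1.prod fun i k => z i ^ k := by
    obtain ⟨m, hm⟩ := m
    obtain rfl := mem_multidegrees.mp hm
    exact exists_multilinear_monomial m
  choose E hE hEz using hmonomial
  refine ⟨∑ m, coeff m.1 H • E m, ?_, fun z => ?_⟩
  · refine (norm_sum_le_of_le _ fun m _ => ?_).trans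
      (Finset.sum_coe_sort _ fun m => |coeff m H|).le
    rw [norm_smul, Real.norm_eq_abs]
    exact mul_le_of_le_one_right (abs_nonneg _) (hE m)
  · rw [sum_apply, ← Finset.sum_coe_sort _ (term H z)]
    refine Finset.sum_congr rfl fun m _ => ?_
    rw [smul_apply, hEz, smul_eq_mul, term]

theorem ofReal_le_radius [Fintype σ] {H : MvPowerSeries σ ℝ} {r : ℝ} (hr : 0 ≤ r)
    (hH : Summable fun m => |coeff m H| * r ^ m.degree) {p : FormalMultilinearSeries ℝ (σ → ℝ) ℝ}
    (hp : ∀ d, ‖p d‖ ≤ ∑ m ∈ multidegrees σ d, |coeff m H|) : ENNReal.ofReal r ≤ p.radius := by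
  refine p.le_radius_of_bound (∑' m, |coeff m H| * r ^ m.degree) fun d => ?_
  rw [Real.coe_toNNReal _ hr]
  calc ‖p d‖ * r ^ d ≤ (∑ m ∈ multidegrees σ d, |coeff m H|) * r ^ d :=
        mul_le_mul_of_nonneg_right (hp d) (by positivity)
    _ = ∑ m ∈ multidegrees σ d, |coeff m H| * r ^ m.degree := by
        rw [Finset.sum_mul]
        exact Finset.sum_congr rfl fun m hm => by rw [mem_multidegrees.mp hm]
    _ ≤ _ := hH.sum_le_tsum _ fun m _ => by positivity

theorem exists_analyticAt_hasExpansion [Fintype σ] {H : MvPowerSeries σ ℝ} {r : ℝ} (hr : 0 < r)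
    (hH : Summable fun m => |coeff m H| * r ^ m.degree) {N : ℕ} (hN : H ∈ orderGE σ ℝ N) :
    ∃ h : (σ → ℝ) → ℝ, AnalyticAt ℝ h 0 ∧ (h =O[𝓝 0] fun z => ‖z‖ ^ N) ∧ HasExpansion h H := by
  obtain ⟨p, hp⟩ := exists_formalMultilinearSeries H
  have hrad := ofReal_le_radius hr.le hH fun d => (hp d).1
  have hball := p.hasFPowerSeriesOnBall ((ENNReal.ofReal_pos.mpr hr).trans_le hrad)
  refine ⟨p.sum, hball.analyticAt, ?_, ?_⟩
  · refine (hball.hasFPowerSeriesAt.isBigO_sub_partialSum_pow N).congr_left fun z => ?_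
    rw [zero_add, sub_eq_self, FormalMultilinearSeries.partialSum]
    refine Finset.sum_eq_zero fun d hd => ?_
    rw [(hp d).2]
    refine Finset.sum_eq_zero fun m hm => ?_
    rw [term, coeff_eq_zero_of_mem_orderGE hN, zero_mul]
    exact mem_multidegrees.mp hm ▸ Finset.mem_range.mp hd
  · filter_upwards [Metric.ball_mem_nhds (0 : σ → ℝ) hr] with z hz
    have hzr : ‖z‖ < r := mem_ball_zero_iff.mp hz
    have hsum := summable_term hH hzr.le
    have hzrad : z ∈ Metric.eball 0 p.radius := by
      rw [Metric.mem_eball, edist_zero_right, ← ofReal_norm]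
      exact ((ENNReal.ofReal_lt_ofReal_iff hr).mpr hzr).trans_le hrad
    have hp_sum := hball.hasSum hzrad
    simp only [zero_add, (hp _).2] at hp_sum
    rw [hp_sum.unique (hasSum_sum_multidegrees hsum)]
    exact hsum.hasSum

theorem IsConvergent.exists_bound [Finite σ] {H : MvPowerSeries σ ℝ} (h : IsConvergent H) :
    ∃ C r : ℝ, 0 < r ∧ ∀ m, |coeff m H| * r ^ m.degree ≤ C := by
  have := Fintype.ofFinite σ
  obtain ⟨ε, hε, hball⟩ := Metric.eventually_nhds_iff.mp h
  have hs : Summable (term H fun _ => ε / 2) := by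
    refine hball ?_
    rw [dist_zero_right]
    refine (pi_norm_const_le _).trans_lt ?_
    rw [Real.norm_of_nonneg (by positivity)]
    linarith
  refine ⟨∑' m, |term H (fun _ => ε / 2) m|, ε / 2, by positivity, fun m => ?_⟩
  refine le_trans (le_of_eq ?_) (hs.abs.le_tsum m fun _ _ => abs_nonneg _)
  rw [term, abs_mul, Finsupp.prod, Finset.prod_pow_eq_pow_sum, Finsupp.degree_apply]
  congr 1
  rw [abs_of_nonneg (by positivity)]

theorem hasSum_term_add {H₁ H₂ : MvPowerSeries σ ℝ} {z : σ → ℝ} {a b : ℝ}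
    (h₁ : HasSum (term H₁ z) a) (h₂ : HasSum (term H₂ z) b) :
    HasSum (term (H₁ + H₂) z) (a + b) := by
  convert h₁.add h₂ using 2 with m
  rw [term, term, term, map_add, add_mul]

theorem hasSum_term_coe (P : MvPolynomial σ ℝ) (z : σ → ℝ) :
    HasSum (term (P : MvPowerSeries σ ℝ) z) (MvPolynomial.eval z P) := by
  rw [MvPolynomial.eval_eq]
  refine hasSum_sum_of_ne_finset_zero fun m hm => ?_
  rw [term, MvPolynomial.coeff_coe, MvPolynomial.notMem_support_iff.mp hm, zero_mul]

theorem not_isConvergent_of_pow_self_le [Finite σ] {F : MvPowerSeries σ ℝ} {d : ℕ → ℕ}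
    (hd : StrictMono d) (hF : ∀ k, ∃ m : σ →₀ ℕ, m.degree = 2 * (d k - 1) ∧
      (d k : ℝ) ^ d k / 2 ≤ 2 ^ (d k - 1) * |coeff m F|) : ¬ IsConvergent F := by
  intro hconv
  obtain ⟨C, r, hr, hC⟩ := hconv.exists_bound
  obtain ⟨k, hk⟩ := exists_nat_gt (max (2 / r ^ 2) (2 * C))
  obtain ⟨m, hm, hmF⟩ := hF k
  have hkd : (k : ℝ) ≤ d k := by exact_mod_cast hd.le_apply
  have hdr : 2 / r ^ 2 < d k := ((le_max_left _ _).trans_lt hk).trans_le hkd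
  have hdC : 2 * C < d k := ((le_max_right _ _).trans_lt hk).trans_le hkd
  have hd0 : d k ≠ 0 := by
    rintro h
    rw [h, Nat.cast_zero] at hdr
    exact hdr.not_ge (by positivity)
  have hone : 1 ≤ (d k : ℝ) * (r ^ 2 / 2) := by
    rw [div_lt_iff₀ (by positivity)] at hdr
    linarith
  refine hdC.not_ge ?_
  calc (d k : ℝ) ≤ d k * (d k * (r ^ 2 / 2)) ^ (d k - 1) :=
        le_mul_of_one_le_right (Nat.cast_nonneg _) (one_le_pow₀ hone)
    _ = 2 * ((d k : ℝ) ^ d k / 2 / 2 ^ (d k - 1) * r ^ (2 * (d k - 1))) := by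
        rw [mul_pow, div_pow, ← pow_mul, ← mul_assoc, mul_pow_sub_one hd0]
        ring
    _ ≤ 2 * (|coeff m F| * r ^ m.degree) := by
        rw [hm]
        gcongr
        rwa [div_le_iff₀' (by positivity)]
    _ ≤ 2 * C := by linarith [hC m]

end Convergence

section QuadraticPart

variable {n : ℕ} (κ : ℕ) (t : Fin n → ℝ)

/-- The polynomial underlying `quadSeries`. -/
noncomputable def quadPolynomial : MvPolynomial (Coord n) ℝ :=
  ∑ j, MvPolynomial.C (quadCoeff κ t j) *
    if (j : ℕ) < κ then MvPolynomial.X (.inl j) ^ 2 + MvPolynomial.X (.inr j) ^ 2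
    else MvPolynomial.X (.inl j) * MvPolynomial.X (.inr j)

theorem coe_quadPolynomial : (quadPolynomial κ t : MvPowerSeries (Coord n) ℝ) = quadSeries κ t := by
  rw [quadPolynomial, quadSeries, ← MvPolynomial.coeToMvPowerSeries.ringHom_apply, map_sum]
  refine Finset.sum_congr rfl fun j _ => ?_
  rw [planeInvariant, smul_eq_C_mul]
  split_ifs <;> simp [act]

theorem quadraticPart_spectrumOf {t : Fin n → ℝ} (ht : Function.Injective t) (z : Coord n → ℝ) :
    quadraticPart κ (spectrumOf κ t) z = ∑ j : Fin n, quadCoeff κ t j *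
      if (j : ℕ) < κ then z (.inl j) ^ 2 + z (.inr j) ^ 2 else z (.inl j) * z (.inr j) := by
  classical
  have hpairs : ∑ p with IsConjPair κ (spectrumOf κ t) p,
      spectrumOf κ t p.1 * ((z (.inl p.1) : ℂ) + Complex.I * (z (.inl p.2) : ℂ)) *
        ((z (.inr p.1) : ℂ) - Complex.I * (z (.inr p.2) : ℂ))
      = ∑ j ∈ Finset.univ.filter (fun j : Fin n => ¬ (j : ℕ) < κ),
          ((2 * (t j * (z (.inl j) * z (.inr j))) : ℝ) : ℂ) := by
    simp only [isConjPair_spectrumOf ht]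
    refine Finset.sum_bij' (fun p _ => p.1) (fun j _ => (j, j)) (fun p hp => ?_) (fun j hj => ?_)
      (fun p hp => Prod.ext rfl (Finset.mem_filter.mp hp).2.2) (fun j _ => rfl) fun p hp => ?_
    · simpa using (Finset.mem_filter.mp hp).2.1
    · simpa using hj
    · obtain ⟨hκ, hp⟩ := (Finset.mem_filter.mp hp).2
      rw [← hp, spectrumOf, if_neg (not_lt.mpr hκ)]
      push_cast
      linear_combination (-(t p.1 * z (.inl p.1) * z (.inr p.1)) : ℂ) * Complex.I_mul_I
  rw [quadraticPart, ← Finset.sum_filter_add_sum_filter_not Finset.univ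
    (fun j : Fin n => (j : ℕ) < κ) (fun j => quadCoeff κ t j * _)]
  congr 1
  · rw [Finset.mul_sum]
    refine Finset.sum_congr rfl fun j hj => ?_
    have hjκ := (Finset.mem_filter.mp hj).2
    rw [if_pos hjκ, spectrumOf, if_pos hjκ, quadCoeff, if_pos hjκ, ← mul_assoc Complex.I,
      Complex.I_mul_I]
    simp only [neg_mul, one_mul, Complex.neg_re, Complex.ofReal_re]
    ring
  · rw [hpairs, ← Complex.ofReal_sum, Complex.ofReal_re, Finset.mul_sum]
    refine Finset.sum_congr rfl fun j hj => ?_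
    rw [if_neg (Finset.mem_filter.mp hj).2, quadCoeff, if_neg (Finset.mem_filter.mp hj).2]
    ring

theorem eval_quadPolynomial {t : Fin n → ℝ} (ht : Function.Injective t) (z : Coord n → ℝ) :
    MvPolynomial.eval z (quadPolynomial κ t) = quadraticPart κ (spectrumOf κ t) z := by
  rw [quadraticPart_spectrumOf κ ht, quadPolynomial, map_sum]
  refine Finset.sum_congr rfl fun j _ => ?_
  split_ifs <;> simp

theorem analyticAt_quadraticPart {t : Fin n → ℝ} (ht : Function.Injective t) :
    AnalyticAt ℝ (quadraticPart κ (spectrumOf κ t)) 0 := by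
  rw [← funext (eval_quadPolynomial κ ht)]
  exact AnalyticOnNhd.eval_mvPolynomial _ 0 (Set.mem_univ _)

theorem hasSum_term_quadSeries {t : Fin n → ℝ} (ht : Function.Injective t) (z : Coord n → ℝ) :
    HasSum (term (quadSeries κ t) z) (quadraticPart κ (spectrumOf κ t) z) := by
  rw [← eval_quadPolynomial κ ht, ← coe_quadPolynomial]
  exact hasSum_term_coe _ z

end QuadraticPart

section PairSeries

section CoefficientBounds

variable {σ 𝕜 : Type*} [NormedCommRing 𝕜] {f g : MvPowerSeries σ 𝕜} {M : ℝ}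

theorem norm_coeff_mul_X_le (hf : ∀ m, ‖coeff m f‖ ≤ M) (i : σ) (m : σ →₀ ℕ) :
    ‖coeff m (f * X i)‖ ≤ M := by
  classical
  rw [X, coeff_mul_monomial]
  split_ifs
  · rw [mul_one]
    exact hf _
  · rw [norm_zero]
    exact (norm_nonneg _).trans (hf 0)

theorem norm_coeff_mul_X_add_C_mul_X_le (hf : ∀ m, ‖coeff m f‖ ≤ M) {c : 𝕜} (hc : ‖c‖ ≤ 1)
    (i k : σ) (m : σ →₀ ℕ) : ‖coeff m (f * (X i + C c * X k))‖ ≤ M * 2 := by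
  rw [mul_add, mul_left_comm, map_add, coeff_C_mul, mul_two]
  calc ‖coeff m (f * X i) + c * coeff m (f * X k)‖
      ≤ ‖coeff m (f * X i)‖ + ‖c‖ * ‖coeff m (f * X k)‖ :=
        (norm_add_le _ _).trans (add_le_add_right (norm_mul_le _ _) _)
    _ ≤ M + M := add_le_add (norm_coeff_mul_X_le hf i m)
        ((mul_le_of_le_one_left (norm_nonneg _) hc).trans (norm_coeff_mul_X_le hf k m))

theorem norm_coeff_mul_pow_le
    (hg : ∀ (f : MvPowerSeries σ 𝕜) (M : ℝ), (∀ m, ‖coeff m f‖ ≤ M) →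
      ∀ m, ‖coeff m (f * g)‖ ≤ M * 2)
    (hf : ∀ m, ‖coeff m f‖ ≤ M) (k : ℕ) : ∀ m, ‖coeff m (f * g ^ k)‖ ≤ M * 2 ^ k := by
  induction k with
  | zero => simpa using hf
  | succ k ih =>
    rw [pow_succ, pow_succ, ← mul_assoc, ← mul_assoc]
    exact hg _ _ ih

end CoefficientBounds

variable {n : ℕ} (κ : ℕ) (s t : Fin n) (p q : ℕ)

theorem exists_posForm_eq (j : Fin n) :
    ∃ (c : ℂ) (i k : Coord n), ‖c‖ ≤ 1 ∧ posForm κ j = X i + C c * X k := by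
  rw [posForm]
  split_ifs
  · exact ⟨-Complex.I, .inl j, .inr j, by simp, by rw [map_neg, neg_mul, sub_eq_add_neg]⟩
  · exact ⟨0, .inl j, .inl j, by simp, by simp⟩

theorem exists_momForm_eq (j : Fin n) :
    ∃ (c : ℂ) (i k : Coord n), ‖c‖ ≤ 1 ∧ momForm κ j = X i + C c * X k := by
  rw [momForm]
  split_ifs
  · exact ⟨Complex.I, .inl j, .inr j, by simp, rfl⟩
  · exact ⟨0, .inr j, .inr j, by simp, by simp⟩

theorem posForm_mem_orderGE (j : Fin n) : posForm κ j ∈ orderGE (Coord n) ℂ 1 := by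
  obtain ⟨c, i, k, -, h⟩ := exists_posForm_eq κ j
  exact h ▸ Ideal.add_mem _ (X_mem_orderGE i) (Ideal.mul_mem_left _ _ (X_mem_orderGE k))

theorem momForm_mem_orderGE (j : Fin n) : momForm κ j ∈ orderGE (Coord n) ℂ 1 := by
  obtain ⟨c, i, k, -, h⟩ := exists_momForm_eq κ j
  exact h ▸ Ideal.add_mem _ (X_mem_orderGE i) (Ideal.mul_mem_left _ _ (X_mem_orderGE k))

theorem norm_coeff_mul_posForm_le (j : Fin n) {f : MvPowerSeries (Coord n) ℂ} {M : ℝ}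
    (hf : ∀ m, ‖coeff m f‖ ≤ M) (m : Coord n →₀ ℕ) : ‖coeff m (f * posForm κ j)‖ ≤ M * 2 := by
  obtain ⟨c, i, k, hc, h⟩ := exists_posForm_eq κ j
  exact h ▸ norm_coeff_mul_X_add_C_mul_X_le hf hc i k m

theorem norm_coeff_mul_momForm_le (j : Fin n) {f : MvPowerSeries (Coord n) ℂ} {M : ℝ}
    (hf : ∀ m, ‖coeff m f‖ ≤ M) (m : Coord n →₀ ℕ) : ‖coeff m (f * momForm κ j)‖ ≤ M * 2 := by
  obtain ⟨c, i, k, hc, h⟩ := exists_momForm_eq κ j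
  exact h ▸ norm_coeff_mul_X_add_C_mul_X_le hf hc i k m

/-- The sum of the monomials `ξ_s^p η_t^q` and `η_s^p ξ_t^q` in the diagonalizing coordinates, up to
factors. If the planes `s` and `t` are of the same type, it has real coefficients. -/
noncomputable def pairSeries : MvPowerSeries (Coord n) ℂ :=
  posForm κ s ^ p * momForm κ t ^ q + momForm κ s ^ p * posForm κ t ^ q

theorem pairSeries_mem_orderGE : pairSeries κ s t p q ∈ orderGE (Coord n) ℂ (p + q) := by
  have hpow {f : MvPowerSeries (Coord n) ℂ} (hf : f ∈ orderGE (Coord n) ℂ 1) (k : ℕ) :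
      f ^ k ∈ orderGE (Coord n) ℂ k := by
    simpa using pow_mem_orderGE hf k
  exact Ideal.add_mem _
    (mul_mem_orderGE (hpow (posForm_mem_orderGE κ s) p) (hpow (momForm_mem_orderGE κ t) q))
    (mul_mem_orderGE (hpow (momForm_mem_orderGE κ s) p) (hpow (posForm_mem_orderGE κ t) q))

theorem norm_coeff_pairSeries_le (m : Coord n →₀ ℕ) :
    ‖coeff m (pairSeries κ s t p q)‖ ≤ 2 * 2 ^ (p + q) := by
  classical
  have hone (m : Coord n →₀ ℕ) : ‖coeff m (1 : MvPowerSeries (Coord n) ℂ)‖ ≤ 1 := by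
    rw [coeff_one]
    split_ifs <;> simp
  have hpos (j : Fin n) : ∀ (f : MvPowerSeries (Coord n) ℂ) (M : ℝ), (∀ m, ‖coeff m f‖ ≤ M) →
      ∀ m, ‖coeff m (f * posForm κ j)‖ ≤ M * 2 := fun _ _ hf => norm_coeff_mul_posForm_le κ j hf
  have hmom (j : Fin n) : ∀ (f : MvPowerSeries (Coord n) ℂ) (M : ℝ), (∀ m, ‖coeff m f‖ ≤ M) →
      ∀ m, ‖coeff m (f * momForm κ j)‖ ≤ M * 2 := fun _ _ hf => norm_coeff_mul_momForm_le κ j hf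
  have hfst := norm_coeff_mul_pow_le (hmom t) (norm_coeff_mul_pow_le (hpos s) hone p) q m
  have hsnd := norm_coeff_mul_pow_le (hpos t) (norm_coeff_mul_pow_le (hmom s) hone p) q m
  rw [one_mul, one_mul, ← pow_add] at hfst hsnd
  rw [pairSeries, map_add, two_mul]
  exact (norm_add_le _ _).trans (add_le_add hfst hsnd)

variable {κ s t} in
theorem map_conj_pairSeries (hst : (s : ℕ) < κ ↔ (t : ℕ) < κ) :
    MvPowerSeries.map (starRingEnd ℂ) (pairSeries κ s t p q) = pairSeries κ s t p q := by
  by_cases hs : (s : ℕ) < κ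
  · have hI : MvPowerSeries.map (starRingEnd ℂ) (C Complex.I : MvPowerSeries (Coord n) ℂ)
        = -C Complex.I := by
      rw [map_C, Complex.conj_I, map_neg]
    have hpos (j : Fin n) (hj : (j : ℕ) < κ) :
        MvPowerSeries.map (starRingEnd ℂ) (posForm κ j) = momForm κ j := by
      rw [posForm, momForm, if_pos hj, if_pos hj, map_sub, map_mul, hI, map_X, map_X]
      ring
    have hmom (j : Fin n) (hj : (j : ℕ) < κ) :
        MvPowerSeries.map (starRingEnd ℂ) (momForm κ j) = posForm κ j := by
      rw [posForm, momForm, if_pos hj, if_pos hj, map_add, map_mul, hI, map_X, map_X]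
      ring
    simp only [pairSeries, map_add, map_mul, map_pow, hpos _ hs, hmom _ hs, hpos _ (hst.mp hs),
      hmom _ (hst.mp hs)]
    exact add_comm _ _
  · simp only [pairSeries, posForm, momForm, if_neg hs, if_neg (hst.not.mp hs), map_add, map_mul,
      map_pow, map_X]

/-- The real part of `pairSeries`, the perturbation term used in the construction. -/
noncomputable def realPair : MvPowerSeries (Coord n) ℝ :=
  fun m => (coeff m (pairSeries κ s t p q)).re

theorem coeff_realPair (m : Coord n →₀ ℕ) :
    coeff m (realPair κ s t p q) = (coeff m (pairSeries κ s t p q)).re := rfl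

theorem realPair_mem_orderGE : realPair κ s t p q ∈ orderGE (Coord n) ℝ (p + q) := by
  refine mem_orderGE_iff_coeff.mpr fun m hm => ?_
  rw [coeff_realPair, coeff_eq_zero_of_mem_orderGE (pairSeries_mem_orderGE κ s t p q) hm,
    Complex.zero_re]

variable {κ s t} in
theorem complexify_realPair (hst : (s : ℕ) < κ ↔ (t : ℕ) < κ) :
    complexify (realPair κ s t p q) = pairSeries κ s t p q := by
  ext m
  rw [complexify, coeff_map, coeff_realPair]
  refine Complex.conj_eq_iff_re.mp ?_
  rw [← coeff_map, map_conj_pairSeries p q hst]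

theorem abs_coeff_realPair_le (m : Coord n →₀ ℕ) :
    |coeff m (realPair κ s t p q)| ≤ 2 * 2 ^ m.degree := by
  rcases lt_or_ge m.degree (p + q) with h | h
  · rw [coeff_eq_zero_of_mem_orderGE (realPair_mem_orderGE κ s t p q) h, abs_zero]
    positivity
  · calc |coeff m (realPair κ s t p q)| ≤ ‖coeff m (pairSeries κ s t p q)‖ :=
          Complex.abs_re_le_norm _
      _ ≤ 2 * 2 ^ (p + q) := norm_coeff_pairSeries_le κ s t p q m
      _ ≤ 2 * 2 ^ m.degree := by gcongr; exact one_le_two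

theorem exists_diagonalize_pairSeries :
    ∃ a b : ℂ, 1 ≤ ‖a * b‖ ∧ diagonalize n κ (pairSeries κ s t p q)
      = a • crossMonomial ℂ s t p q + b • crossMonomial ℂ t s q p := by
  have hpos (j : Fin n) : 1 ≤ ‖posFactor κ j‖ := by
    rw [norm_posFactor]
    split_ifs <;> norm_num
  refine ⟨posFactor κ s ^ p * momFactor κ t ^ q, posFactor κ t ^ q * momFactor κ s ^ p, ?_, ?_⟩
  · simp only [norm_mul, norm_pow, norm_momFactor, one_pow, mul_one]
    exact one_le_mul_of_one_le_of_one_le (one_le_pow₀ (hpos s)) (one_le_pow₀ (hpos t))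
  · simp only [pairSeries, crossMonomial, map_add, map_mul, map_pow, diagonalize_posForm,
      diagonalize_momForm, smul_pow, smul_mul_smul_comm]
    rw [mul_comm (posFactor κ t ^ q), mul_comm (X (Sum.inr s) ^ p)]

end PairSeries

section InductiveSums

variable {σ R : Type*}

theorem exists_sum_of_orderGE [CommRing R] {G : ℕ → MvPowerSeries σ R} {d : ℕ → ℕ}
    (hd : StrictMono d) (hG : ∀ i, G i ∈ orderGE σ R (d i)) :
    ∃ H : MvPowerSeries σ R, (∀ k, H - ∑ i ∈ Finset.range k, G i ∈ orderGE σ R (d k)) ∧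
      ∀ m, coeff m H = ∑ i ∈ Finset.range (m.degree + 1), coeff m (G i) := by
  let H : MvPowerSeries σ R := fun m => ∑ i ∈ Finset.range (m.degree + 1), coeff m (G i)
  have hH (m : σ →₀ ℕ) : coeff m H = ∑ i ∈ Finset.range (m.degree + 1), coeff m (G i) := rfl
  refine ⟨H, fun k => mem_orderGE_iff_coeff.mpr fun m hm => ?_, hH⟩
  have hzero (i : ℕ) (hi : m.degree < d i) : coeff m (G i) = 0 :=
    coeff_eq_zero_of_mem_orderGE (hG i) hi
  rw [map_sub, map_sum, hH, sub_eq_zero]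
  rcases le_total (m.degree + 1) k with h | h
  · refine Finset.sum_subset (Finset.range_mono h) fun i _ hi => hzero i ?_
    rw [Finset.mem_range, not_lt] at hi
    exact (Nat.lt_of_succ_le hi).trans_le hd.le_apply
  · refine (Finset.sum_subset (Finset.range_mono h) fun i _ hi => hzero i ?_).symm
    rw [Finset.mem_range, not_lt] at hi
    exact hm.trans_le (hd.monotone hi)

theorem exists_sum_smul_of_forall_exists [NormedCommRing R] {P : ℕ → MvPowerSeries σ R}
    {d : ℕ → ℕ} {N : ℕ} {Q : ℕ → MvPowerSeries σ R → Prop} (hd : StrictMono d) (hN : N ≤ d 0)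
    (hP : ∀ k, P k ∈ orderGE σ R (d k))
    (hQ : ∀ k, ∀ S ∈ orderGE σ R N, ∃ c : R, ‖c‖ ≤ 1 ∧
      ∀ T ∈ orderGE σ R (d (k + 1)), Q k (S + c • P k + T)) :
    ∃ G ∈ orderGE σ R N,
      (∀ m, ‖coeff m G‖ ≤ ∑ k ∈ Finset.range (m.degree + 1), ‖coeff m (P k)‖) ∧ ∀ k, Q k G := by
  choose! c hc hcQ using hQ
  let S : ℕ → MvPowerSeries σ R := fun k => Nat.rec 0 (fun k G => G + c k G • P k) k
  have hS (k : ℕ) : S (k + 1) = S k + c k (S k) • P k := rfl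
  have hSsum (k : ℕ) : S k = ∑ l ∈ Finset.range k, c l (S l) • P l := by
    induction k with
    | zero => rfl
    | succ k ih => rw [hS, Finset.sum_range_succ, ← ih]
  have hcP (k : ℕ) : c k (S k) • P k ∈ orderGE σ R (d k) := smul_mem_orderGE (hP k) _
  have hSN (k : ℕ) : S k ∈ orderGE σ R N := by
    rw [hSsum]
    exact Ideal.sum_mem _ fun l _ => orderGE_anti (hN.trans (hd.monotone l.zero_le)) (hcP l)
  obtain ⟨G, hG, hGcoeff⟩ := exists_sum_of_orderGE hd hcP
  simp only [← hSsum] at hG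
  refine ⟨G, orderGE_anti hN ?_, fun m => ?_, fun k => ?_⟩
  · simpa [S] using hG 0
  · rw [hGcoeff]
    refine (norm_sum_le _ _).trans (Finset.sum_le_sum fun l _ => ?_)
    rw [coeff_smul]
    exact (norm_mul_le _ _).trans (mul_le_of_le_one_left (norm_nonneg _) (hc l _ (hSN l)))
  · simpa [← hS] using hcQ k (S k) (hSN k) (G - S (k + 1)) (hG (k + 1))

end InductiveSums

section Divergence

variable {n κ : ℕ} {t : Fin n → ℝ} {i j : Fin n}

variable (κ t i j) in
/-- The predicate that some diagonal normal form of the quadratic part perturbed by `G` has, at the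
multidegree resonant with the exponents `p` and `q` in the planes `i` and `j`, a coefficient of the
size of the inverse of the corresponding small divisor. -/
def HasLargeCoeff (p q : ℕ) (G : MvPowerSeries (Coord n) ℝ) : Prop :=
  ∃ F, IsDiagNormalFormOf (diagSpectrum κ t) F
      (diagonalize n κ (complexify (quadSeries κ t + G))) ∧
    1 / (2 * ‖diagSpectrum κ t j * q - diagSpectrum κ t i * p‖)
      ≤ ‖coeff (actExp (Finsupp.single i (p - 1) + Finsupp.single j q)) F‖

theorem exists_realPair_smul_hasLargeCoeff (hij : i ≠ j) (hκ : (i : ℕ) < κ ↔ (j : ℕ) < κ)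
    {p q : ℕ} (hp : 1 ≤ p) (hpq : 3 ≤ p + q)
    (hδ : diagSpectrum κ t j * q - diagSpectrum κ t i * p ≠ 0)
    {G : MvPowerSeries (Coord n) ℝ} (hG : G ∈ orderGE (Coord n) ℝ 3) :
    ∃ c : ℝ, ‖c‖ ≤ 1 ∧ ∀ R ∈ orderGE (Coord n) ℝ (2 * (p + q) - 1),
      HasLargeCoeff κ t i j p q (G + c • realPair κ i j p q + R) := by
  have hT := isSymplecticAut_diagonalize (n := n) κ
  obtain ⟨a, b, hab, hP⟩ := exists_diagonalize_pairSeries κ i j p q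
  have hH : diagonalize n κ (complexify (quadSeries κ t + G)) - diagQuad (diagSpectrum κ t)
      ∈ orderGE (Coord n) ℂ 3 := by
    rw [← diagonalize_quadSeries, ← map_sub, ← map_sub, add_sub_cancel_left]
    exact hT.map_mem _ _ (map_mem_orderGE _ hG)
  obtain ⟨c, hc, hR⟩ := exists_isDiagNormalFormOf_coeff_ge hH hij hp hpq a b hδ
  refine ⟨c, hc, fun R hRm => ?_⟩
  obtain ⟨F, hF, hFcoeff⟩ := hR (diagonalize n κ (complexify R))
    (hT.map_mem _ _ (map_mem_orderGE _ hRm))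
  refine ⟨F, ?_, (div_le_div_of_nonneg_right hab (by positivity)).trans hFcoeff⟩
  rwa [← hP, ← complexify_realPair p q hκ, ← map_smul, ← complexify_smul, ← map_add, ← map_add,
    ← map_add, ← map_add, add_assoc, add_assoc, ← add_assoc G] at hF

theorem sum_abs_coeff_realPair_le (p q : ℕ → ℕ) (m : Coord n →₀ ℕ) :
    ∑ k ∈ Finset.range (m.degree + 1), |coeff m (realPair κ i j (p k) (q k))|
      ≤ 2 * 4 ^ m.degree := by
  have hdeg : ((m.degree + 1 : ℕ) : ℝ) ≤ 2 ^ m.degree := by exact_mod_cast Nat.lt_two_pow_self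
  calc ∑ k ∈ Finset.range (m.degree + 1), |coeff m (realPair κ i j (p k) (q k))|
      ≤ ∑ _k ∈ Finset.range (m.degree + 1), 2 * (2 : ℝ) ^ m.degree :=
        Finset.sum_le_sum fun k _ => abs_coeff_realPair_le κ i j (p k) (q k) m
    _ = 2 * ((m.degree + 1 : ℕ) * (2 : ℝ) ^ m.degree) := by
        rw [Finset.sum_const, Finset.card_range, nsmul_eq_mul, mul_left_comm]
    _ ≤ 2 * (2 ^ m.degree * 2 ^ m.degree) := by gcongr
    _ = 2 * 4 ^ m.degree := by rw [← mul_pow]; norm_num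

theorem exists_forall_hasLargeCoeff (hij : i ≠ j) (hκ : (i : ℕ) < κ ↔ (j : ℕ) < κ)
    {p q : ℕ → ℕ} (hp : ∀ k, 3 ≤ p k)
    (hpq : ∀ k, 2 * (p k + q k) ≤ p (k + 1) + q (k + 1))
    (hδ : ∀ k, diagSpectrum κ t j * q k - diagSpectrum κ t i * p k ≠ 0) :
    ∃ G ∈ orderGE (Coord n) ℝ 3, (∀ m, |coeff m G| ≤ 2 * 4 ^ m.degree) ∧
      ∀ k, HasLargeCoeff κ t i j (p k) (q k) G := by
  have hd3 (k : ℕ) : 3 ≤ p k + q k := (hp k).trans (Nat.le_add_right _ _)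
  have hd : StrictMono fun k => p k + q k :=
    strictMono_nat_of_lt_succ fun k => by linarith [hd3 k, hpq k]
  obtain ⟨G, hG3, hGcoeff, hGlarge⟩ := exists_sum_smul_of_forall_exists hd (hd3 0)
    (Q := fun k => HasLargeCoeff κ t i j (p k) (q k))
    (fun k => realPair_mem_orderGE κ i j (p k) (q k)) fun k S hS => by
      obtain ⟨c, hc, hcR⟩ := exists_realPair_smul_hasLargeCoeff (t := t) hij hκ
        ((by norm_num : 1 ≤ 3).trans (hp k)) (hd3 k) (hδ k) hS
      exact ⟨c, hc, fun T hT => hcR T (orderGE_anti ((Nat.sub_le _ _).trans (hpq k)) hT)⟩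
  exact ⟨G, hG3, fun m => (hGcoeff m).trans (sum_abs_coeff_realPair_le p q m), hGlarge⟩

theorem HasLargeCoeff.exists_pow_self_le (ht : LinearIndependent ℤ t) {p q : ℕ} (hp : 1 ≤ p)
    (hδ : diagSpectrum κ t j * q - diagSpectrum κ t i * p ≠ 0)
    (hsmall : ‖diagSpectrum κ t j * q - diagSpectrum κ t i * p‖
      ≤ 1 / ((p + q : ℕ) : ℝ) ^ (p + q))
    {G : MvPowerSeries (Coord n) ℝ} (hG : HasLargeCoeff κ t i j p q G)
    {F : MvPowerSeries (Coord n) ℝ}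
    (hF : IsBirkhoffNormalFormOf κ (spectrumOf κ t) F (quadSeries κ t + G)) :
    ∃ m : Coord n →₀ ℕ, m.degree = 2 * (p + q - 1) ∧
      ((p + q : ℕ) : ℝ) ^ (p + q) / 2 ≤ 2 ^ (p + q - 1) * |coeff m F| := by
  obtain ⟨F₁, hF₁, hlarge⟩ := hG
  obtain ⟨m, hm, hmF⟩ := exists_coeff_ge κ ht.injective (linearIndependent_diagSpectrum κ ht) hF hF₁
    (Finsupp.single i (p - 1) + Finsupp.single j q)
  have hdeg : (Finsupp.single i (p - 1) + Finsupp.single j q).degree = p + q - 1 := by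
    rw [map_add, Finsupp.degree_single, Finsupp.degree_single, Nat.sub_add_comm hp]
  rw [hdeg] at hm hmF
  refine ⟨m, hm, le_trans ?_ (hlarge.trans hmF)⟩
  rw [mul_comm (2 : ℝ) ‖_‖, ← div_div, div_le_div_iff_of_pos_right two_pos]
  have hpq : (0 : ℝ) < ((p + q : ℕ) : ℝ) := Nat.cast_pos.mpr (Nat.add_pos_left hp q)
  exact (le_one_div (norm_pos_iff.mpr hδ) (pow_pos hpq _)).mp hsmall

theorem exists_forall_not_isConvergent (ht : LinearIndependent ℤ t) (hij : i ≠ j)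
    (hκ : (i : ℕ) < κ ↔ (j : ℕ) < κ) {p q : ℕ → ℕ} (hp : ∀ k, 3 ≤ p k) (hq : ∀ k, 1 ≤ q k)
    (hpq : ∀ k, 2 * (p k + q k) ≤ p (k + 1) + q (k + 1))
    (hsmall : ∀ k, ‖diagSpectrum κ t j * q k - diagSpectrum κ t i * p k‖
      ≤ 1 / ((p k + q k : ℕ) : ℝ) ^ (p k + q k)) :
    ∃ G ∈ orderGE (Coord n) ℝ 3, (∀ m, |coeff m G| ≤ 2 * 4 ^ m.degree) ∧
      ∀ F, IsBirkhoffNormalFormOf κ (spectrumOf κ t) F (quadSeries κ t + G) →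
        ¬ IsConvergent F := by
  have hδ (k : ℕ) : diagSpectrum κ t j * q k - diagSpectrum κ t i * p k ≠ 0 :=
    mul_natCast_sub_ne_zero_of_linearIndependent (linearIndependent_diagSpectrum κ ht) hij _
      (Nat.one_le_iff_ne_zero.mp (hq k))
  obtain ⟨G, hG3, hGcoeff, hGlarge⟩ := exists_forall_hasLargeCoeff hij hκ hp hpq hδ
  refine ⟨G, hG3, hGcoeff, fun F hF => not_isConvergent_of_pow_self_le (d := fun k => p k + q k)
    (strictMono_nat_of_lt_succ fun k => by linarith [hp k, hpq k]) fun k => ?_⟩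
  exact (hGlarge k).exists_pow_self_le ht ((by norm_num : 1 ≤ 3).trans (hp k)) (hδ k) (hsmall k) hF

theorem exists_consecutive (hn : 2 ≤ n) (hexc : ¬ (n = 2 ∧ κ = 1)) :
    ∃ i j : Fin n, (j : ℕ) = i + 1 ∧ ((i : ℕ) < κ ↔ (j : ℕ) < κ) := by
  by_cases h : 2 ≤ κ
  · exact ⟨⟨0, by omega⟩, ⟨1, by omega⟩, rfl, by simp only; omega⟩
  · exact ⟨⟨n - 2, by omega⟩, ⟨n - 1, by omega⟩, by simp only; omega, by simp only; omega⟩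

end Divergence

end Birkhoff

open Birkhoff

theorem theorem1 (n κ : ℕ) (hn : 2 ≤ n) (hκ : κ ≤ n) (hexc : ¬ (n = 2 ∧ κ = 1)) :
    ∃ (lam : Fin n → ℂ) (h : (Birkhoff.Coord n → ℝ) → ℝ)
      (H : MvPowerSeries (Birkhoff.Coord n) ℝ),
      Birkhoff.IsSpectrum κ lam ∧
      Birkhoff.NonResonant lam ∧
      AnalyticAt ℝ h 0 ∧
      ((fun z => h z - Birkhoff.quadraticPart κ lam z) =O[𝓝 0] fun z => ‖z‖ ^ 3) ∧
      Birkhoff.HasExpansion h H ∧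
      (∃ F, Birkhoff.IsBirkhoffNormalFormOf κ lam F H) ∧
      ∀ F, Birkhoff.IsBirkhoffNormalFormOf κ lam F H → ¬ Birkhoff.IsConvergent F := by
  obtain ⟨x, hx0, hx1, hxT, hx⟩ := exists_transcendental_approximable
  obtain ⟨p, q, hp, hq, hxpq, hpq⟩ := exists_sparse_exponents hx
  obtain ⟨i, j, hij, hκij⟩ := exists_consecutive (κ := κ) hn hexc
  have hne : i ≠ j := fun h => by simp [h] at hij
  set t : Fin n → ℝ := fun l => x ^ (l : ℕ)
  have ht : LinearIndependent ℤ t :=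
    (linearIndependent_pow_of_transcendental hxT).comp _ Fin.val_injective
  have habs : |x| ≤ 1 := abs_le.mpr ⟨by linarith, hx1.le⟩
  obtain ⟨G, hG3, hGcoeff, hdiv⟩ := exists_forall_not_isConvergent ht hne hκij hp
    hq hpq fun k => (norm_diagSpectrum_sub_le κ hij hκij habs _ _).trans (hxpq k).le
  obtain ⟨g, hg, hgO, hgG⟩ := exists_analyticAt_hasExpansion (r := 1 / 8) (by norm_num)
    (summable_abs_coeff_mul_pow hGcoeff (by norm_num) (by norm_num) (by norm_num)) hG3
  refine ⟨spectrumOf κ t, fun z => quadraticPart κ (spectrumOf κ t) z + g z, quadSeries κ t + G,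
    isSpectrum_spectrumOf κ ht.ne_zero, nonResonant_spectrumOf κ ht,
    (analyticAt_quadraticPart κ ht.injective).add hg, by simpa using hgO, ?_,
    exists_isBirkhoffNormalFormOf ht.injective (linearIndependent_diagSpectrum κ ht)
      (by rwa [add_sub_cancel_left]), hdiv⟩
  exact hgG.mono fun z hz => hasSum_term_add (hasSum_term_quadSeries κ ht.injective z) hz
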